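/- Let $p$ be a prime. For a finite-dimensional $\mathbb F_p$-vector space $V$ of dimension $n\ge 2$, let $\mathrm{St}(V)=\widetilde H_{n-2}(\mathcal T(V);\mathbb Q)$ be its Steinberg module, where the Tits building $\mathcal T(V)$ is the simplicial complex of flags of nonzero proper subspaces of $V$. A sequence $B=(v_1,\dots,v_n)$ of nonzero vectors of $V$ determines an apartment class $A_B\in\mathrm{St}(V)$: the image of the fundamental class of the barycentric subdivision of the boundary of an $(n-1)$-simplex under the map $I\mapsto\langle v_i : i\in I\rangle$ for $\emptyset\neq I\subsetneq\{1,\dots,n\}$. If $V$ is symplectic, let $\mathrm{St}^{sep}(V)\subseteq\mathrm{St}(V)$ be the span of those $A_B$ for which there is an orthogonal splitting $V=S_1\oplus S_2$ with $S_1,S_2\ne 0$ and every $v_i$ in $S_1$ or $S_2$, and let $\mathrm{St}^{ns}(V)=\mathrm{St}(V)/\mathrm{St}^{sep}(V)$. Let $g\ge 1$ and give $\mathbb F_p^{2g}$ the standard symplectic form. A symplectic splitting is an unordered set $S=\{S_1,\dots,S_k\}$ of nonzero pairwise orthogonal subspaces of which $\mathbb F_p^{2g}$ is the internal direct sum (the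 form then restricts to a symplectic form on each $S_i$). Let $\mathfrak S_g$ be the set of all symplectic splittings, including $\{\mathbb F_p^{2g}\}$. For $S\in\mathfrak S_g$ let $\mathrm{St}^{ns}(S)$ be the unordered tensor product of $\mathrm{St}^{ns}(S_1),\dots,\mathrm{St}^{ns}(S_k)$ over $\mathbb Q$, that is, the coinvariants of the symmetric group on $k$ letters acting, by permuting tensor factors, on the direct sum over all orderings $(S_{i_1},\dots,S_{i_k})$ of $S$ of the tensor products $\mathrm{St}^{ns}(S_{i_1})\otimes\cdots\otimes\mathrm{St}^{ns}(S_{i_k})$. Let $\mathrm{Sp}(S)$ be the stabilizer of $S$ in $\mathrm{Sp}_{2g}(\mathbb F_p)$; it acts on $\mathrm{St}^{ns}(S)$, and $\mathrm{Sp}_{2g}(\mathbb F_p)$ acts on $\bigoplus_{S\in\mathfrak S_g}\mathrm{St}^{ns}(S)$, with $A$ taking the summand of $S$ to that of $A(S)$. **Theorem.** Write $\mathrm{St}_{2g}(\mathbb F_p)=\mathrm{St}(\mathbb F_p^{2g})$ for the Steinberg representation of $\mathrm{SL}_{2g}(\mathbb F_p)$. There is an isomorphism of $\mathbb Q$-vector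 spaces $$\mathrm{St}_{2g}(\mathbb F_p)\;\cong\;\bigoplus_{S\in\mathfrak S_g}\mathrm{St}^{ns}(S)$$ that is an isomorphism of representations of $\mathrm{Sp}_{2g}(\mathbb F_p)$. Consequently, for every set $U\subseteq\mathfrak S_g$ that contains exactly one representative of each $\mathrm{Sp}_{2g}(\mathbb F_p)$-orbit, there is an isomorphism of $\mathrm{Sp}_{2g}(\mathbb F_p)$-representations $$\mathrm{St}_{2g}(\mathbb F_p)\;\cong\;\bigoplus_{S\in U}\mathrm{Ind}_{\mathrm{Sp}(S)}^{\mathrm{Sp}_{2g}(\mathbb F_p)}\mathrm{St}^{ns}(S).$$ -/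

import Mathlib

open scoped DirectSum TensorProduct

noncomputable section

section OrderComplex

variable {P Q R : Type*} [PartialOrder P] [PartialOrder Q] [PartialOrder R]

variable (P) in
/-- A simplex with `m` vertices (so of dimension `m - 1`) of the order complex of a poset `P`:
a strictly increasing sequence of length `m`.  For `m = 0` this is the empty simplex. -/
abbrev FlagSimplex (m : ℕ) : Type _ := {c : Fin m → P // StrictMono c}

variable (P) in
/-- The degree `m - 1` term of the augmented oriented simplicial chain complex, with rational
coefficients, of the order complex of `P`. The vertices of each simplex are ordered by the order
of `P`.  For `m = 0` it is a copy of `ℚ`. -/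
abbrev FlagChain (m : ℕ) : Type _ := FlagSimplex P m →₀ ℚ

/-- The boundary map `∂ (x₀ < ⋯ < xₘ) = ∑ᵢ (-1)ⁱ (x₀ < ⋯ < x̂ᵢ < ⋯ < xₘ)` from degree `m` to
degree `m - 1`. For `m = 0` it is the augmentation. -/
def flagBoundary (P : Type*) [PartialOrder P] (m : ℕ) :
    FlagChain P (m + 1) →ₗ[ℚ] FlagChain P m :=
  Finsupp.linearCombination ℚ fun c : FlagSimplex P (m + 1) =>
    ∑ i : Fin (m + 1), (-1 : ℚ) ^ (i : ℕ) •
      Finsupp.single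
        (⟨c.1 ∘ i.succAbove, c.2.comp (Fin.strictMono_succAbove i)⟩ : FlagSimplex P m) (1 : ℚ)

/-- The cycles of degree `m - 1`. -/
def flagCycles (P : Type*) [PartialOrder P] : (m : ℕ) → Submodule ℚ (FlagChain P m)
  | 0 => ⊤
  | m + 1 => LinearMap.ker (flagBoundary P m)

/-- The boundaries of degree `m - 1`. -/
def flagBoundaries (P : Type*) [PartialOrder P] (m : ℕ) : Submodule ℚ (FlagChain P m) :=
  LinearMap.range (flagBoundary P m)

/-- The reduced simplicial homology group `H̃_{m-1}`, with rational coefficients, of the order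
complex of the poset `P`. -/
def FlagHomology (P : Type*) [PartialOrder P] (m : ℕ) : Type _ :=
  flagCycles P m ⧸ (flagBoundaries P m).submoduleOf (flagCycles P m)

instance (m : ℕ) : AddCommGroup (FlagHomology P m) :=
  inferInstanceAs (AddCommGroup (flagCycles P m ⧸ _))

instance (m : ℕ) : Module ℚ (FlagHomology P m) :=
  inferInstanceAs (Module ℚ (flagCycles P m ⧸ _))

/-- The homology class of a cycle. -/
def FlagHomology.mk (P : Type*) [PartialOrder P] (m : ℕ) :
    flagCycles P m →ₗ[ℚ] FlagHomology P m :=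
  Submodule.mkQ _

open Classical in
/-- The oriented simplex spanned by a sequence of vertices, which is `0` when the sequence
is not strictly increasing. It is used for weakly increasing sequences, where it is `0`
precisely for the degenerate ones. -/
def flagSimplex {m : ℕ} (c : Fin m → P) : FlagChain P m :=
  if h : StrictMono c then Finsupp.single ⟨c, h⟩ 1 else 0

lemma flagSimplex_of_strictMono {m : ℕ} {c : Fin m → P} (h : StrictMono c) :
    flagSimplex c = Finsupp.single ⟨c, h⟩ 1 := dif_pos h

lemma flagSimplex_of_eq {m : ℕ} {c : Fin m → P} {i j : Fin m} (hij : i ≠ j) (h : c i = c j) :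
    flagSimplex c = 0 := dif_neg fun hc => hij (hc.injective h)

lemma flagBoundary_flagSimplex {m : ℕ} {c : Fin (m + 1) → P} (hc : Monotone c) :
    flagBoundary P m (flagSimplex c) =
      ∑ i : Fin (m + 1), (-1 : ℚ) ^ (i : ℕ) • flagSimplex (c ∘ i.succAbove) := by
  by_cases h : StrictMono c
  · rw [flagSimplex_of_strictMono h, flagBoundary, Finsupp.linearCombination_single, one_smul]
    refine Finset.sum_congr rfl fun i _ => ?_
    rw [flagSimplex_of_strictMono (h.comp (Fin.strictMono_succAbove i))]
  · obtain ⟨i, hi⟩ : ∃ i : Fin m, c i.castSucc = c i.succ := by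
      by_contra! hne
      exact h (Fin.strictMono_iff_lt_succ.2 fun i =>
        lt_of_le_of_ne (hc (Fin.castSucc_lt_succ (i := i)).le) (hne i))
    have h0 : flagSimplex c = 0 :=
      flagSimplex_of_eq (Fin.castSucc_lt_succ (i := i)).ne hi
    rw [h0, map_zero]
    symm
    rw [Finset.sum_eq_add_of_mem i.castSucc i.succ (Finset.mem_univ _) (Finset.mem_univ _)
      (Fin.castSucc_lt_succ (i := i)).ne]
    · have : c ∘ i.castSucc.succAbove = c ∘ i.succ.succAbove := by
        funext j
        simp only [Function.comp]
        rcases lt_trichotomy j i with hj | hj | hj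
        · rw [Fin.succAbove_of_castSucc_lt _ _ (by simpa using hj),
            Fin.succAbove_of_castSucc_lt _ _ (by
              rw [Fin.lt_def] at *; simp; omega)]
        · subst hj
          rw [Fin.succAbove_castSucc_self, Fin.succAbove_succ_self, hi]
        · rw [Fin.succAbove_of_le_castSucc _ _ (by simpa using hj.le),
            Fin.succAbove_of_le_castSucc _ _ (by
              rw [Fin.lt_def] at hj; rw [Fin.le_def]; simp; omega)]
      rw [this, ← add_smul]
      simp [pow_succ]
    · intro k _ hk
      obtain ⟨a, ha⟩ := Fin.exists_succAbove_eq hk.1.symm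
      obtain ⟨b, hb⟩ := Fin.exists_succAbove_eq hk.2.symm
      rw [flagSimplex_of_eq (i := a) (j := b), smul_zero]
      · rintro rfl
        exact (Fin.castSucc_lt_succ (i := i)).ne (ha.symm.trans hb)
      · simp [ha, hb, hi]

lemma flagBoundary_comp_flagBoundary (m : ℕ) :
    flagBoundary P m ∘ₗ flagBoundary P (m + 1) = 0 := by
  refine Finsupp.lhom_ext' fun c => LinearMap.ext_ring ?_
  simp only [LinearMap.comp_apply, LinearMap.zero_apply, Finsupp.lsingle_apply]
  rw [← flagSimplex_of_strictMono c.2, flagBoundary_flagSimplex c.2.monotone, map_sum]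
  have h : ∀ i : Fin (m + 2), flagBoundary P m
      ((-1 : ℚ) ^ (i : ℕ) • flagSimplex (c.1 ∘ i.succAbove)) =
      ∑ j : Fin (m + 1), ((-1 : ℚ) ^ (i + j : ℕ)) •
        flagSimplex (c.1 ∘ i.succAbove ∘ j.succAbove) := by
    intro i
    rw [map_smul, flagBoundary_flagSimplex (c.2.monotone.comp (Fin.strictMono_succAbove i).monotone),
      Finset.smul_sum]
    refine Finset.sum_congr rfl fun j _ => ?_
    rw [smul_smul, pow_add]; rfl
  rw [Finset.sum_congr rfl fun i _ => h i, ← Finset.sum_product', Finset.univ_product_univ]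
  refine Finset.sum_involution (fun x _ => (x.1.succAbove x.2, x.2.predAbove x.1)) ?_ ?_ ?_ ?_
  · rintro ⟨i, j⟩ _
    have e : c.1 ∘ (i.succAbove j).succAbove ∘ (j.predAbove i).succAbove =
        c.1 ∘ i.succAbove ∘ j.succAbove := by
      funext k
      simp [Fin.succAbove_succAbove_succAbove_predAbove]
    simp only [e, ← add_smul]
    rw [Fin.neg_one_pow_succAbove_add_predAbove]
    simp [pow_add]
  · rintro ⟨i, j⟩ _ _ h
    exact Fin.succAbove_ne i j (congrArg Prod.fst h)
  · exact fun _ _ => Finset.mem_univ _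
  · rintro ⟨i, j⟩ _
    simp [Fin.succAbove_succAbove_predAbove, Fin.predAbove_predAbove_succAbove]

/-- The map on simplicial chains induced by a monotone map `f`. Simplices with degenerate image
go to `0`.  The degree of the target is only propositionally equal to that of the source. -/
def flagChainMap (f : P →o Q) {m m' : ℕ} (h : m = m') : FlagChain P m →ₗ[ℚ] FlagChain Q m' :=
  Finsupp.linearCombination ℚ fun c => flagSimplex (f ∘ c.1 ∘ Fin.cast h.symm)

lemma flagChainMap_flagSimplex (f : P →o Q) {m m' : ℕ} (h : m = m') {c : Fin m → P}
    (hc : Monotone c) :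
    flagChainMap f h (flagSimplex c) = flagSimplex (f ∘ c ∘ Fin.cast h.symm) := by
  subst h
  by_cases hs : StrictMono c
  · rw [flagSimplex_of_strictMono hs, flagChainMap, Finsupp.linearCombination_single, one_smul]
  · obtain ⟨i, j, hij, hcij⟩ : ∃ i j, i ≠ j ∧ c i = c j := by
      by_contra! hne
      exact hs (hc.strictMono_of_injective fun i j hij => by
        by_contra hn
        exact hne i j hn hij)
    rw [flagSimplex_of_eq hij hcij, map_zero]
    exact (flagSimplex_of_eq hij (by simp [hcij])).symm

lemma flagBoundary_flagChainMap (f : P →o Q) {m : ℕ} (x : FlagChain P (m + 1)) :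
    flagBoundary Q m (flagChainMap f rfl x) = flagChainMap f rfl (flagBoundary P m x) := by
  induction x using Finsupp.induction_linear with
  | zero => simp
  | add x y hx hy => simp [hx, hy]
  | single c a =>
    have hc : Finsupp.single c a = a • flagSimplex c.1 := by
      rw [flagSimplex_of_strictMono c.2]; simp
    rw [hc]
    simp only [map_smul]
    rw [flagChainMap_flagSimplex f rfl c.2.monotone, flagBoundary_flagSimplex c.2.monotone,
      map_sum]
    refine congrArg (a • ·) ((flagBoundary_flagSimplex (f.monotone.comp c.2.monotone)).trans ?_)
    refine Finset.sum_congr rfl fun i _ => ?_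
    rw [map_smul, flagChainMap_flagSimplex f rfl
      (c.2.monotone.comp (Fin.strictMono_succAbove i).monotone)]
    rfl

lemma flagChainMap_mem_cycles (f : P →o Q) {m m' : ℕ} (h : m = m') (x : FlagChain P m)
    (hx : x ∈ flagCycles P m) : flagChainMap f h x ∈ flagCycles Q m' := by
  subst h
  cases m with
  | zero => trivial
  | succ m =>
    simp only [flagCycles, LinearMap.mem_ker] at hx ⊢
    rw [flagBoundary_flagChainMap, hx, map_zero]

lemma flagChainMap_mem_boundaries (f : P →o Q) {m m' : ℕ} (h : m = m') (x : FlagChain P m)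
    (hx : x ∈ flagBoundaries P m) : flagChainMap f h x ∈ flagBoundaries Q m' := by
  subst h
  obtain ⟨y, rfl⟩ := hx
  exact ⟨flagChainMap f rfl y, flagBoundary_flagChainMap f y⟩

/-- The map on reduced homology induced by a monotone map. -/
def FlagHomology.map (f : P →o Q) {m m' : ℕ} (h : m = m') :
    FlagHomology P m →ₗ[ℚ] FlagHomology Q m' :=
  Submodule.mapQ _ _
    ((flagChainMap f h).restrict (p := flagCycles P m) (q := flagCycles Q m')
      (flagChainMap_mem_cycles f h))
    (fun x hx => flagChainMap_mem_boundaries f h x.1 hx)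

lemma FlagHomology.map_mk (f : P →o Q) {m m' : ℕ} (h : m = m') (x : flagCycles P m) :
    FlagHomology.map f h (FlagHomology.mk P m x) =
      FlagHomology.mk Q m' ⟨flagChainMap f h x.1, flagChainMap_mem_cycles f h x.1 x.2⟩ := rfl

lemma FlagHomology.mk_surjective (m : ℕ) : Function.Surjective (FlagHomology.mk P m) :=
  Submodule.mkQ_surjective _

lemma flagChainMap_id {m : ℕ} (f : P →o P) (hf : ∀ x, f x = x) (h : m = m) (x : FlagChain P m) :
    flagChainMap f h x = x := by
  induction x using Finsupp.induction_linear with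
  | zero => simp
  | add x y hx hy => simp [hx, hy]
  | single c a =>
    have hc : (f ∘ c.1 ∘ Fin.cast h.symm) = c.1 := by
      funext i; simp [hf]
    rw [flagChainMap, Finsupp.linearCombination_single, hc, flagSimplex_of_strictMono c.2]
    simp

lemma flagChainMap_comp {m m' m'' : ℕ} (f : P →o Q) (g : Q →o R) (k : P →o R)
    (hk : ∀ x, g (f x) = k x) (h : m = m') (h' : m' = m'') (h'' : m = m'') (x : FlagChain P m) :
    flagChainMap g h' (flagChainMap f h x) = flagChainMap k h'' x := by
  subst h h'
  induction x using Finsupp.induction_linear with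
  | zero => simp
  | add x y hx hy => simp [hx, hy]
  | single c a =>
    have hc : Finsupp.single c a = a • flagSimplex c.1 := by
      rw [flagSimplex_of_strictMono c.2]; simp
    rw [hc]
    simp only [map_smul]
    rw [flagChainMap_flagSimplex f _ c.2.monotone, flagChainMap_flagSimplex k _ c.2.monotone]
    refine congrArg (a • ·)
      ((flagChainMap_flagSimplex g _ (f.monotone.comp c.2.monotone)).trans ?_)
    congr 1
    funext i
    exact hk _

lemma FlagHomology.map_id {m : ℕ} (f : P →o P) (hf : ∀ x, f x = x) (h : m = m)
    (x : FlagHomology P m) : FlagHomology.map f h x = x := by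
  obtain ⟨x, rfl⟩ := FlagHomology.mk_surjective m x
  rw [FlagHomology.map_mk]
  congr 1
  exact Subtype.ext (flagChainMap_id f hf h x.1)

lemma FlagHomology.map_map {m m' m'' : ℕ} (f : P →o Q) (g : Q →o R) (k : P →o R)
    (hk : ∀ x, g (f x) = k x) (h : m = m') (h' : m' = m'') (h'' : m = m'')
    (x : FlagHomology P m) :
    FlagHomology.map g h' (FlagHomology.map f h x) = FlagHomology.map k h'' x := by
  obtain ⟨x, rfl⟩ := FlagHomology.mk_surjective m x
  simp only [FlagHomology.map_mk]
  congr 1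
  exact Subtype.ext (flagChainMap_comp f g k hk h h' h'' x.1)

end OrderComplex

section Steinberg

variable (K : Type*) [Field K] {V W X : Type*} [AddCommGroup V] [Module K V]
  [AddCommGroup W] [Module K W] [AddCommGroup X] [Module K X]

/-- The vertices of the Tits building of `V`: the nonzero proper subspaces, ordered by inclusion.
The simplices of the building are the flags of such subspaces, so the building is the
order complex of this poset. -/
abbrev TitsVertex (V : Type*) [AddCommGroup V] [Module K V] : Type _ :=
  {U : Submodule K V // U ≠ ⊥ ∧ U ≠ ⊤}

/-- The Steinberg module `St(V) = H̃_{n-2}(Tits(V); ℚ)`, where `n = dim V ≥ 2`. A simplex of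
dimension `n - 2` has `n - 1` vertices. -/
def Steinberg (V : Type*) [AddCommGroup V] [Module K V] : Type _ :=
  FlagHomology (TitsVertex K V) (Module.finrank K V - 1)

instance : AddCommGroup (Steinberg K V) :=
  inferInstanceAs (AddCommGroup (FlagHomology _ _))

instance : Module ℚ (Steinberg K V) :=
  inferInstanceAs (Module ℚ (FlagHomology _ _))

variable {K}

/-- The map of Tits buildings induced by a linear isomorphism. -/
def titsMap (e : V ≃ₗ[K] W) : TitsVertex K V →o TitsVertex K W where
  toFun U := ⟨U.1.map (e : V →ₗ[K] W), by
    refine ⟨fun h => U.2.1 ?_, fun h => U.2.2 ?_⟩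
    · exact (Submodule.map_eq_bot_iff (e := e)).1 h
    · refine Submodule.map_injective_of_injective (f := (e : V →ₗ[K] W)) e.injective ?_
      rw [h, Submodule.map_top, LinearEquiv.range]⟩
  monotone' _ _ h := Submodule.map_mono h

/-- The isomorphism of Steinberg modules induced by a linear isomorphism. -/
def Steinberg.map (e : V ≃ₗ[K] W) : Steinberg K V →ₗ[ℚ] Steinberg K W :=
  FlagHomology.map (titsMap e) (by rw [e.finrank_eq])

lemma Steinberg.map_refl (x : Steinberg K V) : Steinberg.map (LinearEquiv.refl K V) x = x :=
  FlagHomology.map_id _ (fun U => Subtype.ext (Submodule.map_id U.1)) _ x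

lemma Steinberg.map_trans (e : V ≃ₗ[K] W) (e' : W ≃ₗ[K] X) (x : Steinberg K V) :
    Steinberg.map (e.trans e') x = Steinberg.map e' (Steinberg.map e x) :=
  (FlagHomology.map_map _ _ _ (fun U => Subtype.ext (Submodule.map_comp _ _ U.1).symm) _ _ _ x).symm

variable (K V) in
/-- The action of the linear automorphisms of `V` on `St(V)`. -/
def steinbergRep : Representation ℚ (V ≃ₗ[K] V) (Steinberg K V) where
  toFun e := Steinberg.map e
  map_one' := LinearMap.ext Steinberg.map_refl
  map_mul' e e' := LinearMap.ext (Steinberg.map_trans e' e)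

/-- The nonempty proper subsets of `{1, …, n}`. The order complex of this poset is the boundary
of the barycentric subdivision of an `(n-1)`-simplex. -/
abbrev ProperSubset (n : ℕ) : Type :=
  {I : Finset (Fin n) // I.Nonempty ∧ I ≠ Finset.univ}

/-- The maximal flag `{σ 1} ⊂ {σ 1, σ 2} ⊂ ⋯ ⊂ {σ 1, …, σ (n-1)}` of proper subsets. -/
def permFlag (n : ℕ) (σ : Equiv.Perm (Fin n)) (j : Fin (n - 1)) : ProperSubset n :=
  ⟨(Finset.univ.filter fun i : Fin n => (i : ℕ) ≤ j).map σ.toEmbedding, by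
    have hj := j.2
    constructor
    · exact (Finset.map_nonempty).2 ⟨⟨0, by omega⟩, by simp⟩
    · intro h
      have h1 := Finset.mem_univ (σ ⟨n - 1, by omega⟩)
      rw [← h] at h1
      simp at h1
      omega⟩

lemma permFlag_monotone (n : ℕ) (σ : Equiv.Perm (Fin n)) : Monotone (permFlag n σ) := by
  intro j k hjk
  refine Finset.map_subset_map.2 fun i hi => ?_
  simp only [Finset.mem_filter, Finset.mem_univ, true_and] at hi ⊢
  exact hi.trans hjk

/-- The fundamental cycle of the `(n-2)`-sphere that is the order complex of `ProperSubset n`. -/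
def fundamentalChain (n : ℕ) : FlagChain (ProperSubset n) (n - 1) :=
  ∑ σ : Equiv.Perm (Fin n), ((Equiv.Perm.sign σ : ℤ) : ℚ) • flagSimplex (permFlag n σ)

lemma permFlag_swap (n : ℕ) (σ : Equiv.Perm (Fin (n + 2))) (i : Fin (n + 1)) :
    permFlag (n + 2) (σ * Equiv.swap i.castSucc i.succ) ∘ i.succAbove =
      permFlag (n + 2) σ ∘ i.succAbove := by
  funext j
  have hj : i.succAbove j ≠ i := Fin.succAbove_ne i j
  refine Subtype.ext (Finset.ext fun x => ?_)
  simp only [Function.comp, permFlag, Finset.mem_map_equiv, Finset.mem_filter, Finset.mem_univ,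
    true_and]
  have : (Equiv.symm (σ * Equiv.swap i.castSucc i.succ)) x =
      Equiv.swap i.castSucc i.succ (σ.symm x) := by
    rw [Equiv.symm_apply_eq]; simp
  rw [this]
  generalize σ.symm x = y
  have hj' : ((i.succAbove j : Fin (n + 1)) : ℕ) ≠ i := fun h => hj (Fin.ext h)
  generalize i.succAbove j = k at *
  rcases eq_or_ne y i.castSucc with rfl | h1
  · rw [Equiv.swap_apply_left]; simp; omega
  · rcases eq_or_ne y i.succ with rfl | h2
    · rw [Equiv.swap_apply_right]; simp; omega
    · rw [Equiv.swap_apply_of_ne_of_ne h1 h2]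

lemma fundamentalChain_mem_cycles (n : ℕ) :
    fundamentalChain n ∈ flagCycles (ProperSubset n) (n - 1) := by
  match n with
  | 0 => trivial
  | 1 => trivial
  | n + 2 =>
    change fundamentalChain (n + 2) ∈ LinearMap.ker (flagBoundary (ProperSubset (n + 2)) n)
    rw [LinearMap.mem_ker, fundamentalChain, map_sum]
    have h1 : ∀ σ : Equiv.Perm (Fin (n + 2)),
        flagBoundary (ProperSubset (n + 2)) n
          (((Equiv.Perm.sign σ : ℤ) : ℚ) • flagSimplex (permFlag (n + 2) σ)) =
        ∑ i : Fin (n + 1), ((Equiv.Perm.sign σ : ℤ) : ℚ) • ((-1 : ℚ) ^ (i : ℕ) •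
          flagSimplex (permFlag (n + 2) σ ∘ i.succAbove)) := by
      intro σ
      rw [map_smul, ← Finset.smul_sum]
      congr 1
      exact flagBoundary_flagSimplex (permFlag_monotone (n + 2) σ)
    rw [Finset.sum_congr rfl fun σ _ => h1 σ, Finset.sum_comm]
    refine Finset.sum_eq_zero fun i _ => ?_
    refine Finset.sum_involution
      (fun σ _ => σ * Equiv.swap i.castSucc i.succ) ?_ ?_ ?_ ?_
    · intro σ _
      rw [permFlag_swap, Equiv.Perm.sign_mul,
        Equiv.Perm.sign_swap (Fin.castSucc_lt_succ (i := i)).ne]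
      simp
    · intro σ _ _ h
      have := mul_eq_left.1 h
      rw [Equiv.swap_eq_one_iff] at this
      exact (Fin.castSucc_lt_succ (i := i)).ne this
    · intro σ _
      exact Finset.mem_univ _
    · intro σ _
      simp [mul_assoc]

/-- The fundamental class of the `(n-2)`-sphere that is the order complex of `ProperSubset n`. -/
def fundamentalClass (n : ℕ) : FlagHomology (ProperSubset n) (n - 1) :=
  FlagHomology.mk _ _ ⟨fundamentalChain n, fundamentalChain_mem_cycles n⟩

/-- The map `I ↦ ⟨vᵢ | i ∈ I⟩` from proper subsets of `{1, …, n}` to the Tits building of `V`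
determined by `n = dim V` nonzero vectors `v₁, …, vₙ` in `V`. -/
def spanMap {n : ℕ} (hn : Module.finrank K V = n) (B : Fin n → V) (hB : ∀ i, B i ≠ 0) :
    ProperSubset n →o TitsVertex K V where
  toFun I := ⟨Submodule.span K (B '' I.1), by
    classical
    constructor
    · obtain ⟨i, hi⟩ := I.2.1
      intro h
      exact hB i ((Submodule.span_eq_bot.1 h) _ ⟨i, hi, rfl⟩)
    · intro h
      have h1 := finrank_span_finset_le_card (R := K) (I.1.image B)
      rw [Finset.coe_image, Set.finrank, h, finrank_top, hn] at h1
      have h2 := Finset.card_image_le (s := I.1) (f := B)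
      have h3 := (Finset.card_lt_iff_ne_univ I.1).2 I.2.2
      rw [Fintype.card_fin] at h3
      omega⟩
  monotone' _ _ h := Submodule.span_mono (Set.image_mono h)

/-- The apartment class in `St(V)` of an ordered sequence of `n = dim V` nonzero vectors: the
image of the fundamental class under `spanMap`. -/
def apartment {n : ℕ} (hn : Module.finrank K V = n) (B : Fin n → V) (hB : ∀ i, B i ≠ 0) :
    Steinberg K V :=
  FlagHomology.map (spanMap hn B hB) (by rw [hn]) (fundamentalClass n)

lemma Steinberg.map_apartment (e : V ≃ₗ[K] W) {n : ℕ} (hn : Module.finrank K V = n)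
    (B : Fin n → V) (hB : ∀ i, B i ≠ 0) :
    Steinberg.map e (apartment hn B hB) =
      apartment (e.finrank_eq.symm.trans hn) (e ∘ B) (fun i => by simpa using hB i) := by
  refine FlagHomology.map_map _ _ _ (fun I => Subtype.ext ?_) _ _ _ _
  change (Submodule.span K (B '' I.1)).map (e : V →ₗ[K] W) = Submodule.span K ((e ∘ B) '' I.1)
  rw [Submodule.map_span, Set.image_comp]
  rfl

end Steinberg

section UnorderedTensor

open scoped Classical

variable {ι ι' ι'' : Type*} [Fintype ι] [Fintype ι'] [Fintype ι'']

/-- The orderings of a finite index set of cardinality `k`: the tuples `(e 1, …, e k)` in which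
every index occurs exactly once. -/
abbrev FamilyOrdering (ι : Type*) [Fintype ι] : Type _ :=
  {e : Fin (Fintype.card ι) → ι // Function.Bijective e}

/-- Permuting an ordering: the entry in position `j` moves to position `σ j`. -/
abbrev FamilyOrdering.permute (σ : Equiv.Perm (Fin (Fintype.card ι))) (e : FamilyOrdering ι) :
    FamilyOrdering ι :=
  ⟨fun j => e.1 (σ.symm j), e.2.comp σ.symm.bijective⟩

/-- Transporting an ordering along a bijection of index sets. -/
abbrev FamilyOrdering.transport (g : ι ≃ ι') (e : FamilyOrdering ι) : FamilyOrdering ι' :=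
  ⟨fun j => g (e.1 ((finCongr (Fintype.card_congr g)).symm j)),
    g.bijective.comp (e.2.comp (finCongr (Fintype.card_congr g)).symm.bijective)⟩

variable (M : ι → Type*) [∀ i, AddCommGroup (M i)] [∀ i, Module ℚ (M i)]
variable (M' : ι' → Type*) [∀ i, AddCommGroup (M' i)] [∀ i, Module ℚ (M' i)]
variable (M'' : ι'' → Type*) [∀ i, AddCommGroup (M'' i)] [∀ i, Module ℚ (M'' i)]

/-- The direct sum, over all orderings `(i₁, …, iₖ)` of the index set, of the tensor products
`M i₁ ⊗ ⋯ ⊗ M iₖ`. -/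
abbrev OrderedTensorSum : Type _ :=
  ⨁ e : FamilyOrdering ι, ⨂[ℚ] j, M (e.1 j)

variable {M M' M''} in
/-- The pure tensor `f 1 ⊗ ⋯ ⊗ f k` in the summand of the ordering `e`. -/
def orderedTensor (e : FamilyOrdering ι) (f : ∀ j, M (e.1 j)) : OrderedTensorSum M :=
  DirectSum.lof ℚ (FamilyOrdering ι) (fun e => ⨂[ℚ] j, M (e.1 j)) e (PiTensorProduct.tprod ℚ f)

variable {M M' M''} in
lemma orderedTensor_congr {e e' : FamilyOrdering ι} {f : ∀ j, M (e.1 j)} {f' : ∀ j, M (e'.1 j)}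
    (h : ∀ j, (⟨e.1 j, f j⟩ : Σ i, M i) = ⟨e'.1 j, f' j⟩) :
    orderedTensor e f = orderedTensor e' f' := by
  obtain rfl : e = e' := Subtype.ext (funext fun j => congrArg Sigma.fst (h j))
  obtain rfl : f = f' := funext fun j => by simpa using h j
  rfl

variable {M M' M''} in
lemma orderedTensor_hom_ext {N : Type*} [AddCommGroup N] [Module ℚ N]
    {φ ψ : OrderedTensorSum M →ₗ[ℚ] N}
    (h : ∀ e f, φ (orderedTensor e f) = ψ (orderedTensor e f)) : φ = ψ := by
  refine DirectSum.linearMap_ext ℚ fun e => PiTensorProduct.ext (MultilinearMap.ext fun f => ?_)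
  exact h e f

/-- The action of a permutation of the `k` tensor positions. -/
def permuteTensor (σ : Equiv.Perm (Fin (Fintype.card ι))) :
    OrderedTensorSum M →ₗ[ℚ] OrderedTensorSum M :=
  DirectSum.toModule ℚ _ _ fun e =>
    DirectSum.lof ℚ (FamilyOrdering ι) (fun e => ⨂[ℚ] j, M (e.1 j)) (e.permute σ) ∘ₗ
      (PiTensorProduct.reindex ℚ (fun j => M (e.1 j)) σ).toLinearMap

lemma permuteTensor_apply (σ : Equiv.Perm (Fin (Fintype.card ι))) (e : FamilyOrdering ι)
    (f : ∀ j, M (e.1 j)) :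
    permuteTensor M σ (orderedTensor e f) =
      orderedTensor (e.permute σ) (fun j => f (σ.symm j)) := by
  rw [permuteTensor, orderedTensor, DirectSum.toModule_lof, LinearMap.comp_apply]
  rw [LinearEquiv.coe_coe, PiTensorProduct.reindex_tprod]
  rfl

/-- The representation of the symmetric group on `OrderedTensorSum M`. -/
def permuteTensorRep :
    Representation ℚ (Equiv.Perm (Fin (Fintype.card ι))) (OrderedTensorSum M) where
  toFun σ := permuteTensor M σ
  map_one' := orderedTensor_hom_ext fun e f => by
    rw [permuteTensor_apply]; rfl
  map_mul' σ τ := orderedTensor_hom_ext fun e f => by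
    rw [Module.End.mul_apply, permuteTensor_apply, permuteTensor_apply, permuteTensor_apply]
    rfl

/-- The unordered tensor product of a finite family: the coinvariants of the symmetric group
acting on the direct sum of the tensor products in all orders. -/
abbrev UnorderedTensor : Type _ := (permuteTensorRep M).Coinvariants

variable {M M' M''}

/-- The map on `OrderedTensorSum` induced by linear maps `M i → M' (g i)`, where `g` is a bijection
of the index sets. -/
def orderedTensorMap (g : ι ≃ ι') (φ : ∀ i, M i →ₗ[ℚ] M' (g i)) :
    OrderedTensorSum M →ₗ[ℚ] OrderedTensorSum M' :=
  DirectSum.toModule ℚ _ _ fun e =>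
    DirectSum.lof ℚ (FamilyOrdering ι') (fun e => ⨂[ℚ] j, M' (e.1 j))
        (e.transport g) ∘ₗ
      (PiTensorProduct.reindex ℚ (fun j => M' (g (e.1 j)))
        (finCongr (Fintype.card_congr g))).toLinearMap ∘ₗ
      PiTensorProduct.map fun j => φ (e.1 j)

lemma orderedTensorMap_apply (g : ι ≃ ι') (φ : ∀ i, M i →ₗ[ℚ] M' (g i)) (e : FamilyOrdering ι)
    (f : ∀ j, M (e.1 j)) :
    orderedTensorMap g φ (orderedTensor e f) =
      orderedTensor (e.transport g)
        (fun j => φ _ (f ((finCongr (Fintype.card_congr g)).symm j))) := by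
  rw [orderedTensorMap, orderedTensor, DirectSum.toModule_lof, LinearMap.comp_apply,
    LinearMap.comp_apply, PiTensorProduct.map_tprod]
  rw [LinearEquiv.coe_coe, PiTensorProduct.reindex_tprod]
  rfl

lemma mk_orderedTensorMap_permute (g : ι ≃ ι') (φ : ∀ i, M i →ₗ[ℚ] M' (g i))
    (σ : Equiv.Perm (Fin (Fintype.card ι))) :
    (Representation.Coinvariants.mk (permuteTensorRep M') ∘ₗ orderedTensorMap g φ) ∘ₗ
        permuteTensorRep M σ =
      Representation.Coinvariants.mk (permuteTensorRep M') ∘ₗ orderedTensorMap g φ := by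
  refine orderedTensor_hom_ext fun e f => ?_
  simp only [LinearMap.comp_apply]
  have h : orderedTensorMap g φ (permuteTensorRep M σ (orderedTensor e f)) =
      permuteTensorRep M' (((finCongr (Fintype.card_congr g)).symm.trans
        (σ.trans (finCongr (Fintype.card_congr g)))))
        (orderedTensorMap g φ (orderedTensor e f)) := by
    change orderedTensorMap g φ (permuteTensor M σ (orderedTensor e f)) =
      permuteTensor M' _ (orderedTensorMap g φ (orderedTensor e f))
    rw [permuteTensor_apply, orderedTensorMap_apply, orderedTensorMap_apply, permuteTensor_apply]
    exact orderedTensor_congr fun j => rfl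
  rw [h, Representation.Coinvariants.mk_self_apply]

/-- The map of unordered tensor products induced by linear maps `M i → M' (g i)`, where `g` is a
bijection of the index sets. -/
def UnorderedTensor.map (g : ι ≃ ι') (φ : ∀ i, M i →ₗ[ℚ] M' (g i)) :
    UnorderedTensor M →ₗ[ℚ] UnorderedTensor M' :=
  Representation.Coinvariants.lift _
    (Representation.Coinvariants.mk (permuteTensorRep M') ∘ₗ orderedTensorMap g φ)
    (mk_orderedTensorMap_permute g φ)

lemma UnorderedTensor.hom_ext {N : Type*} [AddCommGroup N] [Module ℚ N]
    {φ ψ : UnorderedTensor M →ₗ[ℚ] N}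
    (h : ∀ e f, φ (Representation.Coinvariants.mk _ (orderedTensor e f)) =
      ψ (Representation.Coinvariants.mk _ (orderedTensor e f))) : φ = ψ :=
  Representation.Coinvariants.hom_ext (orderedTensor_hom_ext h)

lemma UnorderedTensor.map_mk (g : ι ≃ ι') (φ : ∀ i, M i →ₗ[ℚ] M' (g i)) (x : OrderedTensorSum M) :
    UnorderedTensor.map g φ (Representation.Coinvariants.mk _ x) =
      Representation.Coinvariants.mk _ (orderedTensorMap g φ x) := rfl

lemma UnorderedTensor.map_id (g : ι ≃ ι) (φ : ∀ i, M i →ₗ[ℚ] M (g i))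
    (h : ∀ i x, (⟨g i, φ i x⟩ : Σ i, M i) = ⟨i, x⟩) :
    UnorderedTensor.map g φ = LinearMap.id := by
  refine UnorderedTensor.hom_ext fun e f => ?_
  rw [UnorderedTensor.map_mk, orderedTensorMap_apply, LinearMap.id_apply]
  exact congrArg _ (orderedTensor_congr fun j => h _ _)

lemma UnorderedTensor.map_comp (g : ι ≃ ι') (φ : ∀ i, M i →ₗ[ℚ] M' (g i))
    (g' : ι' ≃ ι'') (φ' : ∀ i, M' i →ₗ[ℚ] M'' (g' i))
    (g'' : ι ≃ ι'') (φ'' : ∀ i, M i →ₗ[ℚ] M'' (g'' i))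
    (h : ∀ i x, (⟨g' (g i), φ' _ (φ i x)⟩ : Σ i, M'' i) = ⟨g'' i, φ'' i x⟩) :
    UnorderedTensor.map g' φ' ∘ₗ UnorderedTensor.map g φ = UnorderedTensor.map g'' φ'' := by
  refine UnorderedTensor.hom_ext fun e f => ?_
  rw [LinearMap.comp_apply, UnorderedTensor.map_mk, UnorderedTensor.map_mk,
    UnorderedTensor.map_mk, orderedTensorMap_apply, orderedTensorMap_apply,
    orderedTensorMap_apply]
  exact congrArg _ (orderedTensor_congr fun j => h _ _)

end UnorderedTensor

section Symplectic

open LinearMap (BilinForm)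

variable {K : Type*} [Field K] {V W X : Type*} [AddCommGroup V] [Module K V]
  [AddCommGroup W] [Module K W] [AddCommGroup X] [Module K X]
  {ω : BilinForm K V} {ω' : BilinForm K W} {ω'' : BilinForm K X}

/-- A sequence of vectors is separated if there is a nontrivial orthogonal splitting
`V = S₁ ⊕ S₂` such that each of the vectors lies in `S₁` or in `S₂`. -/
def IsSeparated (ω : BilinForm K V) {n : ℕ} (B : Fin n → V) : Prop :=
  ∃ S₁ S₂ : Submodule K V, S₁ ≠ ⊥ ∧ S₂ ≠ ⊥ ∧ IsCompl S₁ S₂ ∧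
    (∀ x ∈ S₁, ∀ y ∈ S₂, ω x y = 0) ∧ ∀ i, B i ∈ S₁ ∨ B i ∈ S₂

/-- The separated subspace `St^sep(V)` of `St(V)`: the span of the separated apartments. -/
def stSep (ω : BilinForm K V) : Submodule ℚ (Steinberg K V) :=
  Submodule.span ℚ {x | ∃ (n : ℕ) (hn : Module.finrank K V = n) (B : Fin n → V)
    (hB : ∀ i, B i ≠ 0), IsSeparated ω B ∧ x = apartment hn B hB}

/-- The nonseparated quotient `St^ns(V) = St(V) / St^sep(V)`. -/
abbrev StNS (ω : BilinForm K V) : Type _ := Steinberg K V ⧸ stSep ω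

lemma IsSeparated.map (φ : ω.IsometryEquiv ω') {n : ℕ} {B : Fin n → V} (h : IsSeparated ω B) :
    IsSeparated ω' (φ ∘ B) := by
  obtain ⟨S₁, S₂, h1, h2, hc, ho, hB⟩ := h
  refine ⟨S₁.map (φ.toLinearEquiv : V →ₗ[K] W), S₂.map (φ.toLinearEquiv : V →ₗ[K] W),
    fun h => h1 ((Submodule.map_eq_bot_iff (e := φ.toLinearEquiv)).1 h),
    fun h => h2 ((Submodule.map_eq_bot_iff (e := φ.toLinearEquiv)).1 h), ?_, ?_, ?_⟩
  · exact (Submodule.orderIsoMapComap φ.toLinearEquiv).isCompl hc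
  · rintro _ ⟨x, hx, rfl⟩ _ ⟨y, hy, rfl⟩
    exact (φ.map_app y x).trans (ho x hx y hy)
  · exact fun i => (hB i).imp (fun h => ⟨_, h, rfl⟩) (fun h => ⟨_, h, rfl⟩)

lemma stSep_le_comap (φ : ω.IsometryEquiv ω') :
    stSep ω ≤ (stSep ω').comap (Steinberg.map φ.toLinearEquiv) := by
  refine Submodule.span_le.2 ?_
  rintro _ ⟨n, hn, B, hB, hs, rfl⟩
  refine Submodule.subset_span ⟨n, _, _, _, hs.map φ, Steinberg.map_apartment _ hn B hB⟩

/-- The map of nonseparated quotients induced by an isometry. -/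
def StNS.map (φ : ω.IsometryEquiv ω') : StNS ω →ₗ[ℚ] StNS ω' :=
  Submodule.mapQ _ _ (Steinberg.map φ.toLinearEquiv) (stSep_le_comap φ)

lemma StNS.map_refl (φ : ω.IsometryEquiv ω) (h : ∀ x, φ x = x) (x : StNS ω) :
    StNS.map φ x = x := by
  obtain ⟨x, rfl⟩ := Submodule.mkQ_surjective _ x
  have h' : φ.toLinearEquiv = LinearEquiv.refl K V := LinearEquiv.ext h
  change Submodule.mkQ _ (Steinberg.map φ.toLinearEquiv x) = _
  rw [h', Steinberg.map_refl]

lemma StNS.map_map (φ : ω.IsometryEquiv ω') (ψ : ω'.IsometryEquiv ω'')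
    (χ : ω.IsometryEquiv ω'') (h : ∀ x, ψ (φ x) = χ x) (x : StNS ω) :
    StNS.map ψ (StNS.map φ x) = StNS.map χ x := by
  obtain ⟨x, rfl⟩ := Submodule.mkQ_surjective _ x
  have h' : χ.toLinearEquiv = φ.toLinearEquiv.trans ψ.toLinearEquiv :=
    LinearEquiv.ext fun x => (h x).symm
  change Submodule.mkQ _ (Steinberg.map ψ.toLinearEquiv (Steinberg.map φ.toLinearEquiv x)) =
    Submodule.mkQ _ (Steinberg.map χ.toLinearEquiv x)
  rw [h', Steinberg.map_trans]

/-- The restriction of an isometry of `V` to an isometry of subspaces `s ≃ t`, where `t = φ(s)`. -/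
def restrictIsometry (φ : ω.IsometryEquiv ω) (s t : Submodule K V)
    (h : s.map (φ.toLinearEquiv : V →ₗ[K] V) = t) :
    (ω.restrict s).IsometryEquiv (ω.restrict t) where
  toLinearEquiv := φ.toLinearEquiv.ofSubmodules s t h
  map_app' x y := φ.map_app' x.1 y.1

/-- The map `St^ns(s) → St^ns(t)` induced by an isometry of `V` taking `s` to `t`. -/
def partMap (φ : ω.IsometryEquiv ω) (s t : Submodule K V)
    (h : s.map (φ.toLinearEquiv : V →ₗ[K] V) = t) :
    StNS (ω.restrict s) →ₗ[ℚ] StNS (ω.restrict t) :=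
  StNS.map (restrictIsometry φ s t h)

lemma partMap_id (φ : ω.IsometryEquiv ω) (hφ : ∀ x, φ x = x) (s : Submodule K V)
    (h : s.map (φ.toLinearEquiv : V →ₗ[K] V) = s) (x : StNS (ω.restrict s)) :
    partMap φ s s h x = x :=
  StNS.map_refl _ (fun x => Subtype.ext (hφ x.1)) x

lemma partMap_partMap (φ ψ χ : ω.IsometryEquiv ω) (hχ : ∀ x, ψ (φ x) = χ x)
    (s t u : Submodule K V) (h : s.map (φ.toLinearEquiv : V →ₗ[K] V) = t)
    (h' : t.map (ψ.toLinearEquiv : V →ₗ[K] V) = u)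
    (h'' : s.map (χ.toLinearEquiv : V →ₗ[K] V) = u) (x : StNS (ω.restrict s)) :
    partMap ψ t u h' (partMap φ s t h x) = partMap χ s u h'' x :=
  StNS.map_map _ _ _ (fun x => Subtype.ext (hχ x.1)) x

/-- A symplectic splitting: a finite (unordered) set of nonzero, pairwise orthogonal subspaces
of which `V` is the internal direct sum. -/
@[ext]
structure SymplecticSplitting (ω : BilinForm K V) where
  /-- The set of subspaces. -/
  parts : Finset (Submodule K V)
  bot_notMem : ⊥ ∉ parts
  orthogonal : ∀ s ∈ parts, ∀ t ∈ parts, s ≠ t → ∀ x ∈ s, ∀ y ∈ t, ω x y = 0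
  independent : sSupIndep (parts : Set (Submodule K V))
  sSup_eq_top : sSup (parts : Set (Submodule K V)) = ⊤

/-- The bijection on subspaces induced by an isometry. -/
def isometryOrderIso (φ : ω.IsometryEquiv ω) : Submodule K V ≃o Submodule K V :=
  Submodule.orderIsoMapComap φ.toLinearEquiv

/-- The image of a symplectic splitting under an isometry. -/
def SymplecticSplitting.map (φ : ω.IsometryEquiv ω) (S : SymplecticSplitting ω) :
    SymplecticSplitting ω where
  parts := S.parts.map (isometryOrderIso φ).toEquiv.toEmbedding
  bot_notMem := by
    rw [Finset.mem_map]
    rintro ⟨s, hs, h⟩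
    have : s = ⊥ := (isometryOrderIso φ).injective (h.trans (isometryOrderIso φ).map_bot.symm)
    exact S.bot_notMem (this ▸ hs)
  orthogonal := by
    intro s' hs' t' ht' hst
    obtain ⟨s, hs, rfl⟩ := Finset.mem_map.1 hs'
    obtain ⟨t, ht, rfl⟩ := Finset.mem_map.1 ht'
    rintro _ ⟨x, hx, rfl⟩ _ ⟨y, hy, rfl⟩
    exact (φ.map_app y x).trans (S.orthogonal s hs t ht (fun h => hst (by rw [h])) x hx y hy)
  independent := by
    rw [Finset.coe_map]
    have h := S.independent
    rw [sSupIndep_iff] at h ⊢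
    have := (iSupIndep_map_orderIso_iff (isometryOrderIso φ)).2 h
    let e : (S.parts : Set (Submodule K V)) ≃
        (((isometryOrderIso φ).toEquiv.toEmbedding '' (S.parts : Set (Submodule K V)) :
          Set (Submodule K V))) := (isometryOrderIso φ).toEquiv.image _
    exact (iSupIndep.comp' (t := Subtype.val) (f := e) (by exact this) e.surjective)
  sSup_eq_top := by
    rw [Finset.coe_map]
    have := (isometryOrderIso φ).map_sSup (S.parts : Set (Submodule K V))
    rw [S.sSup_eq_top, (isometryOrderIso φ).map_top, ← sSup_image] at this
    exact this.symm

/-- `St^ns(S)`: the unordered tensor product of the `St^ns(s)`, for `s` in the splitting `S`. -/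
abbrev StNSSplit (S : SymplecticSplitting ω) : Type _ :=
  UnorderedTensor fun s : S.parts => StNS (ω.restrict s.1)

lemma SymplecticSplitting.mem_of_mem {φ : ω.IsometryEquiv ω} {S S' : SymplecticSplitting ω}
    (h : S.map φ = S') (s : S.parts) : s.1.map (φ.toLinearEquiv : V →ₗ[K] V) ∈ S'.parts := by
  subst h
  exact Finset.mem_map.2 ⟨s.1, s.2, rfl⟩

/-- The bijection between the subspaces in `S` and those in `S' = φ(S)`. -/
def partsEquiv (φ : ω.IsometryEquiv ω) {S S' : SymplecticSplitting ω} (h : S.map φ = S') :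
    S.parts ≃ S'.parts :=
  Equiv.ofBijective
    (fun s => ⟨s.1.map (φ.toLinearEquiv : V →ₗ[K] V), SymplecticSplitting.mem_of_mem h s⟩) (by
      constructor
      · intro s t hst
        exact Subtype.ext ((isometryOrderIso φ).injective (congrArg Subtype.val hst))
      · subst h
        rintro ⟨t, ht⟩
        obtain ⟨s, hs, rfl⟩ := Finset.mem_map.1 ht
        exact ⟨⟨s, hs⟩, rfl⟩)

lemma map_eq_partsEquiv (φ : ω.IsometryEquiv ω) {S S' : SymplecticSplitting ω}
    (h : S.map φ = S') (s : S.parts) :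
    s.1.map (φ.toLinearEquiv : V →ₗ[K] V) = (partsEquiv φ h s).1 := rfl

/-- The map `St^ns(S) → St^ns(S')` induced by an isometry taking `S` to `S'`. -/
def StNSSplit.map (φ : ω.IsometryEquiv ω) {S S' : SymplecticSplitting ω} (h : S.map φ = S') :
    StNSSplit S →ₗ[ℚ] StNSSplit S' :=
  UnorderedTensor.map (partsEquiv φ h) fun s => partMap φ s.1 (partsEquiv φ h s).1 (map_eq_partsEquiv φ h s)

lemma sigma_partMap_congr {φ : ω.IsometryEquiv ω} {S : SymplecticSplitting ω}
    {s : Submodule K V} {t t' : S.parts} (h : s.map (φ.toLinearEquiv : V →ₗ[K] V) = t.1)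
    (h' : s.map (φ.toLinearEquiv : V →ₗ[K] V) = t'.1) (x : StNS (ω.restrict s)) :
    (⟨t, partMap φ s t.1 h x⟩ : Σ t : S.parts, StNS (ω.restrict t.1)) =
      ⟨t', partMap φ s t'.1 h' x⟩ := by
  obtain rfl : t = t' := Subtype.ext (h.symm.trans h')
  rfl

lemma map_eq_self_of_id (φ : ω.IsometryEquiv ω) (hφ : ∀ x, φ x = x) (s : Submodule K V) :
    s.map (φ.toLinearEquiv : V →ₗ[K] V) = s := by
  have : (φ.toLinearEquiv : V →ₗ[K] V) = LinearMap.id := LinearMap.ext hφ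
  rw [this, Submodule.map_id]

lemma map_map_of_comp (φ ψ χ : ω.IsometryEquiv ω) (hχ : ∀ x, ψ (φ x) = χ x)
    (s : Submodule K V) :
    (s.map (φ.toLinearEquiv : V →ₗ[K] V)).map (ψ.toLinearEquiv : V →ₗ[K] V) =
      s.map (χ.toLinearEquiv : V →ₗ[K] V) := by
  have : (χ.toLinearEquiv : V →ₗ[K] V) =
    (ψ.toLinearEquiv : V →ₗ[K] V) ∘ₗ (φ.toLinearEquiv : V →ₗ[K] V) :=
      LinearMap.ext fun x => (hχ x).symm
  rw [this, Submodule.map_comp]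

lemma SymplecticSplitting.map_id (φ : ω.IsometryEquiv ω) (hφ : ∀ x, φ x = x)
    (S : SymplecticSplitting ω) : S.map φ = S := by
  ext s
  refine Finset.mem_map.trans ⟨?_, fun hs => ⟨s, hs, map_eq_self_of_id φ hφ s⟩⟩
  rintro ⟨t, ht, hts⟩
  have : t = s := (map_eq_self_of_id φ hφ t).symm.trans hts
  exact this ▸ ht

lemma SymplecticSplitting.map_map (φ ψ χ : ω.IsometryEquiv ω) (hχ : ∀ x, ψ (φ x) = χ x)
    (S : SymplecticSplitting ω) : (S.map φ).map ψ = S.map χ := by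
  apply SymplecticSplitting.ext
  change (S.parts.map _).map _ = S.parts.map _
  rw [Finset.map_map]
  congr 1
  ext1 s
  exact map_map_of_comp φ ψ χ hχ s

lemma StNSSplit.map_id (φ : ω.IsometryEquiv ω) (hφ : ∀ x, φ x = x) {S : SymplecticSplitting ω}
    (h : S.map φ = S) : StNSSplit.map φ h = LinearMap.id := by
  refine UnorderedTensor.map_id _ _ fun s x => ?_
  refine (sigma_partMap_congr (t := partsEquiv φ h s) (t' := s) (map_eq_partsEquiv φ h s)
    (map_eq_self_of_id φ hφ s.1) x).trans ?_
  rw [partMap_id φ hφ]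

lemma StNSSplit.map_comp (φ ψ χ : ω.IsometryEquiv ω) (hχ : ∀ x, ψ (φ x) = χ x)
    {S S' S'' : SymplecticSplitting ω} (h : S.map φ = S') (h' : S'.map ψ = S'')
    (h'' : S.map χ = S'') :
    StNSSplit.map ψ h' ∘ₗ StNSSplit.map φ h = StNSSplit.map χ h'' := by
  refine UnorderedTensor.map_comp _ _ _ _ _ _ fun s x => ?_
  have e : s.1.map (χ.toLinearEquiv : V →ₗ[K] V) = (partsEquiv ψ h' (partsEquiv φ h s)).1 :=
    (map_map_of_comp φ ψ χ hχ s.1).symm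
  exact (congrArg (Sigma.mk (partsEquiv ψ h' (partsEquiv φ h s))) (partMap_partMap φ ψ χ hχ _ _ _ (map_eq_partsEquiv φ h s)
    (map_eq_partsEquiv ψ h' _) e x)).trans (sigma_partMap_congr e (map_eq_partsEquiv χ h'' s) x)

end Symplectic

section Standard

open scoped Classical
open Matrix

variable (g p : ℕ)

/-- The vector space `𝔽_p^{2g}`. -/
abbrev SympSpace : Type := Fin g ⊕ Fin g → ZMod p

/-- The standard symplectic form on `𝔽_p^{2g}`. -/
def stdForm : LinearMap.BilinForm (ZMod p) (SympSpace g p) :=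
  Matrix.toBilin' (Matrix.J (Fin g) (ZMod p))

/-- The inclusion of `Sp_{2g}(𝔽_p)` in `SL_{2g}(𝔽_p)`. -/
def spToSL : Matrix.symplecticGroup (Fin g) (ZMod p) →*
    Matrix.SpecialLinearGroup (Fin g ⊕ Fin g) (ZMod p) where
  toFun A := ⟨A.1, SymplecticGroup.det_eq_one A.2⟩
  map_one' := rfl
  map_mul' _ _ := rfl

variable [Fact p.Prime]

/-- The Steinberg representation `St_{2g}(𝔽_p)` of `SL_{2g}(𝔽_p)`. -/
def steinbergSL : Representation ℚ (Matrix.SpecialLinearGroup (Fin g ⊕ Fin g) (ZMod p))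
    (Steinberg (ZMod p) (SympSpace g p)) :=
  (steinbergRep (ZMod p) (SympSpace g p)).comp Matrix.SpecialLinearGroup.toLin'

variable {g p}

/-- The isometry `v ↦ A v` given by a symplectic matrix. -/
def spIsometry (A : Matrix.symplecticGroup (Fin g) (ZMod p)) :
    (stdForm g p).IsometryEquiv (stdForm g p) where
  toLinearEquiv := Matrix.SpecialLinearGroup.toLin' (spToSL g p A)
  map_app' x y := by
    change Matrix.toBilin' (Matrix.J (Fin g) (ZMod p)) (A.1.mulVec x) (A.1.mulVec y) =
      Matrix.toBilin' (Matrix.J (Fin g) (ZMod p)) x y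
    have h := SymplecticGroup.mem_iff'.1 A.2
    conv_rhs => rw [← h]
    simp only [Matrix.toBilin'_apply', ← Matrix.mulVec_mulVec, Matrix.dotProduct_mulVec,
      Matrix.vecMul_transpose]

lemma spIsometry_one (x : SympSpace g p) :
    spIsometry (1 : Matrix.symplecticGroup (Fin g) (ZMod p)) x = x := by
  change Matrix.SpecialLinearGroup.toLin' (spToSL g p 1) x = x
  rw [map_one, map_one]; rfl

lemma spIsometry_mul (A B : Matrix.symplecticGroup (Fin g) (ZMod p)) (x : SympSpace g p) :
    spIsometry A (spIsometry B x) = spIsometry (A * B) x := by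
  change _ = Matrix.SpecialLinearGroup.toLin' (spToSL g p (A * B)) x
  rw [map_mul, map_mul]; rfl

/-- `Sp_{2g}(𝔽_p)` acts on the set of symplectic splittings. -/
instance : MulAction (Matrix.symplecticGroup (Fin g) (ZMod p))
    (SymplecticSplitting (stdForm g p)) where
  smul A S := S.map (spIsometry A)
  one_smul S := S.map_id _ spIsometry_one
  mul_smul A B S := (S.map_map _ _ _ (spIsometry_mul A B)).symm

/-- The representation of `Sp(S)`, the stabilizer of the splitting `S`, on `St^ns(S)`. -/
def stNSStabilizerRep (S : SymplecticSplitting (stdForm g p)) :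
    Representation ℚ (MulAction.stabilizer (Matrix.symplecticGroup (Fin g) (ZMod p)) S)
      (StNSSplit S) where
  toFun A := StNSSplit.map (spIsometry A.1) A.2
  map_one' := StNSSplit.map_id _ spIsometry_one _
  map_mul' A B := (StNSSplit.map_comp _ _ _ (spIsometry_mul A.1 B.1) B.2 A.2 (A * B).2).symm

/-- The map on the direct sum of the `St^ns(S)` induced by a symplectic matrix `A`. It takes the
summand of `S` to the summand of `A • S`. -/
def summandMap (A : Matrix.symplecticGroup (Fin g) (ZMod p)) :
    (⨁ S : SymplecticSplitting (stdForm g p), StNSSplit S) →ₗ[ℚ]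
      ⨁ S : SymplecticSplitting (stdForm g p), StNSSplit S :=
  DirectSum.toModule ℚ _ _ fun S =>
    DirectSum.lof ℚ _ (fun S : SymplecticSplitting (stdForm g p) => StNSSplit S) (A • S) ∘ₗ
      StNSSplit.map (spIsometry A) rfl

lemma summandMap_lof (A : Matrix.symplecticGroup (Fin g) (ZMod p))
    (S S' : SymplecticSplitting (stdForm g p)) (h : S.map (spIsometry A) = S')
    (x : StNSSplit S) :
    summandMap A
        (DirectSum.lof ℚ _ (fun S : SymplecticSplitting (stdForm g p) => StNSSplit S) S x) =
      DirectSum.lof ℚ _ (fun S : SymplecticSplitting (stdForm g p) => StNSSplit S) S'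
        (StNSSplit.map (spIsometry A) h x) := by
  subst h
  exact DirectSum.toModule_lof ℚ S x

lemma summandMap_one :
    summandMap (1 : Matrix.symplecticGroup (Fin g) (ZMod p)) = LinearMap.id := by
  refine DirectSum.linearMap_ext ℚ fun S => LinearMap.ext fun x => ?_
  refine (summandMap_lof 1 S S (S.map_id _ spIsometry_one) x).trans ?_
  rw [StNSSplit.map_id _ spIsometry_one]
  rfl

lemma summandMap_mul (A B : Matrix.symplecticGroup (Fin g) (ZMod p)) :
    summandMap (A * B) = summandMap A ∘ₗ summandMap B := by
  refine DirectSum.linearMap_ext ℚ fun S => LinearMap.ext fun x => ?_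
  have hAB : S.map (spIsometry (A * B)) = (S.map (spIsometry B)).map (spIsometry A) :=
    (S.map_map _ _ _ (spIsometry_mul A B)).symm
  have h := StNSSplit.map_comp _ _ _ (spIsometry_mul A B) (S := S) rfl rfl hAB
  refine (summandMap_lof (A * B) S _ hAB x).trans ?_
  rw [← h]
  refine Eq.symm ((congrArg (summandMap A) (summandMap_lof B S _ rfl x)).trans ?_)
  exact summandMap_lof A _ _ rfl _

variable (g p)

/-- The representation of `Sp_{2g}(𝔽_p)` on the direct sum of the `St^ns(S)`, over all symplectic
splittings `S`. -/
def stNSSumRep : Representation ℚ (Matrix.symplecticGroup (Fin g) (ZMod p))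
    (⨁ S : SymplecticSplitting (stdForm g p), StNSSplit S) where
  toFun A := summandMap A
  map_one' := summandMap_one
  map_mul' A B := summandMap_mul A B

end Standard

end

/-!
# The Steinberg module as a sum over symplectic splittings

Write `n` for the dimension of `V`. The Tits building of `V` has no simplices above its top degree,
so a class in `St(V)` is a cycle, and it is determined by its coefficients at the complete flags of
`V` (`Steinberg.coeff_injective`). The coefficient of the apartment of `B = (v₁, …, vₙ)` at the flag
`C₀ < ⋯ < Cₙ₋₁ = V` is the determinant of the incidence matrix `[vᵢ ∈ Cⱼ]` (`coeff_apartment`).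
A class is the combination, with its own coefficients, of the apartments of vectors chosen from the
members of the flags (`sum_coeff_smul_apartment`), and so the apartments span `St(V)`.

Two operations relate `St(V)` to the Steinberg modules of the summands of a decomposition
`V = W₁ ⊕ ⋯ ⊕ Wₖ`.
* The product `stProd` takes apartments to the apartment of the concatenated sequence of vectors.
  It is natural, and if all `Wₛ` have even dimension it does not depend on their order, because a
  permutation of blocks of even sizes is even (`map_stProd`).
* The coproduct evaluates a class at the flags that run through complete flags of `W₁`, …, `Wₖ` one
  after the other. It appears here through the functionals `joinFunctional`, for functionals on the
  `St(Wₛ)`. It is a left inverse of the product (`joinFunctional_stProd`). On an apartment, its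
  component in `St(Wₛ)` is a combination of apartments of components of the given vectors
  (`joinFunctional_apartment_eq_zero`).

Choose linear sections of the projections `St(s) → St^ns(s)`. For every symplectic splitting `S`
they give, with the product, a map `St^ns(S) → St(V)`. The sum of these maps over all `S` is
`splitSum`.
* It is surjective: an apartment of vectors which lie in the members of `S` is a multiple of a
  product over `S`. Changing a factor by a separated class changes the product by a combination of
  apartments adapted to finer splittings, so that descending induction on the number of members of
  `S` applies (`apartment_mem_range_splitSum`).
* It is injective: read modulo separated apartments, the coproduct along `S` annihilates all
  products over splittings `T` which `S` does not refine (`joinFunctional_stProd_eq_zero`). Indeed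
  some member of `S` is contained in no member of `T`, and for the first such member the component
  of the coproduct consists of apartments which are separated or zero. If the `S`-component of an
  element of the kernel is nonzero, with the least possible number of members of `S`, the coproduct
  along `S` only sees this component, and detects it, by the left inverse property.

Averaging the sections over the finite group `Sp` makes the isomorphism equivariant
(`map_averageSection`, `map_splitProd`). The second statement is the general fact that a
representation whose summands are permuted by the group is the sum of the representations induced
from the stabilizers (`nonempty_equiv_directSum_ind`).
-/

noncomputable section

/-! ### Coefficients of Steinberg classes at complete flags -/

section CompleteFlags

open Module

lemma strictMono_fin_add_sub_le {n : ℕ} {f : Fin n → ℕ} (hf : StrictMono f) {i j : Fin n}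
    (hij : i ≤ j) : f i + ((j : ℕ) - i) ≤ f j := by
  obtain ⟨j, hj⟩ := j
  induction j with
  | zero =>
    have : i = ⟨0, hj⟩ := le_antisymm hij (Fin.mk_le_mk.2 (Nat.zero_le _))
    subst this; simp
  | succ k ih =>
    rcases hij.eq_or_lt with rfl | h
    · simp
    · have h1 : i ≤ ⟨k, by omega⟩ := Fin.mk_le_mk.2 (by have := Fin.lt_def.1 h; simp at this; omega)
      have h2 := ih (by omega) h1
      have h3 : f ⟨k, by omega⟩ < f ⟨k + 1, hj⟩ := hf (Fin.mk_lt_mk.2 (Nat.lt_succ_self k))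
      have h4 := Fin.le_def.1 h1
      simp only at h2 h4 ⊢
      omega

variable (K V : Type*) [Field K] [AddCommGroup V] [Module K V]

/-- The complete flags `0 < C₀ < C₁ < ⋯ < Cₙ₋₁` of a space of dimension `n`. The last subspace
is the whole space, so these correspond to the chambers of the Tits building. -/
abbrev CompleteFlag : Type _ :=
  {C : Fin (finrank K V) → Submodule K V // StrictMono C ∧ ∀ j, C j ≠ ⊥}

variable {K V}

namespace CompleteFlag

variable [FiniteDimensional K V]

lemma finrank_eq (C : CompleteFlag K V) (j : Fin (finrank K V)) :
    finrank K (C.1 j) = j + 1 := by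
  have hf : StrictMono fun j => finrank K (C.1 j) :=
    fun i j h => Submodule.finrank_lt_finrank_of_lt (C.2.1 h)
  have hj := j.2
  have h0 : (⟨0, by omega⟩ : Fin (finrank K V)) ≤ j := Fin.mk_le_mk.2 (Nat.zero_le _)
  have h1 : j ≤ (⟨finrank K V - 1, by omega⟩ : Fin (finrank K V)) := Fin.mk_le_mk.2 (by omega)
  have e0 := strictMono_fin_add_sub_le hf h0
  have e1 := strictMono_fin_add_sub_le hf h1
  have e2 : 0 < finrank K (C.1 ⟨0, by omega⟩) := by
    rw [Module.finrank_pos_iff, Submodule.nontrivial_iff_ne_bot]; exact C.2.2 _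
  have e3 := Submodule.finrank_le (C.1 ⟨finrank K V - 1, by omega⟩)
  simp only at e0 e1
  omega

lemma eq_top (C : CompleteFlag K V) {j : Fin (finrank K V)} (hj : (j : ℕ) + 1 = finrank K V) :
    C.1 j = ⊤ :=
  Submodule.eq_top_of_finrank_eq (by rw [C.finrank_eq, hj])

lemma ne_top (C : CompleteFlag K V) {j : Fin (finrank K V)} (hj : (j : ℕ) + 1 < finrank K V) :
    C.1 j ≠ ⊤ := by
  intro h
  have := C.finrank_eq j
  rw [h, finrank_top] at this
  omega

/-- The simplex of the Tits building given by the proper subspaces of a complete flag. -/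
def toSimplex (C : CompleteFlag K V) {k : ℕ} (hk : finrank K V - 1 = k) :
    FlagSimplex (TitsVertex K V) k :=
  ⟨fun j => ⟨C.1 ⟨j, by omega⟩, C.2.2 _, C.ne_top (by simp only; omega)⟩,
    fun i j h => C.2.1 (Fin.mk_lt_mk.2 h)⟩

lemma toSimplex_bijective {k : ℕ} (hk : finrank K V - 1 = k) :
    Function.Bijective fun C : CompleteFlag K V => C.toSimplex hk := by
  constructor
  · intro C D h
    refine Subtype.ext (funext fun j => ?_)
    by_cases hj : (j : ℕ) + 1 < finrank K V
    · have := congrArg Subtype.val (congrFun (congrArg Subtype.val h) ⟨j, by omega⟩)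
      exact this
    · rw [C.eq_top (by omega), D.eq_top (by omega)]
  · intro c
    refine ⟨⟨fun j => if h : (j : ℕ) < k then (c.1 ⟨j, h⟩).1 else ⊤, ?_, ?_⟩, ?_⟩
    · intro i j h
      have hij := Fin.lt_def.1 h
      have hj := j.2
      have hi : (i : ℕ) < k := by omega
      simp only [hi, dif_pos]
      by_cases hj : (j : ℕ) < k
      · simp only [hj, dif_pos]
        exact c.2 (Fin.mk_lt_mk.2 hij)
      · simp only [hj, dif_neg, not_false_iff]
        exact lt_top_iff_ne_top.2 (c.1 _).2.2
    · intro j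
      have hj := j.2
      by_cases hj : (j : ℕ) < k
      · simp only [hj, dif_pos]
        exact (c.1 _).2.1
      · simp only [hj, dif_neg, not_false_iff]
        intro h
        have h1 := finrank_top K V
        rw [h, finrank_bot] at h1
        omega
    · refine Subtype.ext (funext fun j => Subtype.ext ?_)
      simp [toSimplex]

end CompleteFlag

lemma isEmpty_flagSimplex_titsVertex [FiniteDimensional K V] :
    IsEmpty (FlagSimplex (TitsVertex K V) (finrank K V - 1 + 1)) := by
  constructor
  intro c
  have hf : StrictMono fun j => finrank K (c.1 j).1 :=
    fun i j h => Submodule.finrank_lt_finrank_of_lt (c.2 h)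
  have h1 := strictMono_fin_add_sub_le hf (Fin.zero_le (Fin.last _))
  have h2 : 0 < finrank K (c.1 0).1 := by
    rw [Module.finrank_pos_iff, Submodule.nontrivial_iff_ne_bot]; exact (c.1 0).2.1
  have h3 : finrank K (c.1 (Fin.last _)).1 < finrank K V :=
    Submodule.finrank_lt (c.1 (Fin.last _)).2.2
  simp at h1
  omega

lemma flagBoundaries_titsVertex [FiniteDimensional K V] :
    flagBoundaries (TitsVertex K V) (finrank K V - 1) = ⊥ := by
  have := isEmpty_flagSimplex_titsVertex (K := K) (V := V)
  refine (Submodule.eq_bot_iff _).2 ?_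
  rintro _ ⟨y, rfl⟩
  rw [Subsingleton.elim y 0, map_zero]

namespace Steinberg

variable (K V) in
/-- The unique cycle representing a class in the Steinberg module: the building has no
simplices above the top degree. -/
def toChain [FiniteDimensional K V] :
    Steinberg K V →ₗ[ℚ] FlagChain (TitsVertex K V) (finrank K V - 1) :=
  Submodule.liftQ _ (flagCycles (TitsVertex K V) (finrank K V - 1)).subtype (by
    intro x hx
    have h : (x : FlagChain (TitsVertex K V) (finrank K V - 1)) ∈
      flagBoundaries (TitsVertex K V) (finrank K V - 1) := hx
    rw [flagBoundaries_titsVertex] at h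
    exact h)

lemma toChain_mk [FiniteDimensional K V] (x : flagCycles (TitsVertex K V) (finrank K V - 1)) :
    toChain K V (FlagHomology.mk _ _ x) = x.1 := rfl

lemma toChain_injective [FiniteDimensional K V] : Function.Injective (toChain K V) := by
  rw [injective_iff_map_eq_zero]
  intro x hx
  obtain ⟨x, rfl⟩ := FlagHomology.mk_surjective _ x
  rw [toChain_mk] at hx
  rw [Subtype.ext (a1 := x) (a2 := 0) hx, map_zero]; rfl

lemma toChain_mem_cycles [FiniteDimensional K V] (x : Steinberg K V) :
    toChain K V x ∈ flagCycles (TitsVertex K V) (finrank K V - 1) := by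
  obtain ⟨x, rfl⟩ := FlagHomology.mk_surjective _ x
  exact x.2

variable (K V) in
/-- The coefficients at the complete flags of the cycle representing a class in the Steinberg
module. -/
def coeff [FiniteDimensional K V] : Steinberg K V →ₗ[ℚ] (CompleteFlag K V → ℚ) :=
  LinearMap.pi fun C => Finsupp.lapply (C.toSimplex rfl) ∘ₗ toChain K V

lemma coeff_injective [FiniteDimensional K V] : Function.Injective (coeff K V) := by
  rw [injective_iff_map_eq_zero]
  intro x hx
  refine toChain_injective ?_
  rw [map_zero]
  ext c
  obtain ⟨C, rfl⟩ := (CompleteFlag.toSimplex_bijective rfl).2 c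
  exact congrFun hx C

end Steinberg

open Classical in
lemma flagSimplex_apply {P : Type*} [PartialOrder P] {m : ℕ} (c : Fin m → P)
    (d : FlagSimplex P m) : flagSimplex c d = if c = d.1 then 1 else 0 := by
  by_cases h : StrictMono c
  · rw [flagSimplex_of_strictMono h, Finsupp.single_apply]
    congr 1
    rw [Subtype.ext_iff]
  · rw [flagSimplex, dif_neg h, if_neg]
    · rfl
    · rintro rfl; exact h d.2

open Classical in
lemma flagBoundary_apply {P : Type*} [PartialOrder P] {m : ℕ} [Fintype (FlagSimplex P (m + 1))]
    (x : FlagChain P (m + 1)) (c : FlagSimplex P m) :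
    flagBoundary P m x c = ∑ d : FlagSimplex P (m + 1), x d * ∑ i : Fin (m + 1),
      (-1 : ℚ) ^ (i : ℕ) * if d.1 ∘ i.succAbove = c.1 then 1 else 0 := by
  rw [flagBoundary, Finsupp.linearCombination_apply, Finsupp.sum_fintype _ _ (by simp),
    Finsupp.finsetSum_apply]
  refine Finset.sum_congr rfl fun d _ => ?_
  rw [Finsupp.smul_apply, Finsupp.finsetSum_apply, smul_eq_mul]
  congr 1
  refine Finset.sum_congr rfl fun i _ => ?_
  rw [Finsupp.smul_apply, Finsupp.single_apply, smul_eq_mul]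
  simp only [Subtype.ext_iff]

instance [Finite V] : Fintype (CompleteFlag K V) := Fintype.ofFinite _

open Classical in
/-- The cycle condition, in terms of coefficients at complete flags. -/
lemma sum_coeff_adjacent_eq_zero [Finite V] (x : Steinberg K V) (C : CompleteFlag K V)
    {i : Fin (finrank K V)} (hi : (i : ℕ) + 1 < finrank K V) :
    ∑ F : CompleteFlag K V with ∀ l, l ≠ i → F.1 l = C.1 l, Steinberg.coeff K V x F = 0 := by
  suffices H : ∀ (k : ℕ) (hk : finrank K V - 1 = k) (y : FlagChain (TitsVertex K V) k),
      y ∈ flagCycles (TitsVertex K V) k →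
      ∑ F : CompleteFlag K V with ∀ l, l ≠ i → F.1 l = C.1 l, y (F.toSimplex hk) = 0 from
    H _ rfl _ (Steinberg.toChain_mem_cycles x)
  intro k hk y hy
  obtain ⟨m, rfl⟩ : ∃ m, k = m + 1 := ⟨k - 1, by omega⟩
  have : Finite (TitsVertex K V) := inferInstance
  let _ : Fintype (FlagSimplex (TitsVertex K V) (m + 1)) := Fintype.ofFinite _
  let i' : Fin (m + 1) := ⟨i, by omega⟩
  -- the condition is the vanishing of the boundary at the face of `C` opposite to the vertex `C i`
  let c : FlagSimplex (TitsVertex K V) m := ⟨(C.toSimplex hk).1 ∘ i'.succAbove,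
    (C.toSimplex hk).2.comp (Fin.strictMono_succAbove i')⟩
  have h : flagBoundary (TitsVertex K V) m y c = 0 := by
    rw [LinearMap.mem_ker.1 hy]; rfl
  rw [flagBoundary_apply, ← (CompleteFlag.toSimplex_bijective hk).sum_comp] at h
  have key : ∀ F : CompleteFlag K V,
      (∑ j : Fin (m + 1), (-1 : ℚ) ^ (j : ℕ) *
        if (F.toSimplex hk).1 ∘ j.succAbove = c.1 then 1 else 0) =
      (-1) ^ (i : ℕ) * if ∀ l, l ≠ i → F.1 l = C.1 l then 1 else 0 := by
    intro F
    rw [Finset.sum_eq_single i']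
    · congr 2
      refine propext ⟨fun h l hl => ?_, fun h => ?_⟩
      · by_cases hl' : (l : ℕ) < m + 1
        · obtain ⟨t, ht⟩ := Fin.exists_succAbove_eq (x := ⟨l, hl'⟩) (y := i')
            (fun h => hl (Fin.ext (by simpa [i'] using h)))
          have := congrArg Subtype.val (congrFun h t)
          change (F.1 ⟨(i'.succAbove t : Fin (m + 1)), _⟩) =
            C.1 ⟨(i'.succAbove t : Fin (m + 1)), _⟩ at this
          have e : (⟨(i'.succAbove t : Fin (m + 1)), by omega⟩ : Fin (finrank K V)) = l :=
            Fin.ext (by simp [ht])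
          rwa [e] at this
        · have := l.2
          rw [F.eq_top (by omega), C.eq_top (by omega)]
      · funext t
        refine Subtype.ext (h _ fun h' : _ = i => Fin.succAbove_ne i' t (Fin.ext ?_))
        simpa [i'] using congrArg Fin.val h'
    -- omitting another vertex leaves a face with different dimensions
    · intro j _ hj
      rw [if_neg, mul_zero]
      intro h
      refine hj (Fin.succAbove_left_injective (funext fun t => Fin.ext ?_))
      have := congrArg (fun U : TitsVertex K V => finrank K U.1) (congrFun h t)
      change finrank K (F.1 ⟨(j.succAbove t : Fin (m + 1)), _⟩) =
        finrank K (C.1 ⟨(i'.succAbove t : Fin (m + 1)), _⟩) at this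
      rw [F.finrank_eq, C.finrank_eq] at this
      exact Nat.succ_injective this
    · simp
  have h1 : ∑ F : CompleteFlag K V, y (F.toSimplex hk) *
      ((-1) ^ (i : ℕ) * if ∀ l, l ≠ i → F.1 l = C.1 l then 1 else 0) = 0 := by
    refine (Finset.sum_congr rfl fun F _ => ?_).trans h
    rw [← key]
    congr!
  rw [Finset.sum_filter]
  have h2 : (-1 : ℚ) ^ (i : ℕ) * ∑ F : CompleteFlag K V,
      (if ∀ l, l ≠ i → F.1 l = C.1 l then y (F.toSimplex hk) else 0) = 0 := by
    rw [Finset.mul_sum]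
    refine (Finset.sum_congr rfl fun F _ => ?_).trans h1
    split_ifs <;> ring
  exact (mul_eq_zero.1 h2).resolve_left (pow_ne_zero _ (by norm_num))

/-- If a function of complete flags does not depend on the `i`-th subspace, where `Cᵢ` is
proper, then its pairing with any class in the Steinberg module vanishes. -/
lemma sum_coeff_smul_eq_zero [Finite V] {M : Type*} [AddCommGroup M] [Module ℚ M]
    (x : Steinberg K V) {i : Fin (finrank K V)} (hi : (i : ℕ) + 1 < finrank K V)
    (φ : CompleteFlag K V → M)
    (hφ : ∀ F F' : CompleteFlag K V, (∀ l, l ≠ i → F.1 l = F'.1 l) → φ F = φ F') :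
    ∑ F, Steinberg.coeff K V x F • φ F = 0 := by
  classical
  let r : CompleteFlag K V → ({l // l ≠ i} → Submodule K V) := fun F l => F.1 l.1
  rw [← Finset.sum_fiberwise_of_maps_to (s := Finset.univ) (t := Finset.univ.image r) (g := r)
    (fun F _ => Finset.mem_image_of_mem _ (Finset.mem_univ F))]
  refine Finset.sum_eq_zero fun y hy => ?_
  obtain ⟨C, -, rfl⟩ := Finset.mem_image.1 hy
  have hr : ∀ F : CompleteFlag K V, r F = r C ↔ ∀ l, l ≠ i → F.1 l = C.1 l := fun F =>
    ⟨fun h l hl => congrFun h ⟨l, hl⟩, fun h => funext fun l => h l.1 l.2⟩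
  simp only [hr]
  have : ∀ F ∈ Finset.univ.filter fun F : CompleteFlag K V => ∀ l, l ≠ i → F.1 l = C.1 l,
      Steinberg.coeff K V x F • φ F = Steinberg.coeff K V x F • φ C := by
    intro F hF
    rw [hφ F C (Finset.mem_filter.1 hF).2]
  rw [Finset.sum_congr rfl this, ← Finset.sum_smul, sum_coeff_adjacent_eq_zero x C hi, zero_smul]

end CompleteFlags

/-! ### Apartments as determinants of incidence matrices -/

section Incidence

open Module

variable {K V : Type*} [Field K] [AddCommGroup V] [Module K V]

lemma boole_congr {p q : Prop} {_ : Decidable p} {_ : Decidable q} (h : p ↔ q) :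
    (if p then (1 : ℚ) else 0) = if q then 1 else 0 := by
  by_cases hp : p
  · rw [if_pos hp, if_pos (h.1 hp)]
  · rw [if_neg hp, if_neg fun hq => hp (h.2 hq)]

open Classical in
/-- The incidence matrix of a family of vectors and a family of subspaces. -/
def incidence {ι κ : Type*} (B : ι → V) (C : κ → Submodule K V) : Matrix ι κ ℚ :=
  Matrix.of fun i j => if B i ∈ C j then 1 else 0

lemma incidence_of_mem {ι κ : Type*} {B : ι → V} {C : κ → Submodule K V} {i : ι} {j : κ}
    (h : B i ∈ C j) : incidence B C i j = 1 := if_pos h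

lemma incidence_of_notMem {ι κ : Type*} {B : ι → V} {C : κ → Submodule K V} {i : ι} {j : κ}
    (h : B i ∉ C j) : incidence B C i j = 0 := if_neg h

lemma incidence_congr {ι κ ι' κ' : Type*} {V' : Type*} [AddCommGroup V'] [Module K V']
    {B : ι → V} {C : κ → Submodule K V} {B' : ι' → V'} {C' : κ' → Submodule K V'}
    {i : ι} {j : κ} {i' : ι'} {j' : κ'} (h : B i ∈ C j ↔ B' i' ∈ C' j') :
    incidence B C i j = incidence B' C' i' j' := by
  by_cases h' : B i ∈ C j
  · rw [incidence_of_mem h', incidence_of_mem (h.1 h')]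
  · rw [incidence_of_notMem h', incidence_of_notMem (fun h'' => h' (h.2 h''))]

open Classical in
/-- The coefficients of an apartment are determinants of incidence matrices. The terms of the
determinant that are not flags spanned by the vectors cancel, by a column operation. -/
lemma sum_sign_span_eq_det [FiniteDimensional K V] {n : ℕ} {B : Fin n → V} (hB : ∀ i, B i ≠ 0)
    {C : Fin n → Submodule K V} (hC : StrictMono C) (hr : ∀ j, finrank K (C j) = j + 1)
    (ht : ∀ j : Fin n, (j : ℕ) + 1 = n → C j = ⊤) :
    (∑ σ : Equiv.Perm (Fin n), ((Equiv.Perm.sign σ : ℤ) : ℚ) *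
      if ∀ j : Fin n, (j : ℕ) + 1 < n → Submodule.span K (B ∘ σ '' {i | i ≤ j}) = C j
        then 1 else 0) = (incidence B C).det := by
  obtain _ | m := n
  · simp
  -- `N` arises by subtracting from each column, except the first and the last, the preceding one
  let N : Matrix (Fin (m + 1)) (Fin (m + 1)) ℚ := Matrix.of fun i j =>
    if B i ∈ C j ∧ ((j : ℕ) < m → ∀ l : Fin (m + 1), (l : ℕ) + 1 = j → B i ∉ C l) then 1 else 0
  have hdet : (incidence B C).det = N.det := by
    refine Matrix.det_eq_of_forall_col_eq_smul_add_pred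
      (fun j : Fin m => if (j : ℕ) + 1 < m then 1 else 0) (fun i => ?_) (fun i j => ?_)
    · simp only [incidence, N, Matrix.of_apply]
      congr 1
      simp
    · simp only [incidence, N, Matrix.of_apply]
      have h1 : B i ∈ C j.castSucc → B i ∈ C j.succ :=
        fun h => hC.monotone (Fin.castSucc_lt_succ (i := j)).le h
      have h2 : (∀ l : Fin (m + 1), (l : ℕ) + 1 = (j.succ : Fin (m + 1)) → B i ∉ C l) ↔
          B i ∉ C j.castSucc := by
        refine ⟨fun h => h _ (by simp), fun h l hl => ?_⟩
        have : l = j.castSucc := Fin.ext (by simp at hl; simpa using hl)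
        rwa [this]
      simp only [h2]
      simp only [Fin.val_succ]
      by_cases hj : (j : ℕ) + 1 < m <;> by_cases h3 : B i ∈ C j.castSucc <;>
        by_cases h4 : B i ∈ C j.succ <;> simp [hj, h3, h4]
      exact h4 (h1 h3)
  rw [hdet, Matrix.det_apply']
  refine Finset.sum_congr rfl fun σ _ => ?_
  congr 1
  simp only [N, Matrix.of_apply]
  refine Eq.trans ?_ Finset.prod_boole.symm
  refine boole_congr ⟨fun h j _ => ?_, fun h => ?_⟩
  · refine ⟨?_, fun hj l hl hmem => ?_⟩
    · by_cases hj : (j : ℕ) + 1 < m + 1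
      · rw [← h j hj]
        exact Submodule.subset_span ⟨j, le_refl j, rfl⟩
      · rw [ht j (by omega)]
        exact Submodule.mem_top
    · have hlt : C l < C j := hC (Fin.lt_def.2 (by omega))
      refine absurd ?_ hlt.not_ge
      rw [← h j (by omega), Submodule.span_le]
      rintro _ ⟨i, hi, rfl⟩
      rcases (show i ≤ j from hi).eq_or_lt with rfl | hi'
      · exact hmem
      · have : B (σ i) ∈ Submodule.span K (B ∘ σ '' {i | i ≤ l}) :=
          Submodule.subset_span ⟨i, Fin.le_def.2 (by have := Fin.lt_def.1 hi'; omega), rfl⟩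
        rwa [h l (by omega)] at this
  · have hle : ∀ j, Submodule.span K (B ∘ σ '' {i | i ≤ j}) ≤ C j := by
      intro j
      rw [Submodule.span_le]
      rintro _ ⟨i, hi, rfl⟩
      exact hC.monotone hi (h i (Finset.mem_univ i)).1
    rintro ⟨j, hj⟩
    induction j with
    | zero =>
      intro _
      refine Submodule.eq_of_le_of_finrank_le (hle _) ?_
      rw [hr, Nat.succ_le_iff, Module.finrank_pos_iff, Submodule.nontrivial_iff_ne_bot]
      intro hbot
      refine hB (σ ⟨0, hj⟩) ((Submodule.mem_bot K).1 ?_)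
      rw [← hbot]
      exact Submodule.subset_span ⟨_, le_refl (⟨0, hj⟩ : Fin (m + 1)), rfl⟩
    | succ k ih =>
      intro hk
      simp only at hk
      refine Submodule.eq_of_le_of_finrank_le (hle _) ?_
      have e := ih (by omega) (by simp only; omega)
      have hlt : C ⟨k, by omega⟩ <
          Submodule.span K (B ∘ σ '' {i | i ≤ (⟨k + 1, hj⟩ : Fin (m + 1))}) := by
        refine lt_of_le_of_ne ?_ fun heq => ?_
        · rw [← e]
          refine Submodule.span_mono (Set.image_mono fun i hi => ?_)
          exact le_trans hi (Fin.mk_le_mk.2 (Nat.le_succ k))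
        · refine (h ⟨k + 1, hj⟩ (Finset.mem_univ _)).2 (by simp only; omega) ⟨k, by omega⟩ rfl ?_
          rw [heq]
          exact Submodule.subset_span ⟨_, le_refl (⟨k + 1, hj⟩ : Fin (m + 1)), rfl⟩
      have := Submodule.finrank_lt_finrank_of_lt hlt
      rw [hr] at this ⊢
      exact this

lemma coeff_apartment [FiniteDimensional K V] (B : Fin (finrank K V) → V) (hB : ∀ i, B i ≠ 0)
    (C : CompleteFlag K V) :
    Steinberg.coeff K V (apartment rfl B hB) C = (incidence B C.1).det := by
  classical
  rw [← sum_sign_span_eq_det hB C.2.1 C.finrank_eq (fun j hj => C.eq_top hj)]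
  change flagChainMap (spanMap rfl B hB) rfl (fundamentalChain (finrank K V)) (C.toSimplex rfl) = _
  rw [fundamentalChain, map_sum, Finsupp.finsetSum_apply]
  refine Finset.sum_congr rfl fun σ _ => ?_
  rw [map_smul, flagChainMap_flagSimplex _ _ (permFlag_monotone _ σ), Finsupp.smul_apply,
    smul_eq_mul, flagSimplex_apply]
  congr 1
  have hset : ∀ j : Fin (finrank K V - 1),
      B '' (permFlag (finrank K V) σ j).1 = B ∘ σ '' {i | (i : ℕ) ≤ j} := by
    intro j
    rw [Set.image_comp]
    congr 1
    ext i
    simp [permFlag]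
  refine boole_congr ⟨fun h j hj => ?_, fun h => funext fun j => Subtype.ext ?_⟩
  · have := congrArg Subtype.val (congrFun h ⟨j, by omega⟩)
    change Submodule.span K (B '' (permFlag (finrank K V) σ ⟨j, by omega⟩).1) = C.1 j at this
    rwa [hset] at this
  · change Submodule.span K (B '' (permFlag (finrank K V) σ j).1) = C.1 ⟨j, by omega⟩
    rw [hset, ← h ⟨j, by omega⟩ (by simp only; omega)]
    rfl

/-- A family of vectors in a proper subspace has vanishing incidence determinants. -/
lemma det_incidence_eq_zero [FiniteDimensional K V] {U : Submodule K V} (hU : U ≠ ⊤)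
    {B : Fin (finrank K V) → V} (hB : ∀ i, B i ≠ 0) (hBU : ∀ i, B i ∈ U)
    (C : CompleteFlag K V) : (incidence B C.1).det = 0 := by
  have hpos : 0 < finrank K V := by
    have := Submodule.finrank_lt hU
    omega
  by_contra hdet
  refine hU ?_
  have h0 : ∀ j, C.1 j ⊓ U ≠ ⊥ := by
    intro j hj
    refine hdet (Matrix.det_eq_zero_of_column_eq_zero j fun i => incidence_of_notMem fun h => ?_)
    exact hB i ((Submodule.mem_bot K).1 (hj ▸ (⟨h, hBU i⟩ : B i ∈ C.1 j ⊓ U)))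
  have h1 : StrictMono fun j => C.1 j ⊓ U := by
    intro i j hij
    refine lt_of_le_of_ne (inf_le_inf_right U (C.2.1 hij).le) fun heq => ?_
    refine hdet (Matrix.det_zero_of_column_eq hij.ne fun k => incidence_congr ?_)
    have e : ∀ l, B k ∈ C.1 l ↔ B k ∈ C.1 l ⊓ U := fun l => ⟨fun h => ⟨h, hBU k⟩, fun h => h.1⟩
    rw [e i, e j]
    exact (SetLike.ext_iff.1 heq) (B k)
  have h2 := CompleteFlag.eq_top (⟨_, h1, h0⟩ : CompleteFlag K V)
    (j := ⟨finrank K V - 1, by omega⟩) (by simp only; omega)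
  exact top_le_iff.1 (h2.ge.trans inf_le_right)

/-- The cocycle relation: the incidence matrix of `n + 1` vectors, with a column of ones added,
has two equal columns. -/
lemma sum_det_incidence_succAbove {n : ℕ} (u : Fin (n + 1) → V) {C : Fin n → Submodule K V}
    {l : Fin n} (hl : C l = ⊤) :
    ∑ k : Fin (n + 1), (-1 : ℚ) ^ (k : ℕ) * (incidence (u ∘ k.succAbove) C).det = 0 := by
  let N : Matrix (Fin (n + 1)) (Fin (n + 1)) ℚ :=
    Matrix.of fun k => Fin.cons 1 (incidence u C k)
  have h0 : N.det = 0 := by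
    refine Matrix.det_zero_of_column_eq (i := 0) (j := l.succ) (Fin.succ_ne_zero l).symm
      fun k => ?_
    simp only [N, Matrix.of_apply, Fin.cons_zero, Fin.cons_succ]
    rw [incidence_of_mem (by rw [hl]; exact Submodule.mem_top)]
  rw [Matrix.det_succ_column_zero] at h0
  rw [← h0]
  refine Finset.sum_congr rfl fun k _ => ?_
  simp only [N, Matrix.of_apply, Fin.cons_zero, mul_one]
  rfl

/-- A choice of a nonzero vector in every nonzero subspace. -/
def IsVectorChoice (v : Submodule K V → V) : Prop := ∀ U, U ≠ ⊥ → v U ∈ U ∧ v U ≠ 0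

lemma exists_isVectorChoice : ∃ v : Submodule K V → V, IsVectorChoice v := by
  have h : ∀ U : Submodule K V, ∃ v, U ≠ ⊥ → v ∈ U ∧ v ≠ 0 := by
    intro U
    by_cases hU : U = ⊥
    · exact ⟨0, fun h => absurd hU h⟩
    · obtain ⟨v, hv⟩ := U.exists_mem_ne_zero_of_ne_bot hU
      exact ⟨v, fun _ => hv⟩
  choose v hv using h
  exact ⟨v, hv⟩

/-- The pairing does not depend on the choice of vectors. The two choices are joined by the prism
`v(F₀), …, v(Fᵢ), v'(Fᵢ), …, v'(Fₙ₋₁)`. -/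
lemma sum_coeff_mul_det_choice [Finite V] (x : Steinberg K V) (G : CompleteFlag K V)
    {v v' : Submodule K V → V} (hv : IsVectorChoice v) (hv' : IsVectorChoice v') :
    ∑ F, Steinberg.coeff K V x F * (incidence (fun j => v (F.1 j)) G.1).det =
      ∑ F, Steinberg.coeff K V x F * (incidence (fun j => v' (F.1 j)) G.1).det := by
  -- `hyb i` takes the first `i` vectors from `v` and the others from `v'`
  let hyb : ℕ → CompleteFlag K V → Fin (finrank K V) → V :=
    fun i F j => if (j : ℕ) < i then v (F.1 j) else v' (F.1 j)
  let S : ℕ → ℚ := fun i => ∑ F, Steinberg.coeff K V x F * (incidence (hyb i F) G.1).det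
  suffices H : ∀ i, i < finrank K V → S i = S (i + 1) by
    have h1 : ∀ i, i ≤ finrank K V → S i = S 0 := by
      intro i
      induction i with
      | zero => exact fun _ => rfl
      | succ i ih => exact fun hi => (H i hi).symm.trans (ih (Nat.le_of_succ_le hi))
    have h2 := h1 _ le_rfl
    simpa [S, hyb] using h2
  intro i hi
  -- the vertices of the prism: omitting the `i`-th or `(i + 1)`-st one gives `hyb i`, `hyb (i + 1)`
  let u : CompleteFlag K V → Fin (finrank K V + 1) → V := fun F k =>
    if hk : (k : ℕ) ≤ i then v (F.1 ⟨k, by omega⟩) else v' (F.1 ⟨k - 1, by omega⟩)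
  let T : Fin (finrank K V + 1) → ℚ := fun k =>
    ∑ F, Steinberg.coeff K V x F * (incidence (u F ∘ k.succAbove) G.1).det
  have hT : ∑ k : Fin (finrank K V + 1), (-1 : ℚ) ^ (k : ℕ) * T k = 0 := by
    simp only [T, Finset.mul_sum]
    rw [Finset.sum_comm]
    refine Finset.sum_eq_zero fun F _ => ?_
    have := sum_det_incidence_succAbove (u F) (C := G.1) (l := ⟨finrank K V - 1, by omega⟩)
      (G.eq_top (by simp only; omega))
    rw [← mul_zero (Steinberg.coeff K V x F), ← this, Finset.mul_sum]
    exact Finset.sum_congr rfl fun k _ => by ring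
  have hu : ∀ F (m : Fin (finrank K V + 1)) (l : Fin (finrank K V)), (m : ℕ) = l → (l : ℕ) ≤ i →
      u F m = v (F.1 l) := by
    intro F m l hml hl
    simp only [u, hml, hl, dif_pos]
  have hu' : ∀ F (m : Fin (finrank K V + 1)) (l : Fin (finrank K V)), (m : ℕ) = l + 1 →
      i ≤ (l : ℕ) → u F m = v' (F.1 l) := by
    intro F m l hml hl
    have h : ¬ (m : ℕ) ≤ i := by omega
    have e : (⟨m - 1, by omega⟩ : Fin (finrank K V)) = l := Fin.ext (by simp only; omega)
    simp only [u, h, dif_neg, not_false_iff, e]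
  let k₀ : Fin (finrank K V + 1) := ⟨i, by omega⟩
  let k₁ : Fin (finrank K V + 1) := ⟨i + 1, by omega⟩
  have hk01 : k₀ ≠ k₁ := fun h => by simpa [k₀, k₁] using congrArg Fin.val h
  have hT0 : T k₀ = S i := by
    refine Finset.sum_congr rfl fun F _ => ?_
    congr 3
    funext j
    simp only [Function.comp, hyb]
    split_ifs with h
    · have hlt : j.castSucc < k₀ := Fin.lt_def.2 h
      exact hu F _ j (by rw [Fin.succAbove_of_castSucc_lt _ _ hlt]; rfl) (by omega)
    · have hle : k₀ ≤ j.castSucc := Fin.le_def.2 (not_lt.1 h)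
      exact hu' F _ j (by rw [Fin.succAbove_of_le_castSucc _ _ hle]; rfl) (by omega)
  have hT1 : T k₁ = S (i + 1) := by
    refine Finset.sum_congr rfl fun F _ => ?_
    congr 3
    funext j
    simp only [Function.comp, hyb]
    split_ifs with h
    · have hlt : j.castSucc < k₁ := Fin.lt_def.2 h
      exact hu F _ j (by rw [Fin.succAbove_of_castSucc_lt _ _ hlt]; rfl) (by omega)
    · have hle : k₁ ≤ j.castSucc := Fin.le_def.2 (not_lt.1 h)
      exact hu' F _ j (by rw [Fin.succAbove_of_le_castSucc _ _ hle]; rfl) (by omega)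
  rw [Finset.sum_eq_add_of_mem k₀ k₁ (Finset.mem_univ _) (Finset.mem_univ _) hk01, hT0, hT1] at hT
  · have h3 : (-1 : ℚ) ^ i * (S i - S (i + 1)) = 0 := by
      rw [← hT]; simp only [k₀, k₁]; ring
    exact sub_eq_zero.1 ((mul_eq_zero.1 h3).resolve_left (pow_ne_zero _ (by norm_num)))
  -- Without its last vertex the prism lies in a proper subspace. Each remaining face of the prism
  -- does not depend on one of the proper subspaces of the flag.
  · rintro k - ⟨hk0, hk1⟩
    have hk0' : (k : ℕ) ≠ i := fun h => hk0 (Fin.ext h)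
    have hk1' : (k : ℕ) ≠ i + 1 := fun h => hk1 (Fin.ext h)
    have hkn := k.2
    refine mul_eq_zero_of_right _ ?_
    by_cases hkl : (k : ℕ) = finrank K V
    · refine Finset.sum_eq_zero fun F _ => mul_eq_zero_of_right _ ?_
      refine det_incidence_eq_zero (U := F.1 ⟨finrank K V - 2, by omega⟩)
        (F.ne_top (by simp only; omega)) (fun j => ?_) (fun j => ?_) G
      · simp only [Function.comp, u]
        split_ifs
        · exact (hv _ (F.2.2 _)).2
        · exact (hv' _ (F.2.2 _)).2
      · have hk : k = Fin.last _ := Fin.ext hkl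
        subst hk
        have hj := j.2
        simp only [Function.comp, u, Fin.succAbove_last, Fin.val_castSucc]
        split_ifs
        · exact F.2.1.monotone (Fin.mk_le_mk.2 (by omega)) (hv _ (F.2.2 _)).1
        · exact F.2.1.monotone (Fin.mk_le_mk.2 (by omega)) (hv' _ (F.2.2 _)).1
    · let l : Fin (finrank K V) := ⟨if (k : ℕ) < i then k else k - 1, by split_ifs <;> omega⟩
      refine sum_coeff_smul_eq_zero x (i := l) (by simp only [l]; split_ifs <;> omega)
        (fun F => (incidence (u F ∘ k.succAbove) G.1).det) fun F F' hF => ?_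
      congr 2
      funext j
      have hj : ((k.succAbove j : Fin _) : ℕ) ≠ k := fun h => Fin.succAbove_ne k j (Fin.ext h)
      simp only [Function.comp, u]
      generalize k.succAbove j = m at hj
      have hm := m.2
      split_ifs with h
      · rw [hF]
        intro h'
        have := congrArg Fin.val h'
        simp only [l] at this
        split_ifs at this <;> omega
      · rw [hF]
        intro h'
        have := congrArg Fin.val h'
        simp only [l] at this
        split_ifs at this <;> omega

/-- A class in the Steinberg module is recovered from its coefficients: it is the combination of
the apartments of the sequences of vectors chosen from the subspaces in the flags. -/
lemma sum_coeff_smul_apartment [Finite V] (x : Steinberg K V) {v : Submodule K V → V}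
    (hv : IsVectorChoice v) :
    ∑ F, Steinberg.coeff K V x F •
      apartment rfl (fun j => v (F.1 j)) (fun j => (hv _ (F.2.2 j)).2) = x := by
  refine Steinberg.coeff_injective (funext fun G => ?_)
  rw [map_sum, Finset.sum_apply]
  simp only [map_smul, Pi.smul_apply, smul_eq_mul, coeff_apartment]
  -- for a choice adapted to `G`, the incidence matrices become triangular
  have hw : ∃ w : Submodule K V → V, IsVectorChoice w ∧
      ∀ U, U ≠ ⊥ → ∀ j, w U ∈ G.1 j → U ≤ G.1 j := by
    have h : ∀ U : Submodule K V, ∃ w, U ≠ ⊥ → (w ∈ U ∧ w ≠ 0) ∧ ∀ j, w ∈ G.1 j → U ≤ G.1 j := by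
      intro U
      by_cases hU : U = ⊥
      · exact ⟨0, fun h => absurd hU h⟩
      by_cases hle : ∀ j, U ≤ G.1 j
      · obtain ⟨w, hw⟩ := U.exists_mem_ne_zero_of_ne_bot hU
        exact ⟨w, fun _ => ⟨hw, fun j _ => hle j⟩⟩
      · push Not at hle
        obtain ⟨j, hj, hmax⟩ := Set.Finite.exists_maximal
          (s := {j | ¬ U ≤ G.1 j}) (Set.toFinite _) hle
        obtain ⟨w, hwU, hwj⟩ := SetLike.not_le_iff_exists.1 hj
        refine ⟨w, fun _ => ⟨⟨hwU, fun h => hwj (h ▸ zero_mem _)⟩, fun i hi => ?_⟩⟩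
        by_contra hUi
        rcases le_total i j with hij | hij
        · exact hwj (G.2.1.monotone hij hi)
        · exact hwj (G.2.1.monotone (hmax hUi hij) hi)
    choose w hw using h
    exact ⟨w, fun U hU => (hw U hU).1, fun U hU => (hw U hU).2⟩
  obtain ⟨w, hw, hwG⟩ := hw
  rw [sum_coeff_mul_det_choice x G hv hw, Finset.sum_eq_single G]
  · have : (incidence (fun j => w (G.1 j)) G.1).det = 1 := by
      rw [Matrix.det_of_isUpperTriangular]
      · exact Finset.prod_eq_one fun j _ => incidence_of_mem (hw _ (G.2.2 j)).1
      · intro i j hij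
        exact incidence_of_notMem fun h => (G.2.1 hij).not_ge (hwG _ (G.2.2 i) j h)
    rw [this, mul_one]
  · intro F _ hF
    refine mul_eq_zero_of_right _ ?_
    have hle : ∀ i j, F.1 i ≤ G.1 j → i ≤ j := by
      intro i j h
      have := Submodule.finrank_mono h
      rw [F.finrank_eq, G.finrank_eq] at this
      exact Fin.le_def.2 (by omega)
    obtain ⟨i, hi⟩ : ∃ i, F.1 i ≠ G.1 i := by
      by_contra! h
      exact hF (Subtype.ext (funext h))
    rw [Matrix.det_of_isUpperTriangular]
    · refine Finset.prod_eq_zero (Finset.mem_univ i) (incidence_of_notMem fun h => hi ?_)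
      refine Submodule.eq_of_le_of_finrank_le (hwG _ (F.2.2 i) i h) ?_
      rw [F.finrank_eq, G.finrank_eq]
    · intro i j hij
      exact incidence_of_notMem fun h => hij.not_ge (hle i j (hwG _ (F.2.2 i) j h))
  · simp

/-- The apartments span the Steinberg module. -/
lemma span_apartment_eq_top [Finite V] :
    Submodule.span ℚ {x : Steinberg K V | ∃ B hB, x = apartment rfl B hB} = ⊤ := by
  obtain ⟨v, hv⟩ := exists_isVectorChoice (K := K) (V := V)
  refine eq_top_iff.2 fun x _ => ?_
  rw [← sum_coeff_smul_apartment x hv]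
  exact Submodule.sum_mem _ fun F _ => Submodule.smul_mem _ _ (Submodule.subset_span ⟨_, _, rfl⟩)

end Incidence

/-! ### Multilinear maps and spanning sets -/

section MultilinearInduction

/-- To prove a property of all families in `∏ M s` that is compatible with linear combinations in
each entry, it suffices to treat the families of elements of spanning sets. -/
lemma multilinear_span_induction {ι : Type*} [Finite ι] [DecidableEq ι] {M : ι → Type*}
    [∀ s, AddCommGroup (M s)] [∀ s, Module ℚ (M s)] {S : ∀ s, Set (M s)}
    (hS : ∀ s, Submodule.span ℚ (S s) = ⊤) {P : (∀ s, M s) → Prop}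
    (mem : ∀ x, (∀ s, x s ∈ S s) → P x)
    (zero : ∀ x s, P (Function.update x s 0))
    (add : ∀ x s a b, P (Function.update x s a) → P (Function.update x s b) →
      P (Function.update x s (a + b)))
    (smul : ∀ x s (c : ℚ) a, P (Function.update x s a) → P (Function.update x s (c • a)))
    (x : ∀ s, M s) : P x := by
  have := Fintype.ofFinite ι
  suffices H : ∀ a : Finset ι, ∀ x : ∀ s, M s, (∀ s ∉ a, x s ∈ S s) → P x from
    H Finset.univ x fun s hs => absurd (Finset.mem_univ s) hs
  intro a
  induction a using Finset.induction_on with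
  | empty => exact fun x hx => mem x fun s => hx s (Finset.notMem_empty s)
  | insert s a hs ih =>
    intro x hx
    have h : x s ∈ Submodule.span ℚ (S s) := hS s ▸ Submodule.mem_top
    suffices H : ∀ y ∈ Submodule.span ℚ (S s), P (Function.update x s y) by
      simpa using H _ h
    intro y hy
    induction hy using Submodule.span_induction with
    | mem y hy =>
      refine ih _ fun t ht => ?_
      rcases eq_or_ne t s with rfl | hts
      · simpa using hy
      · simpa [hts] using hx t (by simp [hts, ht])
    | zero => exact zero x s
    | add y z _ _ hy hz => exact add x s y z hy hz
    | smul c y _ hy => exact smul x s c y hy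

end MultilinearInduction

/-! ### The product of Steinberg classes -/

section Product

open Module

variable {K V : Type*} [Field K] [AddCommGroup V] [Module K V]

lemma apartment_cast {n : ℕ} (hn : finrank K V = n) (B : Fin n → V) (hB : ∀ i, B i ≠ 0) :
    apartment hn B hB = apartment rfl (B ∘ Fin.cast hn) (fun _ => hB _) := by
  subst hn; rfl

lemma apartment_congr {B B' : Fin (finrank K V) → V} (h : B = B') (hB : ∀ i, B i ≠ 0) :
    apartment rfl B hB = apartment rfl B' (h ▸ hB) := by
  subst h; rfl

lemma apartment_comp_perm [FiniteDimensional K V] (B : Fin (finrank K V) → V)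
    (hB : ∀ i, B i ≠ 0) (σ : Equiv.Perm (Fin (finrank K V))) :
    apartment rfl (B ∘ σ) (fun _ => hB _) =
      ((Equiv.Perm.sign σ : ℤ) : ℚ) • apartment rfl B hB := by
  refine Steinberg.coeff_injective (funext fun C => ?_)
  rw [map_smul, Pi.smul_apply, coeff_apartment, coeff_apartment, smul_eq_mul,
    ← Matrix.det_permute]
  rfl

lemma apartment_eq_zero [FiniteDimensional K V] {B : Fin (finrank K V) → V}
    (hB : ∀ i, B i ≠ 0) {U : Submodule K V} (hU : U ≠ ⊤) (h : ∀ i, B i ∈ U) :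
    apartment rfl B hB = 0 := by
  refine Steinberg.coeff_injective (funext fun C => ?_)
  rw [coeff_apartment, det_incidence_eq_zero hU hB h]
  simp

/-- The complete flag that a complete flag `C` of `V` induces on a subspace of `V`: its members are
the distinct nonzero intersections with the members of `C`. -/
lemma exists_completeFlag_comap {W : Type*} [AddCommGroup W] [Module K W] [FiniteDimensional K V]
    [FiniteDimensional K W] (f : W →ₗ[K] V) (hf : Function.Injective f) (C : CompleteFlag K V) :
    ∃ E : CompleteFlag K W, ∀ c, (C.1 c).comap f = ⊥ ∨ ∃ d, (C.1 c).comap f = E.1 d := by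
  let D : Fin (finrank K V) → Submodule K W := fun c => (C.1 c).comap f
  have hD : Monotone D := fun c c' h => Submodule.comap_mono (C.2.1.monotone h)
  have hle : finrank K W ≤ finrank K V := LinearMap.finrank_le_finrank_of_injective hf
  have hfin : ∀ U : Submodule K V, finrank K (U.comap f) =
      finrank K (LinearMap.range f ⊓ U : Submodule K V) := fun U => by
    rw [← Submodule.map_comap_eq]
    exact (Submodule.equivMapOfInjective f hf _).finrank_eq
  -- the dimension of the intersection with `W` increases by at most one in each step
  have hstep : ∀ c c' : Fin (finrank K V), (c' : ℕ) = c + 1 →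
      finrank K (D c') ≤ finrank K (D c) + 1 := by
    intro c c' hcc
    have hlt : C.1 c ≤ C.1 c' := C.2.1.monotone (Fin.le_def.2 (by omega))
    have h1 := Submodule.finrank_sup_add_finrank_inf_eq (C.1 c) (LinearMap.range f ⊓ C.1 c')
    have h2 : C.1 c ⊓ (LinearMap.range f ⊓ C.1 c') = LinearMap.range f ⊓ C.1 c := by
      rw [inf_left_comm, inf_eq_left.2 hlt]
    have h3 : finrank K (C.1 c ⊔ LinearMap.range f ⊓ C.1 c' : Submodule K V) ≤
        finrank K (C.1 c') := Submodule.finrank_mono (sup_le hlt inf_le_right)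
    rw [h2, ← hfin, ← hfin] at h1
    rw [C.finrank_eq] at h1 h3
    simp only [D]
    omega
  have hex : ∀ d : Fin (finrank K W), ∃ c, finrank K (D c) = d + 1 := by
    intro d
    have hd := d.2
    have h : ∃ c : ℕ, ∃ hc : c < finrank K V, (d : ℕ) + 1 ≤ finrank K (D ⟨c, hc⟩) := by
      refine ⟨finrank K V - 1, by omega, ?_⟩
      have htop : D ⟨finrank K V - 1, by omega⟩ = ⊤ := by
        simp only [D]
        rw [C.eq_top (by simp only; omega), Submodule.comap_top]
      rw [htop, finrank_top]
      omega
    obtain ⟨hc, hc'⟩ := Nat.find_spec h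
    refine ⟨⟨Nat.find h, hc⟩, le_antisymm ?_ hc'⟩
    rcases Nat.eq_zero_or_pos (Nat.find h) with h0 | h0
    · have h1 : finrank K (LinearMap.range f ⊓ C.1 ⟨Nat.find h, hc⟩ : Submodule K V) ≤
          finrank K (C.1 ⟨Nat.find h, hc⟩) := Submodule.finrank_mono inf_le_right
      rw [← hfin, C.finrank_eq] at h1
      simp only [D]
      simp only [h0] at h1 ⊢
      omega
    · have h1 := Nat.find_min h (m := Nat.find h - 1) (by omega)
      push Not at h1
      have h2 := h1 (by omega)
      have h3 := hstep ⟨Nat.find h - 1, by omega⟩ ⟨Nat.find h, hc⟩ (by simp only; omega)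
      omega
  choose c hc using hex
  have hcmp : ∀ a b, finrank K (D a) < finrank K (D b) → D a < D b := by
    intro a b hab
    rcases le_total a b with h | h
    · exact lt_of_le_of_ne (hD h) fun h' => hab.ne (by rw [h'])
    · exact absurd (Submodule.finrank_mono (hD h)) hab.not_ge
  refine ⟨⟨fun d => D (c d), fun d d' h => hcmp _ _ ?_, fun d h => ?_⟩, fun a => ?_⟩
  · rw [hc, hc]
    exact Nat.succ_lt_succ h
  · have := hc d
    have h' : D (c d) = ⊥ := h
    rw [h', finrank_bot] at this
    omega
  · by_cases h : D a = ⊥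
    · exact Or.inl h
    · right
      have h0 : 0 < finrank K (D a) := by
        rw [Module.finrank_pos_iff, Submodule.nontrivial_iff_ne_bot]; exact h
      have h1 : finrank K (D a) ≤ finrank K W := Submodule.finrank_le _
      refine ⟨⟨finrank K (D a) - 1, by omega⟩, ?_⟩
      have h2 := hc ⟨finrank K (D a) - 1, by omega⟩
      simp only at h2
      change D a = D (c _)
      rcases le_total a (c ⟨finrank K (D a) - 1, by omega⟩) with h3 | h3
      · exact Submodule.eq_of_le_of_finrank_le (hD h3) (by omega)
      · exact (Submodule.eq_of_le_of_finrank_le (hD h3) (by omega)).symm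

lemma det_sigma_of_blockTriangular {ι : Type*} [Fintype ι] [LinearOrder ι] {n : ι → ℕ}
    (M : Matrix (Σ s, Fin (n s)) (Σ s, Fin (n s)) ℚ) (h : ∀ x y, y.1 < x.1 → M x y = 0) :
    M.det = ∏ s, (Matrix.of fun i j => M ⟨s, i⟩ ⟨s, j⟩).det := by
  have hM : Matrix.BlockTriangular M Sigma.fst := fun x y hxy => h x y hxy
  rw [hM.det_fintype]
  refine Finset.prod_congr rfl fun s _ => ?_
  let e : Fin (n s) ≃ {a : Σ s, Fin (n s) // a.1 = s} :=
    { toFun := fun i => ⟨⟨s, i⟩, rfl⟩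
      invFun := fun a => a.2 ▸ a.1.2
      left_inv := fun _ => rfl
      right_inv := by rintro ⟨⟨_, i⟩, rfl⟩; rfl }
  rw [← Matrix.det_submatrix_equiv_self e]
  rfl

lemma finrank_eq_sum_blocks {ι : Type*} [Fintype ι] {W : ι → Type*} [∀ s, AddCommGroup (W s)]
    [∀ s, Module K (W s)] [∀ s, Finite (W s)] (φ : V ≃ₗ[K] ∀ s, W s) :
    finrank K V = ∑ s, finrank K (W s) := by
  rw [φ.finrank_eq, Module.finrank_pi_fintype]

section Blocks

variable {ι : Type*} [LinearOrder ι] {W : ι → Type*} [∀ s, AddCommGroup (W s)]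
  [∀ s, Module K (W s)]

/-- The inclusion of the summand `W s` under a decomposition `V ≃ ∏ W s`. -/
def blockInc (φ : V ≃ₗ[K] ∀ s, W s) (s : ι) : W s →ₗ[K] V :=
  φ.symm.toLinearMap ∘ₗ LinearMap.single K W s

lemma apply_blockInc (φ : V ≃ₗ[K] ∀ s, W s) (s : ι) (w : W s) :
    φ (blockInc φ s w) = Pi.single s w := by simp [blockInc]

lemma blockInc_injective (φ : V ≃ₗ[K] ∀ s, W s) (s : ι) : Function.Injective (blockInc φ s) :=
  φ.symm.injective.comp (Pi.single_injective s)

variable [Fintype ι] [∀ s, Finite (W s)]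

/-- The concatenation of blocks of sizes `dim W s`, in the order of the indices `s`. -/
def blockOrderIso (φ : V ≃ₗ[K] ∀ s, W s) :
    (Σₗ s, Fin (finrank K (W s))) ≃o Fin (finrank K V) :=
  (Fintype.orderIsoFinOfCardEq (Σₗ s, Fin (finrank K (W s))) (by
    rw [finrank_eq_sum_blocks φ]
    exact (Fintype.card_congr ofLex).trans (by simp))).symm

/-- The bijection underlying `blockOrderIso`. -/
def blockEquiv (φ : V ≃ₗ[K] ∀ s, W s) : (Σ s, Fin (finrank K (W s))) ≃ Fin (finrank K V) :=
  toLex.trans (blockOrderIso φ).toEquiv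

lemma blockEquiv_lt_iff (φ : V ≃ₗ[K] ∀ s, W s) (x y : Σ s, Fin (finrank K (W s))) :
    blockEquiv φ x < blockEquiv φ y ↔ toLex x < toLex y :=
  (blockOrderIso φ).lt_iff_lt

/-- The concatenation of sequences of vectors in the summands of `V`. -/
def concat (φ : V ≃ₗ[K] ∀ s, W s) (B : ∀ s, Fin (finrank K (W s)) → W s) :
    Fin (finrank K V) → V :=
  fun i => blockInc φ ((blockEquiv φ).symm i).1 (B _ ((blockEquiv φ).symm i).2)

lemma concat_blockEquiv (φ : V ≃ₗ[K] ∀ s, W s) (B : ∀ s, Fin (finrank K (W s)) → W s)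
    (x : Σ s, Fin (finrank K (W s))) :
    concat φ B (blockEquiv φ x) = blockInc φ x.1 (B x.1 x.2) := by
  rw [concat, Equiv.symm_apply_apply]

lemma concat_ne_zero (φ : V ≃ₗ[K] ∀ s, W s) {B : ∀ s, Fin (finrank K (W s)) → W s}
    (hB : ∀ s i, B s i ≠ 0) (i : Fin (finrank K V)) : concat φ B i ≠ 0 := fun h =>
  hB _ _ ((blockInc_injective φ _) (h.trans (map_zero _).symm))

lemma det_incidence_blockEquiv (φ : V ≃ₗ[K] ∀ s, W s) (B : Fin (finrank K V) → V)
    (C : Fin (finrank K V) → Submodule K V) :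
    (incidence (B ∘ blockEquiv φ) (C ∘ blockEquiv φ)).det = (incidence B C).det :=
  Matrix.det_submatrix_equiv_self (blockEquiv φ) (incidence B C)

variable [Finite V]

/-- The coefficients of the apartment of a concatenation are, up to factors independent of the
vectors, products of coefficients of apartments in the summands. -/
lemma exists_det_incidence_concat (φ : V ≃ₗ[K] ∀ s, W s) (C : CompleteFlag K V) :
    ∃ (κ : ℚ) (E : ∀ s, CompleteFlag K (W s)), ∀ B : ∀ s, Fin (finrank K (W s)) → W s,
      (∀ s i, B s i ≠ 0) →
      (incidence (concat φ B) C.1).det = κ * ∏ s, (incidence (B s) (E s).1).det := by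
  classical
  -- A vector of `W s` lies in a member of `C` if and only if it lies in the corresponding member of
  -- the induced flag, so the incidence matrix is block diagonal up to a factor depending on `C`.
  choose E hE using fun s => exists_completeFlag_comap (blockInc φ s) (blockInc_injective φ s) C
  let N : Matrix (Σ s, Fin (finrank K (W s))) (Σ s, Fin (finrank K (W s))) ℚ :=
    Matrix.of fun x y =>
      if (C.1 (blockEquiv φ y)).comap (blockInc φ x.1) = (E x.1).1 x.2 then 1 else 0
  refine ⟨N.det, E, fun B hB => ?_⟩
  have hN : incidence (concat φ B ∘ blockEquiv φ) (C.1 ∘ blockEquiv φ) =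
      Matrix.blockDiagonal' (fun s => incidence (B s) (E s).1) * N := by
    ext ⟨s, i⟩ y
    rw [Matrix.mul_apply, Fintype.sum_sigma, Finset.sum_eq_single s]
    · simp only [Matrix.blockDiagonal'_apply_eq, N, Matrix.of_apply]
      have hmem : (concat φ B ∘ blockEquiv φ) ⟨s, i⟩ ∈ (C.1 ∘ blockEquiv φ) y ↔
          B s i ∈ (C.1 (blockEquiv φ y)).comap (blockInc φ s) := by
        simp [concat_blockEquiv]
      rcases hE s (blockEquiv φ y) with h | ⟨d, hd⟩
      · rw [incidence_of_notMem, Finset.sum_eq_zero]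
        · intro d _
          rw [if_neg, mul_zero]
          rw [h]
          exact ((E s).2.2 d).symm
        · rw [hmem, h, Submodule.mem_bot]
          exact hB s i
      · rw [Finset.sum_eq_single d, if_pos hd, mul_one]
        · refine incidence_congr ?_
          rw [hmem, hd]
        · intro d' _ hd'
          rw [if_neg, mul_zero]
          rw [hd]
          exact fun h => hd' ((E s).2.1.injective h).symm
        · simp
    · intro t _ hts
      refine Finset.sum_eq_zero fun j _ => ?_
      rw [Matrix.blockDiagonal'_apply_ne _ _ _ hts.symm, zero_mul]
    · simp
  rw [← det_incidence_blockEquiv φ, hN, Matrix.det_mul, det_sigma_of_blockTriangular,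
    mul_comm]
  · congr 1
    refine Finset.prod_congr rfl fun s _ => congrArg Matrix.det (Matrix.ext fun i j => ?_)
    exact Matrix.blockDiagonal'_apply_eq (fun s => incidence (B s) (E s).1) s i j
  · rintro ⟨s, i⟩ ⟨t, j⟩ hst
    exact Matrix.blockDiagonal'_apply_ne _ _ _ hst.ne'

lemma exists_stProd (φ : V ≃ₗ[K] ∀ s, W s) :
    ∃ μ : MultilinearMap ℚ (fun s => Steinberg K (W s)) (Steinberg K V),
      ∀ B hB, μ (fun s => apartment rfl (B s) (hB s)) =
        apartment rfl (concat φ B) (concat_ne_zero φ hB) := by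
  choose κ E hE using exists_det_incidence_concat φ
  let f : MultilinearMap ℚ (fun s => Steinberg K (W s)) (CompleteFlag K V → ℚ) :=
    MultilinearMap.pi fun C => κ C • (MultilinearMap.mkPiAlgebra ℚ ι ℚ).compLinearMap
      fun s => LinearMap.proj (E C s) ∘ₗ Steinberg.coeff K (W s)
  have hf : ∀ B hB, f (fun s => apartment rfl (B s) (hB s)) =
      Steinberg.coeff K V (apartment rfl (concat φ B) (concat_ne_zero φ hB)) := by
    intro B hB
    funext C
    rw [coeff_apartment, hE C B hB]
    simp [f, coeff_apartment]
  have hmem : ∀ x, f x ∈ LinearMap.range (Steinberg.coeff K V) := by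
    refine multilinear_span_induction (fun s => span_apartment_eq_top (K := K) (V := W s))
      ?_ ?_ ?_ ?_
    · intro x hx
      choose B hB hx using hx
      obtain rfl : x = _ := funext hx
      exact ⟨_, (hf B hB).symm⟩
    · intro x s
      rw [f.map_update_zero]
      exact zero_mem _
    · intro x s a b ha hb
      rw [f.map_update_add]
      exact add_mem ha hb
    · intro x s c a ha
      rw [f.map_update_smul]
      exact Submodule.smul_mem _ _ ha
  refine ⟨(LinearEquiv.ofInjective _ (Steinberg.coeff_injective (K := K) (V := V))).symm.toLinearMap
    |>.compMultilinearMap (f.codRestrict _ hmem), fun B hB => ?_⟩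
  simp only [LinearMap.compMultilinearMap_apply, LinearEquiv.coe_coe]
  rw [LinearEquiv.symm_apply_eq]
  exact Subtype.ext (hf B hB)

/-- The product of classes in the Steinberg modules of the summands of `V`. It takes apartments to
the apartment of the concatenated sequence. -/
def stProd (φ : V ≃ₗ[K] ∀ s, W s) :
    MultilinearMap ℚ (fun s => Steinberg K (W s)) (Steinberg K V) :=
  (exists_stProd φ).choose

lemma stProd_apartment (φ : V ≃ₗ[K] ∀ s, W s) (B : ∀ s, Fin (finrank K (W s)) → W s)
    (hB : ∀ s i, B s i ≠ 0) :
    stProd φ (fun s => apartment rfl (B s) (hB s)) =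
      apartment rfl (concat φ B) (concat_ne_zero φ hB) :=
  (exists_stProd φ).choose_spec B hB

/-- The apartment of a sequence of vectors all of which lie in summands of a decomposition is a
multiple of a product. -/
lemma exists_apartment_eq_smul_stProd (φ : V ≃ₗ[K] ∀ s, W s) {B : Fin (finrank K V) → V}
    (hB : ∀ i, B i ≠ 0) (h : ∀ i, ∃ s, B i ∈ LinearMap.range (blockInc φ s)) :
    ∃ (c : ℚ) (x : ∀ s, Steinberg K (W s)), apartment rfl B hB = c • stProd φ x := by
  classical
  by_cases hspan : Submodule.span K (Set.range B) = ⊤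
  · choose t b hb using h
    have hli : LinearIndependent K B :=
      linearIndependent_of_top_le_span_of_card_eq_finrank hspan.ge (by simp)
    -- a basis of vectors in the summands has `dim W s` members in `W s`
    have hcard : ∀ s ∈ Finset.univ, Fintype.card {i // t i = s} ≤ finrank K (W s) := by
      intro s _
      have hb' : ∀ i : {i // t i = s}, ∃ w : W s, blockInc φ s w = B i.1 := by
        rintro ⟨i, rfl⟩
        exact ⟨b i, hb i⟩
      choose w hw using hb'
      have : LinearIndependent K w := by
        refine LinearIndependent.of_comp (blockInc φ s) ?_
        have e : blockInc φ s ∘ w = B ∘ Subtype.val := funext hw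
        rw [e]
        exact hli.comp _ Subtype.val_injective
      exact this.fintype_card_le_finrank
    have hsum : ∑ s, Fintype.card {i // t i = s} = ∑ s, finrank K (W s) := by
      rw [← finrank_eq_sum_blocks φ, ← Fintype.card_sigma,
        Fintype.card_congr (Equiv.sigmaFiberEquiv t), Fintype.card_fin]
    have heq := (Finset.sum_eq_sum_iff_of_le hcard).1 hsum
    let e : (Σ s, Fin (finrank K (W s))) ≃ Fin (finrank K V) :=
      (Equiv.sigmaCongrRight fun s =>
        (Fintype.equivFinOfCardEq (heq s (Finset.mem_univ s))).symm).trans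
          (Equiv.sigmaFiberEquiv t)
    have ht : ∀ x, t (e x) = x.1 := fun x =>
      ((Fintype.equivFinOfCardEq (heq x.1 (Finset.mem_univ _))).symm x.2).2
    have hB' : ∀ s (j : Fin (finrank K (W s))), ∃ w : W s, blockInc φ s w = B (e ⟨s, j⟩) := by
      intro s j
      have h : B (e ⟨s, j⟩) ∈ LinearMap.range (blockInc φ (t (e ⟨s, j⟩))) := ⟨_, hb _⟩
      rwa [ht] at h
    choose B' hB' using hB'
    have hB'0 : ∀ s j, B' s j ≠ 0 := by
      intro s j h0
      refine hB (e ⟨s, j⟩) ?_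
      rw [← hB', h0, map_zero]
    have hcomp : concat φ B' = B ∘ ((blockEquiv φ).symm.trans e) := by
      funext i
      exact hB' _ _
    refine ⟨((Equiv.Perm.sign ((blockEquiv φ).symm.trans e) : ℤ) : ℚ),
      fun s => apartment rfl (B' s) (hB'0 s), ?_⟩
    rw [stProd_apartment, apartment_congr hcomp, apartment_comp_perm B hB, smul_smul]
    rcases Int.units_eq_one_or (Equiv.Perm.sign ((blockEquiv φ).symm.trans e)) with h | h <;>
      simp [h]
  · refine ⟨0, 0, ?_⟩
    rw [zero_smul]
    exact apartment_eq_zero hB hspan fun i => Submodule.subset_span ⟨i, rfl⟩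

end Blocks

end Product

/-! ### Signs of block permutations -/

section BlockPermutation

lemma toLex_sigma_lt_iff_of_ne {ι : Type*} [LinearOrder ι] {n : ι → ℕ} {s t : ι} (h : s ≠ t)
    (i : Fin (n s)) (j : Fin (n t)) :
    (toLex (⟨s, i⟩ : Σ s, Fin (n s)) : Σₗ s, Fin (n s)) < toLex (⟨t, j⟩ : Σ s, Fin (n s)) ↔
      s < t := by
  refine Sigma.lex_iff.trans ⟨fun h' => h'.resolve_right fun ⟨h'', _⟩ => h h'', Or.inl⟩

lemma toLex_sigma_lt_iff {ι : Type*} [LinearOrder ι] {n : ι → ℕ} {s : ι} (i j : Fin (n s)) :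
    (toLex (⟨s, i⟩ : Σ s, Fin (n s)) : Σₗ s, Fin (n s)) < toLex (⟨s, j⟩ : Σ s, Fin (n s)) ↔
      i < j := by
  refine Sigma.lex_iff.trans ⟨?_, fun h => Or.inr ⟨rfl, h⟩⟩
  rintro (h | ⟨_, h⟩)
  · exact absurd h (lt_irrefl s)
  · exact h

/-- A permutation of blocks of even sizes is even. -/
lemma sign_sigmaCongr_eq_one {ι ι' : Type*} [Fintype ι] [LinearOrder ι] [LinearOrder ι']
    {n : ι → ℕ} {n' : ι' → ℕ} {N : ℕ} (q : (Σ s, Fin (n s)) ≃ Fin N)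
    (q' : (Σ t, Fin (n' t)) ≃ Fin N)
    (hq : ∀ x y, q x < q y ↔ toLex x < toLex y) (hq' : ∀ x y, q' x < q' y ↔ toLex x < toLex y)
    (τ : ι ≃ ι') (hn : ∀ s, n s = n' (τ s)) (hev : ∀ s, Even (n s)) :
    Equiv.Perm.sign (q.symm.trans
      ((Equiv.sigmaCongr τ fun s => finCongr (hn s)).trans q')) = 1 := by
  rw [Equiv.Perm.sign_eq_prod_prod_Ioi]
  have h1 : ∀ i : Fin N, ∀ f : Fin N → ℤˣ,
      ∏ j ∈ Finset.Ioi i, f j = ∏ j, if i < j then f j else 1 := by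
    intro i f
    rw [← Finset.prod_filter]
    congr 1
    ext j
    simp
  simp only [h1]
  rw [← q.prod_comp]
  refine Finset.prod_eq_one fun x _ => ?_
  rw [← q.prod_comp, Fintype.prod_sigma]
  refine Finset.prod_eq_one fun t _ => ?_
  obtain ⟨s, i⟩ := x
  have happ : ∀ s (j : Fin (n s)), (Equiv.sigmaCongr τ fun s => finCongr (hn s)) ⟨s, j⟩ =
      (⟨τ s, Fin.cast (hn s) j⟩ : Σ t, Fin (n' t)) := fun _ _ => rfl
  simp only [hq, Equiv.trans_apply, Equiv.symm_apply_apply, happ, hq']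
  rcases eq_or_ne s t with rfl | hst
  · refine Finset.prod_eq_one fun j _ => ?_
    simp only [toLex_sigma_lt_iff]
    split_ifs with h h'
    · rfl
    · exact absurd (Fin.lt_def.2 (Fin.lt_def.1 h)) h'
    · rfl
  · have hτ : τ s ≠ τ t := fun h => hst (τ.injective h)
    simp only [toLex_sigma_lt_iff_of_ne hst, toLex_sigma_lt_iff_of_ne hτ]
    simp only [Finset.prod_const, Finset.card_univ, Fintype.card_fin]
    obtain ⟨m, hm⟩ := hev t
    rw [hm, ← two_mul, pow_mul]
    simp

end BlockPermutation

/-! ### Naturality and symmetry of the product -/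

section Naturality

open Module

variable {K V V' : Type*} [Field K] [AddCommGroup V] [Module K V] [AddCommGroup V'] [Module K V']
  {ι ι' : Type*} [Fintype ι] [LinearOrder ι] [Fintype ι'] [LinearOrder ι']
  {W : ι → Type*} [∀ s, AddCommGroup (W s)] [∀ s, Module K (W s)]
  {W' : ι' → Type*} [∀ s, AddCommGroup (W' s)] [∀ s, Module K (W' s)]
  [Finite V] [∀ s, Finite (W s)] [Finite V'] [∀ s, Finite (W' s)]

/-- The product is natural, and independent of the order of the summands when these have even
dimension. -/
lemma map_stProd (φ : V ≃ₗ[K] ∀ s, W s) (φ' : V' ≃ₗ[K] ∀ t, W' t) (τ : ι ≃ ι') (e : V ≃ₗ[K] V')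
    (f : ∀ s, W s ≃ₗ[K] W' (τ s))
    (hf : ∀ s w, e (blockInc φ s w) = blockInc φ' (τ s) (f s w))
    (hev : ∀ s, Even (finrank K (W s))) (x : ∀ s, Steinberg K (W s))
    (y : ∀ t, Steinberg K (W' t)) (hy : ∀ s, y (τ s) = Steinberg.map (f s) (x s)) :
    Steinberg.map e (stProd φ x) = stProd φ' y := by
  classical
  revert y
  have hupd : ∀ (x : ∀ s, Steinberg K (W s)) (y : ∀ t, Steinberg K (W' t)) (s : ι)
      (c a : Steinberg K (W s)),
      (∀ t, y (τ t) = Steinberg.map (f t) (Function.update x s c t)) →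
      ∀ t, Function.update y (τ s) (Steinberg.map (f s) a) (τ t) =
        Steinberg.map (f t) (Function.update x s a t) := by
    intro x y s c a hy t
    rcases eq_or_ne t s with rfl | hts
    · simp
    · rw [Function.update_of_ne (fun h => hts (τ.injective h)), Function.update_of_ne hts, hy,
        Function.update_of_ne hts]
  refine multilinear_span_induction (fun s => span_apartment_eq_top (K := K) (V := W s))
    (P := fun x => ∀ y, (∀ s, y (τ s) = Steinberg.map (f s) (x s)) →
      Steinberg.map e (stProd φ x) = stProd φ' y) ?_ ?_ ?_ ?_ x
  · intro x hx y hy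
    choose B hB hx using hx
    obtain rfl : x = _ := funext hx
    have hr : ∀ s, finrank K (W s) = finrank K (W' (τ s)) := fun s => (f s).finrank_eq
    obtain ⟨B', hB'⟩ : ∃ B' : ∀ t, Fin (finrank K (W' t)) → W' t,
        ∀ s, B' (τ s) = f s ∘ B s ∘ Fin.cast (hr s).symm :=
      ⟨Equiv.piCongrLeft (fun t => Fin (finrank K (W' t)) → W' t) τ
        (fun s => f s ∘ B s ∘ Fin.cast (hr s).symm), fun s => Equiv.piCongrLeft_apply_apply _ _ _ s⟩
    have hB'0 : ∀ t i, B' t i ≠ 0 := by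
      intro t
      obtain ⟨s, rfl⟩ := τ.surjective t
      intro i
      rw [hB']
      simpa using hB s _
    have hy' : y = fun t => apartment rfl (B' t) (hB'0 t) := by
      funext t
      obtain ⟨s, rfl⟩ := τ.surjective t
      rw [hy, Steinberg.map_apartment, apartment_cast]
      exact (apartment_congr (hB' s) _).symm
    let π : Equiv.Perm (Fin (finrank K V')) := ((finCongr e.finrank_eq.symm).trans
      (blockEquiv φ).symm).trans ((Equiv.sigmaCongr τ fun s => finCongr (hr s)).trans
        (blockEquiv φ'))
    have hπ : Equiv.Perm.sign π = 1 :=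
      sign_sigmaCongr_eq_one ((blockEquiv φ).trans (finCongr e.finrank_eq)) (blockEquiv φ')
        (fun x y => blockEquiv_lt_iff φ x y) (blockEquiv_lt_iff φ') τ hr hev
    rw [hy', stProd_apartment, stProd_apartment, Steinberg.map_apartment, apartment_cast]
    have hcomp : (e ∘ concat φ B) ∘ Fin.cast e.finrank_eq.symm = concat φ' B' ∘ π := by
      funext i
      change e (blockInc φ _ _) = concat φ' B' (blockEquiv φ' _)
      rw [concat_blockEquiv, hf]
      refine congrArg (blockInc φ' _) ?_
      exact (congrFun (hB' ((blockEquiv φ).symm (Fin.cast e.finrank_eq.symm i)).1)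
        (Fin.cast (hr _) ((blockEquiv φ).symm (Fin.cast e.finrank_eq.symm i)).2)).symm
    rw [apartment_congr hcomp, apartment_comp_perm _ (concat_ne_zero φ' hB'0), hπ]
    simp
  · intro x s y hy
    have h := hy s
    rw [Function.update_self, map_zero] at h
    rw [(stProd φ).map_update_zero, map_zero, (stProd φ').map_coord_zero (τ s) h]
  · intro x s a b ha hb y hy
    have h : y = Function.update y (τ s) (Steinberg.map (f s) a + Steinberg.map (f s) b) := by
      rw [← map_add]
      refine (Function.update_eq_self_iff.2 ?_).symm
      rw [hy, Function.update_self]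
    rw [(stProd φ).map_update_add, map_add, h, (stProd φ').map_update_add,
      ha _ (hupd x y s _ a hy), hb _ (hupd x y s _ b hy)]
  · intro x s c a ha y hy
    have h : y = Function.update y (τ s) (c • Steinberg.map (f s) a) := by
      rw [← map_smul]
      refine (Function.update_eq_self_iff.2 ?_).symm
      rw [hy, Function.update_self]
    rw [(stProd φ).map_update_smul, map_smul, h, (stProd φ').map_update_smul,
      ha _ (hupd x y s _ a hy)]

end Naturality

/-! ### Joins of flags -/

section Join

open Module

variable {K V : Type*} [Field K] [AddCommGroup V] [Module K V]
  {ι : Type*} [LinearOrder ι]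
  {W : ι → Type*} [∀ s, AddCommGroup (W s)] [∀ s, Module K (W s)]

/-- The vectors whose component in the summand `s` lies in `U` and whose later components
vanish. -/
def joinSubspace (φ : V ≃ₗ[K] ∀ s, W s) (s : ι) (U : Submodule K (W s)) : Submodule K V where
  carrier := {v | (∀ r, s < r → φ v r = 0) ∧ φ v s ∈ U}
  add_mem' := fun ha hb =>
    ⟨fun r hr => by rw [map_add, Pi.add_apply, ha.1 r hr, hb.1 r hr, add_zero],
      by rw [map_add, Pi.add_apply]; exact add_mem ha.2 hb.2⟩
  zero_mem' := ⟨fun r _ => by simp, by simp⟩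
  smul_mem' := fun c v hv =>
    ⟨fun r hr => by rw [map_smul, Pi.smul_apply, hv.1 r hr, smul_zero],
      by rw [map_smul, Pi.smul_apply]; exact U.smul_mem c hv.2⟩

lemma mem_joinSubspace (φ : V ≃ₗ[K] ∀ s, W s) (s : ι) (U : Submodule K (W s)) (v : V) :
    v ∈ joinSubspace φ s U ↔ (∀ r, s < r → φ v r = 0) ∧ φ v s ∈ U := Iff.rfl

lemma blockInc_mem_joinSubspace (φ : V ≃ₗ[K] ∀ s, W s) (s : ι) (U : Submodule K (W s)) (w : W s) :
    blockInc φ s w ∈ joinSubspace φ s U ↔ w ∈ U := by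
  rw [mem_joinSubspace, apply_blockInc, Pi.single_eq_same]
  exact ⟨fun h => h.2, fun h => ⟨fun r hr => Pi.single_eq_of_ne hr.ne' w, h⟩⟩

variable [Fintype ι] [∀ s, Finite (W s)]

/-- The complete flag of `V` that runs through the given complete flags in the summands, one
summand after the other. -/
def joinFlag (φ : V ≃ₗ[K] ∀ s, W s) (G : ∀ s, CompleteFlag K (W s)) : CompleteFlag K V :=
  ⟨fun i => joinSubspace φ ((blockEquiv φ).symm i).1 ((G _).1 ((blockEquiv φ).symm i).2), by
    suffices H : ∀ x y : Σ s, Fin (finrank K (W s)), blockEquiv φ x < blockEquiv φ y →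
        joinSubspace φ x.1 ((G _).1 x.2) < joinSubspace φ y.1 ((G _).1 y.2) from
      fun i j hij => H _ _ (by simpa using hij)
    rintro ⟨s, i⟩ ⟨t, j⟩ h
    rw [blockEquiv_lt_iff] at h
    rcases eq_or_ne s t with rfl | hst
    · rw [toLex_sigma_lt_iff] at h
      have hlt := (G s).2.1 h
      refine lt_of_le_of_ne (fun v hv => ⟨hv.1, hlt.le hv.2⟩) fun heq => ?_
      obtain ⟨w, hw, hw'⟩ := SetLike.exists_of_lt hlt
      simp only at heq
      rw [← blockInc_mem_joinSubspace φ, ← heq, blockInc_mem_joinSubspace] at hw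
      exact hw' hw
    · rw [toLex_sigma_lt_iff_of_ne hst] at h
      refine lt_of_le_of_ne (fun v hv => ⟨fun r hr => hv.1 r (h.trans hr), ?_⟩) fun heq => ?_
      · simp only
        rw [hv.1 t h]
        exact zero_mem _
      · obtain ⟨w, hw, hw'⟩ := ((G t).1 j).exists_mem_ne_zero_of_ne_bot ((G t).2.2 j)
        simp only at heq
        rw [← blockInc_mem_joinSubspace φ, ← heq] at hw
        refine hw' ?_
        have := hw.1 t h
        rwa [apply_blockInc, Pi.single_eq_same] at this, by
    intro i h
    simp only at h
    generalize (blockEquiv φ).symm i = x at h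
    obtain ⟨w, hw, hw'⟩ := ((G x.1).1 x.2).exists_mem_ne_zero_of_ne_bot ((G x.1).2.2 x.2)
    rw [← blockInc_mem_joinSubspace φ] at hw
    rw [h, Submodule.mem_bot] at hw
    exact hw' (blockInc_injective φ _ (hw.trans (map_zero _).symm))⟩

lemma joinFlag_blockEquiv (φ : V ≃ₗ[K] ∀ s, W s) (G : ∀ s, CompleteFlag K (W s))
    (x : Σ s, Fin (finrank K (W s))) :
    (joinFlag φ G).1 (blockEquiv φ x) = joinSubspace φ x.1 ((G x.1).1 x.2) := by
  change joinSubspace φ ((blockEquiv φ).symm (blockEquiv φ x)).1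
    ((G _).1 ((blockEquiv φ).symm (blockEquiv φ x)).2) = _
  rw [Equiv.symm_apply_apply]

open Classical in
/-- The incidence matrix of a family of vectors with a join of flags, after subtracting from each
column the last column of the preceding block: a vector contributes only to the columns of the
block of its last nonzero component. -/
def leadingMatrix {κ : Type*} (φ : V ≃ₗ[K] ∀ s, W s) (B : κ → V)
    (G : ∀ s, CompleteFlag K (W s)) : Matrix κ (Σ s, Fin (finrank K (W s))) ℚ :=
  Matrix.of fun i x =>
    if ((∀ r, x.1 < r → φ (B i) r = 0) ∧ φ (B i) x.1 ≠ 0) ∧ φ (B i) x.1 ∈ (G x.1).1 x.2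
      then 1 else 0

lemma det_incidence_joinFlag (φ : V ≃ₗ[K] ∀ s, W s) (G : ∀ s, CompleteFlag K (W s))
    {B : Fin (finrank K V) → V} (hB : ∀ i, B i ≠ 0) :
    (incidence B (joinFlag φ G).1).det = (leadingMatrix φ (B ∘ blockEquiv φ) G).det := by
  classical
  -- Column `(s, j)` of the incidence matrix is the sum of column `(s, j)` of the leading matrix and
  -- of the last columns of all preceding blocks of the leading matrix.
  let N : Matrix (Σ s, Fin (finrank K (W s))) (Σ s, Fin (finrank K (W s))) ℚ :=
    Matrix.of fun x y =>
      if x = y ∨ (x.1 < y.1 ∧ (x.2 : ℕ) + 1 = finrank K (W x.1)) then 1 else 0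
  have hN : N.det = 1 := by
    rw [det_sigma_of_blockTriangular]
    · refine Finset.prod_eq_one fun s _ => ?_
      rw [← Matrix.det_one (n := Fin (finrank K (W s)))]
      congr 1
      ext i j
      simp [N, Matrix.one_apply]
    · intro x y hxy
      refine if_neg ?_
      rintro (rfl | h)
      · exact lt_irrefl _ hxy
      · exact lt_asymm hxy h.1
  rw [← det_incidence_blockEquiv φ, ← mul_one (leadingMatrix φ (B ∘ blockEquiv φ) G).det, ← hN,
    ← Matrix.det_mul]
  congr 1
  ext x ⟨s, j⟩
  rw [Matrix.mul_apply]
  set v := (B ∘ blockEquiv φ) x with hv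
  have hv0 : v ≠ 0 := hB _
  have hmem : v ∈ ((joinFlag φ G).1 ∘ blockEquiv φ) ⟨s, j⟩ ↔
      (∀ r, s < r → φ v r = 0) ∧ φ v s ∈ (G s).1 j := by
    rw [Function.comp_apply, joinFlag_blockEquiv, mem_joinSubspace]
  have hφv : φ v ≠ 0 := fun h => hv0 (φ.injective (h.trans (map_zero φ).symm))
  obtain ⟨r, hr, hmax⟩ : ∃ r, φ v r ≠ 0 ∧ ∀ t, r < t → φ v t = 0 := by
    obtain ⟨r, hr, hmax⟩ := Set.Finite.exists_maximal (s := {r | φ v r ≠ 0}) (Set.toFinite _)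
      (Function.ne_iff.1 hφv)
    refine ⟨r, hr, fun t ht => ?_⟩
    by_contra h
    exact ht.not_ge (hmax h ht.le)
  have hlead : ∀ t (i : Fin (finrank K (W t))), t ≠ r →
      leadingMatrix φ (B ∘ blockEquiv φ) G x ⟨t, i⟩ = 0 := by
    intro t i ht
    refine if_neg ?_
    rintro ⟨⟨h1, h2⟩, -⟩
    rcases lt_or_gt_of_ne ht with h | h
    · exact hr (h1 r h)
    · exact h2 (hmax t h)
  rw [Fintype.sum_sigma, Finset.sum_eq_single r (fun t _ ht => Finset.sum_eq_zero fun i _ => by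
    rw [hlead t i ht, zero_mul]) (by simp)]
  have hr' : ∀ i, leadingMatrix φ (B ∘ blockEquiv φ) G x ⟨r, i⟩ =
      if φ v r ∈ (G r).1 i then 1 else 0 := fun i =>
    boole_congr ⟨fun h => h.2, fun h => ⟨⟨hmax, hr⟩, h⟩⟩
  simp only [hr', N, Matrix.of_apply]
  rcases lt_trichotomy r s with h | rfl | h
  · have hpos : 0 < finrank K (W r) := by
      have : Nontrivial (W r) := nontrivial_of_ne _ _ hr
      exact Module.finrank_pos
    rw [Finset.sum_eq_single (⟨finrank K (W r) - 1, by omega⟩ : Fin (finrank K (W r)))]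
    · rw [if_pos, if_pos, mul_one]
      · refine incidence_of_mem (hmem.2 ⟨fun t ht => hmax t (h.trans ht), ?_⟩)
        rw [hmax s h]
        exact zero_mem _
      · exact Or.inr ⟨h, by simp only; omega⟩
      · rw [(G r).eq_top (by simp only; omega)]
        exact Submodule.mem_top
    · intro i _ hi
      rw [if_neg (c := _ ∨ _), mul_zero]
      rintro (h' | h')
      · exact h.ne (congrArg Sigma.fst h')
      · refine hi (Fin.ext ?_)
        simp only at h' ⊢
        omega
    · simp
  · rw [Finset.sum_eq_single j]
    · rw [if_pos (c := _ ∨ _) (Or.inl rfl), mul_one]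
      exact boole_congr (hmem.trans ⟨fun h => h.2, fun h => ⟨hmax, h⟩⟩)
    · intro i _ hi
      rw [if_neg (c := _ ∨ _), mul_zero]
      rintro (h' | h')
      · exact hi (by simpa using h')
      · exact lt_irrefl _ h'.1
    · simp
  · rw [Finset.sum_eq_zero]
    · refine incidence_of_notMem fun h' => ?_
      exact hr ((hmem.1 h').1 r h)
    · intro i _
      rw [if_neg (c := _ ∨ _), mul_zero]
      rintro (h' | h')
      · exact h.ne' (congrArg Sigma.fst h')
      · exact lt_asymm h h'.1

variable [Finite V]

/-- The coefficients of a product at a join of flags. -/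
lemma coeff_stProd_joinFlag (φ : V ≃ₗ[K] ∀ s, W s) (G : ∀ s, CompleteFlag K (W s))
    (x : ∀ s, Steinberg K (W s)) :
    Steinberg.coeff K V (stProd φ x) (joinFlag φ G) =
      ∏ s, Steinberg.coeff K (W s) (x s) (G s) := by
  classical
  let m : MultilinearMap ℚ (fun s => Steinberg K (W s)) ℚ :=
    (MultilinearMap.mkPiAlgebra ℚ ι ℚ).compLinearMap
      fun s => LinearMap.proj (G s) ∘ₗ Steinberg.coeff K (W s)
  change _ = m x
  refine multilinear_span_induction (fun s => span_apartment_eq_top (K := K) (V := W s))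
    (P := fun x => Steinberg.coeff K V (stProd φ x) (joinFlag φ G) = m x) ?_ ?_ ?_ ?_ x
  · intro x hx
    choose B hB hx using hx
    obtain rfl : x = _ := funext hx
    rw [stProd_apartment, coeff_apartment, det_incidence_joinFlag φ G (concat_ne_zero φ hB)]
    have hentry : ∀ x y, leadingMatrix φ (concat φ B ∘ blockEquiv φ) G x y =
        if x.1 = y.1 ∧ φ (blockInc φ x.1 (B x.1 x.2)) y.1 ∈ (G y.1).1 y.2 then 1 else 0 := by
      intro x y
      refine boole_congr ?_
      rw [Function.comp_apply, concat_blockEquiv, apply_blockInc]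
      refine and_congr_left' ⟨fun h => ?_, fun h => ⟨fun r hr => ?_, ?_⟩⟩
      · by_contra hxy
        exact h.2 (Pi.single_eq_of_ne (Ne.symm hxy) _)
      · exact Pi.single_eq_of_ne (h ▸ hr).ne' _
      · rw [← h, Pi.single_eq_same]
        exact hB _ _
    rw [det_sigma_of_blockTriangular]
    · simp only [m, MultilinearMap.compLinearMap_apply, MultilinearMap.mkPiAlgebra_apply,
        LinearMap.comp_apply, LinearMap.proj_apply, coeff_apartment]
      refine Finset.prod_congr rfl fun s _ => congrArg Matrix.det (Matrix.ext fun i j => ?_)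
      rw [Matrix.of_apply, hentry]
      refine boole_congr ?_
      simp [apply_blockInc]
    · intro x y hxy
      rw [hentry, if_neg]
      exact fun h => hxy.ne' h.1
  · intro x s
    rw [(stProd φ).map_update_zero, m.map_update_zero]
    simp
  · intro x s a b ha hb
    rw [(stProd φ).map_update_add, m.map_update_add, ← ha, ← hb]
    simp
  · intro x s c a ha
    rw [(stProd φ).map_update_smul, m.map_update_smul, ← ha]
    simp

end Join

/-! ### Functionals on joins of flags -/

section Functional

open Module

/-- Expansion of a determinant along a block of columns: the average of the Leibniz formula over
the permutations of the block. -/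
lemma factorial_mul_det_sigma {ι : Type*} [Fintype ι] [DecidableEq ι] {n : ι → ℕ}
    (M : Matrix (Σ s, Fin (n s)) (Σ s, Fin (n s)) ℚ) (s₀ : ι) :
    ((n s₀).factorial : ℚ) * M.det = ∑ σ : Equiv.Perm (Σ s, Fin (n s)),
      ((Equiv.Perm.sign σ : ℤ) : ℚ) *
        (∏ t ∈ Finset.univ.erase s₀, ∏ j, M (σ ⟨t, j⟩) ⟨t, j⟩) *
        (Matrix.of fun i j => M (σ ⟨s₀, i⟩) ⟨s₀, j⟩).det := by
  let e : Fin (n s₀) ≃ {a : Σ s, Fin (n s) // a.1 = s₀} :=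
    { toFun := fun i => ⟨⟨s₀, i⟩, rfl⟩
      invFun := fun a => a.2 ▸ a.1.2
      left_inv := fun _ => rfl
      right_inv := by rintro ⟨⟨_, i⟩, rfl⟩; rfl }
  have h1 : ∀ τ : Equiv.Perm (Fin (n s₀)), M.det = ∑ σ : Equiv.Perm (Σ s, Fin (n s)),
      ((Equiv.Perm.sign σ : ℤ) : ℚ) *
        (∏ t ∈ Finset.univ.erase s₀, ∏ j, M (σ ⟨t, j⟩) ⟨t, j⟩) *
        (((Equiv.Perm.sign τ : ℤ) : ℚ) * ∏ j, M (σ ⟨s₀, τ j⟩) ⟨s₀, j⟩) := by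
    intro τ
    rw [Matrix.det_apply', ← Equiv.sum_comp (Equiv.mulRight (τ.extendDomain e))]
    refine Finset.sum_congr rfl fun σ _ => ?_
    rw [Equiv.coe_mulRight, Equiv.Perm.sign_mul, Equiv.Perm.sign_extendDomain,
      Fintype.prod_sigma, ← Finset.mul_prod_erase Finset.univ _ (Finset.mem_univ s₀)]
    have h2 : ∀ j, (τ.extendDomain e) ⟨s₀, j⟩ = ⟨s₀, τ j⟩ := fun j =>
      Equiv.Perm.extendDomain_apply_image τ e j
    have h3 : ∀ t ∈ Finset.univ.erase s₀, ∀ j, (τ.extendDomain e) ⟨t, j⟩ = ⟨t, j⟩ := fun t ht j =>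
      Equiv.Perm.extendDomain_apply_not_subtype τ e (Finset.ne_of_mem_erase ht)
    have h4 : ∏ t ∈ Finset.univ.erase s₀, ∏ j, M ((σ * τ.extendDomain e) ⟨t, j⟩) ⟨t, j⟩ =
        ∏ t ∈ Finset.univ.erase s₀, ∏ j, M (σ ⟨t, j⟩) ⟨t, j⟩ :=
      Finset.prod_congr rfl fun t ht => Finset.prod_congr rfl fun j _ => by
        rw [Equiv.Perm.mul_apply, h3 t ht]
    rw [h4]
    simp only [Equiv.Perm.mul_apply, h2]
    push_cast
    ring
  have h5 : ((n s₀).factorial : ℚ) * M.det = ∑ _τ : Equiv.Perm (Fin (n s₀)), M.det := by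
    rw [Finset.sum_const, Finset.card_univ, Fintype.card_perm, Fintype.card_fin, nsmul_eq_mul]
  rw [h5, Finset.sum_congr rfl fun τ _ => h1 τ, Finset.sum_comm]
  refine Finset.sum_congr rfl fun σ _ => ?_
  rw [← Finset.mul_sum, Matrix.det_apply']
  rfl

lemma sum_pi_mul_eq_zero {ι : Type*} [Fintype ι] [DecidableEq ι] {X : ι → Type*}
    [∀ s, Fintype (X s)] (s₀ : ι) (a : (∀ s, X s) → ℚ) (b : X s₀ → ℚ)
    (ha : ∀ G G', (∀ s, s ≠ s₀ → G s = G' s) → a G = a G') (hb : ∑ g, b g = 0) :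
    ∑ G : ∀ s, X s, a G * b (G s₀) = 0 := by
  rw [← (Equiv.piSplitAt s₀ X).symm.sum_comp, Fintype.sum_prod_type_right]
  refine Finset.sum_eq_zero fun G _ => ?_
  rcases isEmpty_or_nonempty (X s₀) with h | ⟨⟨g₀⟩⟩
  · simp
  · have h1 : ∀ g, a ((Equiv.piSplitAt s₀ X).symm (g, G)) =
        a ((Equiv.piSplitAt s₀ X).symm (g₀, G)) := fun g => ha _ _ fun s hs => by
      simp [Equiv.piSplitAt, hs]
    have h2 : ∀ g, ((Equiv.piSplitAt s₀ X).symm (g, G)) s₀ = g := fun g => by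
      simp [Equiv.piSplitAt]
    simp only [h1, h2, ← Finset.mul_sum, hb, mul_zero]

variable {K V : Type*} [Field K] [AddCommGroup V] [Module K V]

/-- The apartment of vectors chosen from the subspaces in a complete flag. -/
def flagApartment (F : CompleteFlag K V) : Steinberg K V :=
  apartment rfl (fun j => (exists_isVectorChoice (K := K) (V := V)).choose (F.1 j))
    fun j => ((exists_isVectorChoice (K := K) (V := V)).choose_spec _ (F.2.2 j)).2

lemma sum_coeff_mul_flagApartment [Finite V] (l : Steinberg K V →ₗ[ℚ] ℚ) (x : Steinberg K V) :
    ∑ F, Steinberg.coeff K V x F * l (flagApartment F) = l x := by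
  have h := sum_coeff_smul_apartment x (exists_isVectorChoice (K := K) (V := V)).choose_spec
  conv_rhs => rw [← h]
  rw [map_sum]
  refine Finset.sum_congr rfl fun F _ => ?_
  rw [map_smul, smul_eq_mul]
  rfl

variable {ι : Type*} [Fintype ι] [LinearOrder ι]
  {W : ι → Type*} [∀ s, AddCommGroup (W s)] [∀ s, Module K (W s)]
  [Finite V] [∀ s, Finite (W s)]

/-- The functional on `St(V)` obtained from functionals on the `St(W s)`: the restriction to the
joins of flags is a coproduct `St(V) → ⨂ St(W s)`, to which the functionals are applied. -/
def joinFunctional (φ : V ≃ₗ[K] ∀ s, W s) (l : ∀ s, Steinberg K (W s) →ₗ[ℚ] ℚ) :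
    Steinberg K V →ₗ[ℚ] ℚ :=
  ∑ G : ∀ s, CompleteFlag K (W s), (∏ s, l s (flagApartment (G s))) •
    (LinearMap.proj (joinFlag φ G) ∘ₗ Steinberg.coeff K V)

lemma joinFunctional_apply (φ : V ≃ₗ[K] ∀ s, W s) (l : ∀ s, Steinberg K (W s) →ₗ[ℚ] ℚ)
    (x : Steinberg K V) : joinFunctional φ l x = ∑ G : ∀ s, CompleteFlag K (W s),
      (∏ s, l s (flagApartment (G s))) * Steinberg.coeff K V x (joinFlag φ G) := by
  simp [joinFunctional]

lemma joinFunctional_stProd (φ : V ≃ₗ[K] ∀ s, W s) (l : ∀ s, Steinberg K (W s) →ₗ[ℚ] ℚ)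
    (x : ∀ s, Steinberg K (W s)) : joinFunctional φ l (stProd φ x) = ∏ s, l s (x s) := by
  rw [joinFunctional_apply]
  rw [Finset.prod_congr rfl fun s _ => (sum_coeff_mul_flagApartment (l s) (x s)).symm,
    Finset.prod_univ_sum, Fintype.piFinset_univ]
  refine Finset.sum_congr rfl fun G _ => ?_
  rw [coeff_stProd_joinFlag, ← Finset.prod_mul_distrib]
  exact Finset.prod_congr rfl fun s _ => mul_comm _ _

/-- The component in `St(W s₀)` of the coproduct of an apartment is a combination of the
apartments of the `s₀`-components of those vectors whose later components vanish. -/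
lemma joinFunctional_apartment_eq_zero (φ : V ≃ₗ[K] ∀ s, W s)
    (l : ∀ s, Steinberg K (W s) →ₗ[ℚ] ℚ) (s₀ : ι) {B : Fin (finrank K V) → V}
    (hB : ∀ i, B i ≠ 0)
    (hl : ∀ b : Fin (finrank K (W s₀)) → V, (∀ j, b j ∈ Set.range B) →
      (∀ j r, s₀ < r → φ (b j) r = 0) → ∀ h : ∀ j, φ (b j) s₀ ≠ 0,
      l s₀ (apartment rfl (fun j => φ (b j) s₀) h) = 0) :
    joinFunctional φ l (apartment rfl B hB) = 0 := by
  classical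
  have hfac : ((finrank K (W s₀)).factorial : ℚ) ≠ 0 :=
    Nat.cast_ne_zero.2 (Nat.factorial_ne_zero _)
  refine (mul_eq_zero.1 ?_).resolve_left hfac
  rw [joinFunctional_apply, Finset.mul_sum]
  have hexp : ∀ G : ∀ s, CompleteFlag K (W s), ((finrank K (W s₀)).factorial : ℚ) *
      ((∏ s, l s (flagApartment (G s))) *
        Steinberg.coeff K V (apartment rfl B hB) (joinFlag φ G)) =
      ∑ σ : Equiv.Perm (Σ s, Fin (finrank K (W s))), (∏ s, l s (flagApartment (G s))) *
        (((Equiv.Perm.sign σ : ℤ) : ℚ) * (∏ t ∈ Finset.univ.erase s₀, ∏ j,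
          leadingMatrix φ (B ∘ blockEquiv φ) G (σ ⟨t, j⟩) ⟨t, j⟩) *
        (Matrix.of fun i j => leadingMatrix φ (B ∘ blockEquiv φ) G (σ ⟨s₀, i⟩) ⟨s₀, j⟩).det) := by
    intro G
    rw [coeff_apartment, det_incidence_joinFlag φ _ hB, mul_left_comm,
      factorial_mul_det_sigma (n := fun s => finrank K (W s))
        (leadingMatrix φ (B ∘ blockEquiv φ) G) s₀, Finset.mul_sum]
  rw [Finset.sum_congr rfl fun G _ => hexp G, Finset.sum_comm]
  refine Finset.sum_eq_zero fun σ _ => ?_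
  let b : Fin (finrank K (W s₀)) → V := fun j => B (blockEquiv φ (σ ⟨s₀, j⟩))
  let D : CompleteFlag K (W s₀) → ℚ := fun g => (Matrix.of fun i j =>
    if ((∀ r, s₀ < r → φ (b i) r = 0) ∧ φ (b i) s₀ ≠ 0) ∧ φ (b i) s₀ ∈ g.1 j
      then (1 : ℚ) else 0 : Matrix (Fin (finrank K (W s₀))) (Fin (finrank K (W s₀))) ℚ).det
  -- the sum over the flags in `W s₀` is the value of `l s₀` at an apartment
  have hD : ∑ g, l s₀ (flagApartment g) * D g = 0 := by
    by_cases hb : ∀ i, (∀ r, s₀ < r → φ (b i) r = 0) ∧ φ (b i) s₀ ≠ 0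
    · rw [← hl b (fun j => ⟨_, rfl⟩) (fun j => (hb j).1) (fun j => (hb j).2),
        ← sum_coeff_mul_flagApartment]
      refine Finset.sum_congr rfl fun g _ => ?_
      rw [coeff_apartment, mul_comm]
      refine congrArg (· * _) (congrArg Matrix.det (Matrix.ext fun i j => ?_))
      exact boole_congr ⟨fun h => h.2, fun h => ⟨hb i, h⟩⟩
    · push Not at hb
      obtain ⟨i, hi⟩ := hb
      refine Finset.sum_eq_zero fun g _ => mul_eq_zero_of_right _ ?_
      refine Matrix.det_eq_zero_of_row_eq_zero i fun j => if_neg fun h => ?_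
      exact h.1.2 (hi h.1.1)
  have hrow : ∀ G : ∀ s, CompleteFlag K (W s),
      (Matrix.of fun i j => leadingMatrix φ (B ∘ blockEquiv φ) G (σ ⟨s₀, i⟩) ⟨s₀, j⟩).det =
        D (G s₀) := by
    intro G
    refine congrArg Matrix.det (Matrix.ext fun i j => ?_)
    exact boole_congr Iff.rfl
  rw [← sum_pi_mul_eq_zero s₀ (fun G : ∀ s, CompleteFlag K (W s) =>
    (∏ s ∈ Finset.univ.erase s₀, l s (flagApartment (G s))) *
      (((Equiv.Perm.sign σ : ℤ) : ℚ) * ∏ t ∈ Finset.univ.erase s₀, ∏ j,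
        leadingMatrix φ (B ∘ blockEquiv φ) G (σ ⟨t, j⟩) ⟨t, j⟩))
    (fun g => l s₀ (flagApartment g) * D g) ?_ hD]
  · refine Finset.sum_congr rfl fun G _ => ?_
    rw [hrow, ← Finset.mul_prod_erase Finset.univ _ (Finset.mem_univ s₀)]
    ring
  · intro G G' hG
    congr 1
    · refine Finset.prod_congr rfl fun s hs => ?_
      rw [hG s (Finset.ne_of_mem_erase hs)]
    · congr 1
      refine Finset.prod_congr rfl fun t ht => Finset.prod_congr rfl fun j _ => boole_congr ?_
      simp only [hG t (Finset.ne_of_mem_erase ht)]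

end Functional

/-! ### Symplectic forms and symplectic splittings -/

section SymplecticForms

open LinearMap (BilinForm)
open Module

variable {K V : Type*} [Field K] [AddCommGroup V] [Module K V] {ω : BilinForm K V}

/-- A symplectic space has even dimension: a maximal isotropic subspace is its own orthogonal
complement. -/
lemma even_finrank_of_isAlt [FiniteDimensional K V] (hω : ω.IsAlt)
    (hn : ∀ x, (∀ y, ω x y = 0) → x = 0) : Even (finrank K V) := by
  have hrefl : ω.IsRefl := hω.isRefl
  have hnd : ω.Nondegenerate := by
    refine ⟨hn, fun y hy => hn y fun x => hrefl _ _ (hy x)⟩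
  obtain ⟨W, hW, hmax⟩ : ∃ W : Submodule K V, W ≤ ω.orthogonal W ∧
      ∀ W' : Submodule K V, W' ≤ ω.orthogonal W' → finrank K W' ≤ finrank K W := by
    have hfin : {n | ∃ W : Submodule K V, W ≤ ω.orthogonal W ∧ finrank K W = n}.Finite := by
      refine (Set.finite_Iic (finrank K V)).subset ?_
      rintro _ ⟨W, -, rfl⟩
      exact Submodule.finrank_le W
    obtain ⟨_, ⟨W, hW, rfl⟩, hmax⟩ := hfin.exists_maximal ⟨0, ⊥, bot_le, finrank_bot K V⟩
    exact ⟨W, hW, fun W' hW' => not_lt.1 fun h => h.not_ge (hmax ⟨W', hW', rfl⟩ h.le)⟩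
  have heq : ω.orthogonal W ≤ W := by
    intro x hx
    have hx' : ∀ w ∈ W, ω w x = 0 := BilinForm.mem_orthogonal_iff.1 hx
    have hiso : W ⊔ K ∙ x ≤ ω.orthogonal (W ⊔ K ∙ x) := by
      intro y hy
      rw [BilinForm.mem_orthogonal_iff]
      intro z hz
      obtain ⟨a, ha, b, hb, rfl⟩ := Submodule.mem_sup.1 hy
      obtain ⟨c, hc, d, hd, rfl⟩ := Submodule.mem_sup.1 hz
      obtain ⟨β, rfl⟩ := Submodule.mem_span_singleton.1 hb
      obtain ⟨δ, rfl⟩ := Submodule.mem_span_singleton.1 hd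
      have h1 : ω c a = 0 := BilinForm.mem_orthogonal_iff.1 (hW ha) c hc
      have h2 : ω x a = 0 := hrefl _ _ (hx' a ha)
      have h3 : ω x x = 0 := hω x
      simp [h1, h2, h3, hx' c hc]
    have hle := hmax _ hiso
    have := Submodule.eq_of_le_of_finrank_le (le_sup_left : W ≤ W ⊔ K ∙ x) hle
    rw [this]
    exact Submodule.mem_sup_right (Submodule.mem_span_singleton_self x)
  have h := BilinForm.finrank_orthogonal hnd W
  rw [← le_antisymm hW heq] at h
  have := Submodule.finrank_le W
  exact ⟨finrank K W, by omega⟩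

/-- The decomposition of `V` as a product of independent subspaces which span it. -/
def internalEquiv {ι : Type*} [Fintype ι] [LinearOrder ι] (W : ι → Submodule K V)
    (h : DirectSum.IsInternal W) : V ≃ₗ[K] ∀ i, W i :=
  (LinearEquiv.ofBijective (DirectSum.coeLinearMap W) h).symm ≪≫ₗ
    DirectSum.linearEquivFunOnFintype K ι (fun i => W i)

lemma blockInc_internalEquiv {ι : Type*} [Fintype ι] [LinearOrder ι] (W : ι → Submodule K V)
    (h : DirectSum.IsInternal W) (i : ι) (w : W i) :
    blockInc (internalEquiv W h) i w = w := by
  have : (internalEquiv W h).symm (Pi.single i w) = w := by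
    rw [internalEquiv, LinearEquiv.trans_symm, LinearEquiv.trans_apply, LinearEquiv.symm_symm]
    rw [DirectSum.linearEquivFunOnFintype_symm_single]
    exact DirectSum.coeLinearMap_lof W i w
  exact this

lemma sum_blockInc {ι : Type*} [Fintype ι] [LinearOrder ι] {W : ι → Type*}
    [∀ s, AddCommGroup (W s)] [∀ s, Module K (W s)] (φ : V ≃ₗ[K] ∀ s, W s) (x : V) :
    ∑ s, blockInc φ s (φ x s) = x := by
  simp only [blockInc, LinearMap.comp_apply, LinearMap.coe_single]
  rw [← map_sum, Finset.univ_sum_single]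
  exact φ.symm_apply_apply x

namespace SymplecticSplitting

lemma isInternal (S : SymplecticSplitting ω) (e : FamilyOrdering S.parts) :
    DirectSum.IsInternal fun j => (e.1 j).1 := by
  classical
  refine DirectSum.isInternal_submodule_of_iSupIndep_of_iSup_eq_top ?_ ?_
  · exact ((sSupIndep_iff _).1 S.independent).comp e.2.injective
  · rw [e.2.surjective.iSup_comp (fun s : S.parts => s.1), ← S.sSup_eq_top, sSup_eq_iSup']
    rfl

/-- The decomposition of `V` as the product of the subspaces in a symplectic splitting, in a given
order. -/
def splitEquiv (S : SymplecticSplitting ω) (e : FamilyOrdering S.parts) :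
    V ≃ₗ[K] ∀ j, (e.1 j).1 :=
  internalEquiv (fun j => (e.1 j).1) (S.isInternal e)

lemma blockInc_splitEquiv (S : SymplecticSplitting ω) (e : FamilyOrdering S.parts)
    (j : Fin (Fintype.card S.parts)) (w : (e.1 j).1) : blockInc (S.splitEquiv e) j w = w :=
  blockInc_internalEquiv (fun j => (e.1 j).1) (S.isInternal e) j w

lemma sum_splitEquiv (S : SymplecticSplitting ω) (e : FamilyOrdering S.parts) (x : V) :
    ∑ j, (S.splitEquiv e x j : V) = x := by
  conv_rhs => rw [← sum_blockInc (S.splitEquiv e) x]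
  simp only [blockInc_splitEquiv]

lemma mem_range_blockInc (S : SymplecticSplitting ω) (e : FamilyOrdering S.parts)
    {s : Submodule K V} (hs : s ∈ S.parts) {x : V} (hx : x ∈ s) :
    ∃ j, x ∈ LinearMap.range (blockInc (S.splitEquiv e) j) := by
  obtain ⟨j, hj⟩ := e.2.surjective ⟨s, hs⟩
  have : x ∈ (e.1 j).1 := by rw [hj]; exact hx
  exact ⟨j, ⟨x, this⟩, S.blockInc_splitEquiv e j _⟩

/-- The form restricts to a nondegenerate form on each subspace in a symplectic splitting. -/
lemma eq_zero_of_restrict (hn : ∀ x, (∀ y, ω x y = 0) → x = 0) (S : SymplecticSplitting ω)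
    {s : Submodule K V} (hs : s ∈ S.parts) (x : s) (h : ∀ y, ω.restrict s x y = 0) : x = 0 := by
  refine Subtype.ext (hn _ fun y => ?_)
  have : sSup (S.parts : Set (Submodule K V)) ≤ LinearMap.ker (ω x.1) := by
    refine sSup_le fun t ht z hz => ?_
    by_cases hst : s = t
    · subst hst
      exact h ⟨z, hz⟩
    · exact S.orthogonal s hs t ht hst x.1 x.2 z hz
  rw [S.sSup_eq_top] at this
  exact this (Submodule.mem_top (x := y))

lemma even_finrank [Finite V] (hω : ω.IsAlt) (hn : ∀ x, (∀ y, ω x y = 0) → x = 0)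
    (S : SymplecticSplitting ω) {s : Submodule K V} (hs : s ∈ S.parts) : Even (finrank K s) :=
  even_finrank_of_isAlt (ω := ω.restrict s) (fun x => hω x.1)
    (S.eq_zero_of_restrict hn hs)

/-- The splitting given by pairwise orthogonal subspaces that span a symplectic space. Such
subspaces are automatically independent. -/
def ofOrthogonal (hω : ω.IsAlt) (hn : ∀ x, (∀ y, ω x y = 0) → x = 0)
    (parts : Finset (Submodule K V)) (bot_notMem : ⊥ ∉ parts)
    (orthogonal : ∀ s ∈ parts, ∀ t ∈ parts, s ≠ t → ∀ x ∈ s, ∀ y ∈ t, ω x y = 0)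
    (sSup_eq_top : sSup (parts : Set (Submodule K V)) = ⊤) : SymplecticSplitting ω where
  parts := parts
  bot_notMem := bot_notMem
  orthogonal := orthogonal
  sSup_eq_top := sSup_eq_top
  independent := by
    intro s hs
    rw [Submodule.disjoint_def]
    intro x hx hx'
    refine hn x fun y => ?_
    have h1 : ∀ z ∈ s, ω x z = 0 := by
      intro z hz
      have : sSup ((parts : Set (Submodule K V)) \ {s}) ≤ LinearMap.ker (ω z) :=
        sSup_le fun t ht y hy => orthogonal s hs t ht.1 (fun h => ht.2 h.symm) z hz y hy
      exact hω.isRefl _ _ (this hx')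
    have : sSup (parts : Set (Submodule K V)) ≤ LinearMap.ker (ω x) := by
      refine sSup_le fun t ht z hz => ?_
      by_cases hst : s = t
      · subst hst
        exact h1 z hz
      · exact orthogonal s hs t ht hst x hx z hz
    rw [sSup_eq_top] at this
    exact this (Submodule.mem_top (x := y))

/-- A nontrivial orthogonal splitting of one of the subspaces in `S` gives a finer splitting. -/
lemma exists_refinement (hω : ω.IsAlt) (hn : ∀ x, (∀ y, ω x y = 0) → x = 0)
    (S : SymplecticSplitting ω) {s : Submodule K V} (hs : s ∈ S.parts) {P Q : Submodule K s}
    (hP : P ≠ ⊥) (hQ : Q ≠ ⊥) (hPQ : IsCompl P Q)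
    (ho : ∀ x ∈ P, ∀ y ∈ Q, ω.restrict s x y = 0) :
    ∃ S' : SymplecticSplitting ω, S.parts.card < S'.parts.card ∧
      (∀ t ∈ S.parts, t ≠ s → t ∈ S'.parts) ∧ P.map s.subtype ∈ S'.parts ∧
      Q.map s.subtype ∈ S'.parts := by
  classical
  set P' := P.map s.subtype with hP'
  set Q' := Q.map s.subtype with hQ'
  have hPs : P' ≤ s := Submodule.map_subtype_le s P
  have hQs : Q' ≤ s := Submodule.map_subtype_le s Q
  have hP0 : P' ≠ ⊥ := fun h => hP ((Submodule.map_injective_of_injective s.injective_subtype)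
    (h.trans (Submodule.map_bot _).symm))
  have hQ0 : Q' ≠ ⊥ := fun h => hQ ((Submodule.map_injective_of_injective s.injective_subtype)
    (h.trans (Submodule.map_bot _).symm))
  have hsup : P' ⊔ Q' = s := by
    rw [hP', hQ', ← Submodule.map_sup, hPQ.sup_eq_top, Submodule.map_subtype_top]
  have hne : P' ≠ Q' := by
    intro h
    have h' := Submodule.map_injective_of_injective s.injective_subtype h
    rw [h'] at hPQ
    exact hQ (disjoint_self.1 hPQ.disjoint)
  have ho1 : ∀ x ∈ P', ∀ y ∈ Q', ω x y = 0 := by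
    rintro _ ⟨x, hx, rfl⟩ _ ⟨y, hy, rfl⟩
    exact ho x hx y hy
  have hout : ∀ R ≤ s, R ≠ ⊥ → R ∉ S.parts.erase s := by
    intro R hR hR0 hmem
    obtain ⟨h1, h2⟩ := Finset.mem_erase.1 hmem
    refine hR0 (disjoint_self.1 ((S.independent hs).mono hR
      (le_sSup (Set.mem_sdiff_singleton.2 ⟨h2, h1⟩))))
  have hort : ∀ R R', R ∈ S.parts.erase s ∪ {P', Q'} → R' ∈ S.parts.erase s ∪ {P', Q'} →
      R ≠ R' → ∀ x ∈ R, ∀ y ∈ R', ω x y = 0 := by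
    have key : ∀ R ≤ s, ∀ R' ∈ S.parts.erase s, ∀ x ∈ R, ∀ y ∈ R', ω x y = 0 :=
      fun R hR R' hR' x hx y hy => S.orthogonal s hs R' (Finset.mem_of_mem_erase hR')
        (Finset.ne_of_mem_erase hR').symm x (hR hx) y hy
    have hsymm : ∀ x y, ω x y = 0 → ω y x = 0 := hω.isRefl
    intro R R' hR hR' hRR x hx y hy
    simp only [Finset.mem_union, Finset.mem_insert, Finset.mem_singleton] at hR hR'
    rcases hR with hR | rfl | rfl <;> rcases hR' with hR' | rfl | rfl
    · exact S.orthogonal R (Finset.mem_of_mem_erase hR) R' (Finset.mem_of_mem_erase hR') hRR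
        x hx y hy
    · exact hsymm _ _ (key _ hPs R hR y hy x hx)
    · exact hsymm _ _ (key _ hQs R hR y hy x hx)
    · exact key _ hPs R' hR' x hx y hy
    · exact absurd rfl hRR
    · exact ho1 x hx y hy
    · exact key _ hQs R' hR' x hx y hy
    · exact hsymm _ _ (ho1 y hy x hx)
    · exact absurd rfl hRR
  refine ⟨ofOrthogonal hω hn (S.parts.erase s ∪ {P', Q'}) ?_
    (fun R hR R' hR' => hort R R' hR hR') ?_,
    ?_, ?_, ?_, ?_⟩
  · simp only [Finset.mem_union, Finset.mem_insert, Finset.mem_singleton, not_or]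
    exact ⟨fun h => S.bot_notMem (Finset.mem_of_mem_erase h), hP0.symm, hQ0.symm⟩
  · rw [eq_top_iff, ← S.sSup_eq_top]
    refine sSup_le fun t ht => ?_
    by_cases hts : t = s
    · rw [hts, ← hsup]
      exact sup_le (le_sSup (by simp)) (le_sSup (by simp))
    · exact le_sSup (Finset.mem_coe.2 (Finset.mem_union_left _ (Finset.mem_erase.2 ⟨hts, ht⟩)))
  · change _ < (S.parts.erase s ∪ {P', Q'}).card
    rw [Finset.card_union_of_disjoint, Finset.card_pair hne, Finset.card_erase_of_mem hs]
    · have := Finset.card_pos.2 ⟨s, hs⟩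
      omega
    · rw [Finset.disjoint_right]
      intro R hR
      simp only [Finset.mem_insert, Finset.mem_singleton] at hR
      rcases hR with rfl | rfl
      exacts [hout _ hPs hP0, hout _ hQs hQ0]
  · exact fun t ht hts => Finset.mem_union_left _ (Finset.mem_erase.2 ⟨hts, ht⟩)
  · exact Finset.mem_union_right _ (by simp)
  · exact Finset.mem_union_right _ (by simp)

/-- A proper refinement of a splitting has strictly more members. -/
lemma eq_of_refines {S T : SymplecticSplitting ω} (h : ∀ s ∈ S.parts, ∃ t ∈ T.parts, s ≤ t)
    (hcard : S.parts.card ≤ T.parts.card) : S = T := by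
  classical
  have h' : ∀ s : S.parts, ∃ t : T.parts, s.1 ≤ t.1 := fun s => by
    obtain ⟨t, ht, hst⟩ := h s.1 s.2
    exact ⟨⟨t, ht⟩, hst⟩
  choose f hf using h'
  have hsurj : Function.Surjective f := by
    intro t
    by_contra hne
    push Not at hne
    have hle : sSup (S.parts : Set (Submodule K V)) ≤
        sSup ((T.parts : Set (Submodule K V)) \ {t.1}) := by
      refine sSup_le fun s hs => (hf ⟨s, hs⟩).trans (le_sSup ⟨(f ⟨s, hs⟩).2, fun h => ?_⟩)
      exact hne ⟨s, hs⟩ (Subtype.ext h)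
    rw [S.sSup_eq_top, top_le_iff] at hle
    have hd := T.independent t.2
    rw [hle, disjoint_top] at hd
    exact T.bot_notMem (hd ▸ t.2)
  have hbij : Function.Bijective f := by
    rw [Fintype.bijective_iff_surjective_and_card]
    refine ⟨hsurj, le_antisymm ?_ (Fintype.card_le_of_surjective f hsurj)⟩
    simpa using hcard
  have hfs : ∀ s, (f s).1 = s.1 := by
    intro s
    refine le_antisymm (fun x hx => ?_) (hf s)
    have htop : s.1 ⊔ sSup ((S.parts : Set (Submodule K V)) \ {s.1}) = ⊤ := by
      rw [eq_top_iff, ← S.sSup_eq_top]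
      refine sSup_le fun u hu => ?_
      by_cases hus : u = s.1
      · exact hus ▸ le_sup_left
      · exact le_sup_of_le_right (le_sSup ⟨hu, hus⟩)
    have hle : sSup ((S.parts : Set (Submodule K V)) \ {s.1}) ≤
        sSup ((T.parts : Set (Submodule K V)) \ {(f s).1}) := by
      refine sSup_le fun u hu => (hf ⟨u, hu.1⟩).trans (le_sSup ⟨(f ⟨u, hu.1⟩).2, fun h => ?_⟩)
      exact hu.2 (congrArg Subtype.val (hbij.1 (Subtype.ext h)))
    obtain ⟨a, ha, b, hb, rfl⟩ := Submodule.mem_sup.1 (htop ▸ Submodule.mem_top : x ∈ _)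
    have hb0 : b = 0 := by
      refine Submodule.disjoint_def.1 (T.independent (f s).2) b ?_ (hle hb)
      simpa using Submodule.sub_mem _ hx (hf s ha)
    simpa [hb0] using ha
  refine SymplecticSplitting.ext (Finset.eq_of_subset_of_card_le (fun s hs => ?_) ?_)
  · have h := (f ⟨s, hs⟩).2
    rwa [hfs] at h
  · simpa using Fintype.card_le_of_surjective f hsurj

instance [Finite V] : Finite (SymplecticSplitting ω) :=
  Finite.of_injective SymplecticSplitting.parts fun _ _ h => SymplecticSplitting.ext h

end SymplecticSplitting

/-- The splitting with one subspace, `V` itself. -/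
def trivialSplitting [Nontrivial V] (ω : BilinForm K V) : SymplecticSplitting ω where
  parts := {⊤}
  bot_notMem := by
    rw [Finset.mem_singleton]
    exact bot_ne_top
  orthogonal := by
    intro s hs t ht hst
    rw [Finset.mem_singleton] at hs ht
    exact absurd (hs.trans ht.symm) hst
  independent := by
    rw [Finset.coe_singleton]
    exact sSupIndep_singleton _
  sSup_eq_top := by simp

end SymplecticForms

/-! ### Unordered tensor products -/

section UnorderedTensorLemmas

open scoped Classical

/-- Products of functionals separate the points of a tensor product of rational vector spaces. -/
lemma piTensorProduct_eq_zero {ι : Type*} [Fintype ι] {M : ι → Type*} [∀ i, AddCommGroup (M i)]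
    [∀ i, Module ℚ (M i)] (z : ⨂[ℚ] i, M i)
    (h : ∀ (D : MultilinearMap ℚ M ℚ) (l : ∀ i, M i →ₗ[ℚ] ℚ),
      (∀ x, D x = ∏ i, l i (x i)) → PiTensorProduct.lift D z = 0) :
    z = 0 := by
  let b := fun i => Module.Basis.ofVectorSpace ℚ (M i)
  refine (Basis.piTensorProduct b).repr.map_eq_zero_iff.1 (Finsupp.ext fun p => ?_)
  have := h ((MultilinearMap.mkPiAlgebra ℚ ι ℚ).compLinearMap fun i => (b i).coord (p i))
    (fun i => (b i).coord (p i)) (fun x => by simp)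
  rw [Finsupp.zero_apply, ← this]
  have h2 : (Basis.piTensorProduct b).coord p = PiTensorProduct.lift
      ((MultilinearMap.mkPiAlgebra ℚ ι ℚ).compLinearMap fun i => (b i).coord (p i)) := by
    refine PiTensorProduct.ext (MultilinearMap.ext fun x => ?_)
    simp [Basis.piTensorProduct_repr_tprod_apply]
  exact DFunLike.congr_fun h2 z

variable {ι : Type*} [Fintype ι] {M : ι → Type*} [∀ i, AddCommGroup (M i)] [∀ i, Module ℚ (M i)]
  {N : Type*} [AddCommGroup N] [Module ℚ N]

/-- The linear map on a sum of ordered tensor products given by multilinear maps. -/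
def orderedLift (F : ∀ e : FamilyOrdering ι, MultilinearMap ℚ (fun j => M (e.1 j)) N) :
    OrderedTensorSum M →ₗ[ℚ] N :=
  DirectSum.toModule ℚ _ _ fun e => PiTensorProduct.lift (F e)

lemma orderedLift_orderedTensor
    (F : ∀ e : FamilyOrdering ι, MultilinearMap ℚ (fun j => M (e.1 j)) N)
    (e : FamilyOrdering ι) (f : ∀ j, M (e.1 j)) :
    orderedLift F (orderedTensor e f) = F e f := by
  rw [orderedLift, orderedTensor, DirectSum.toModule_lof, PiTensorProduct.lift.tprod]

/-- The linear map on an unordered tensor product given by a family of multilinear maps, one for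
each ordering, which is compatible with permutations. -/
def UnorderedTensor.lift (F : ∀ e : FamilyOrdering ι, MultilinearMap ℚ (fun j => M (e.1 j)) N)
    (hF : ∀ (σ : Equiv.Perm (Fin (Fintype.card ι))) (e : FamilyOrdering ι) (f : ∀ j, M (e.1 j)),
      F (e.permute σ) (fun j => f (σ.symm j)) = F e f) : UnorderedTensor M →ₗ[ℚ] N :=
  Representation.Coinvariants.lift _ (orderedLift F) fun σ => orderedTensor_hom_ext fun e f => by
    rw [LinearMap.comp_apply, orderedLift_orderedTensor]
    refine (congrArg (orderedLift F) (permuteTensor_apply M σ e f)).trans ?_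
    rw [orderedLift_orderedTensor, hF]

/-- The map from the tensor product in a given order to the unordered tensor product. -/
def UnorderedTensor.ofOrdered (e : FamilyOrdering ι) :
    (⨂[ℚ] j, M (e.1 j)) →ₗ[ℚ] UnorderedTensor M :=
  Representation.Coinvariants.mk (permuteTensorRep M) ∘ₗ
    DirectSum.lof ℚ (FamilyOrdering ι) (fun e => ⨂[ℚ] j, M (e.1 j)) e

lemma UnorderedTensor.ofOrdered_tprod (e : FamilyOrdering ι) (f : ∀ j, M (e.1 j)) :
    UnorderedTensor.ofOrdered e (PiTensorProduct.tprod ℚ f) =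
      Representation.Coinvariants.mk (permuteTensorRep M) (orderedTensor e f) := rfl

lemma UnorderedTensor.lift_mk
    (F : ∀ e : FamilyOrdering ι, MultilinearMap ℚ (fun j => M (e.1 j)) N) (hF)
    (e : FamilyOrdering ι) (f : ∀ j, M (e.1 j)) :
    UnorderedTensor.lift F hF (Representation.Coinvariants.mk (permuteTensorRep M)
      (orderedTensor e f)) = F e f :=
  orderedLift_orderedTensor F e f

lemma UnorderedTensor.ofOrdered_surjective (e : FamilyOrdering ι) :
    Function.Surjective (UnorderedTensor.ofOrdered (M := M) e) := by
  have htop : LinearMap.range (UnorderedTensor.ofOrdered (M := M) e) = ⊤ := by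
    have h : (LinearMap.range (UnorderedTensor.ofOrdered (M := M) e)).mkQ = 0 := by
      refine UnorderedTensor.hom_ext fun e' f => ?_
      rw [LinearMap.zero_apply, Submodule.mkQ_apply, Submodule.Quotient.mk_eq_zero]
      obtain ⟨σ, hσ⟩ : ∃ σ, e'.permute σ = e := by
        refine ⟨(Equiv.ofBijective _ e'.2).trans (Equiv.ofBijective _ e.2).symm,
          Subtype.ext (funext fun j => ?_)⟩
        exact Equiv.ofBijective_apply_symm_apply e'.1 e'.2 (e.1 j)
      subst hσ
      refine ⟨PiTensorProduct.tprod ℚ fun j => f (σ.symm j), ?_⟩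
      rw [UnorderedTensor.ofOrdered_tprod, ← permuteTensor_apply]
      exact Representation.Coinvariants.mk_self_apply (permuteTensorRep M) σ _
    rw [← Submodule.ker_mkQ (LinearMap.range _), h, LinearMap.ker_zero]
  exact LinearMap.range_eq_top.1 htop

/-- An element of an unordered tensor product vanishes if it is annihilated by the functionals
which on tensors in one given order are products of functionals. -/
lemma UnorderedTensor.eq_zero (e : FamilyOrdering ι) (y : UnorderedTensor M)
    (h : ∀ l : ∀ j, M (e.1 j) →ₗ[ℚ] ℚ, ∃ L : UnorderedTensor M →ₗ[ℚ] ℚ, L y = 0 ∧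
      ∀ f, L (Representation.Coinvariants.mk _ (orderedTensor e f)) = ∏ j, l j (f j)) :
    y = 0 := by
  obtain ⟨z, rfl⟩ := UnorderedTensor.ofOrdered_surjective e y
  rw [piTensorProduct_eq_zero z fun D l hD => ?_, map_zero]
  obtain ⟨L, hL, hL'⟩ := h l
  have : PiTensorProduct.lift D = L ∘ₗ UnorderedTensor.ofOrdered e := by
    refine PiTensorProduct.ext (MultilinearMap.ext fun f => ?_)
    change PiTensorProduct.lift D (PiTensorProduct.tprod ℚ f) =
      L (UnorderedTensor.ofOrdered e (PiTensorProduct.tprod ℚ f))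
    rw [UnorderedTensor.ofOrdered_tprod, hL', PiTensorProduct.lift.tprod, hD]
  rw [this, LinearMap.comp_apply, hL]

end UnorderedTensorLemmas

/-! ### The sum of products over splittings is surjective -/

section MultilinearMembership

variable {ι : Type*} [Finite ι] [DecidableEq ι] {M : ι → Type*}
    [∀ s, AddCommGroup (M s)] [∀ s, Module ℚ (M s)] {N : Type*} [AddCommGroup N] [Module ℚ N]

/-- A multilinear map which takes families of generators into a submodule takes families in the
spans of the generators into it. -/
lemma multilinear_mem_of_span (f : MultilinearMap ℚ M N) (R : Submodule ℚ N) (G : ∀ s, Set (M s))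
    (h : ∀ x, (∀ s, x s ∈ G s) → f x ∈ R) (x : ∀ s, M s)
    (hx : ∀ s, x s ∈ Submodule.span ℚ (G s)) : f x ∈ R := by
  let F := f.compLinearMap fun s => (Submodule.span ℚ (G s)).subtype
  have hF : ∀ x, F x ∈ R := by
    refine multilinear_span_induction (P := fun x => F x ∈ R)
      (fun s => Submodule.span_span_coe_preimage (R := ℚ) (s := G s)) ?_ ?_ ?_ ?_
    · exact fun x hx => h _ hx
    · intro x s
      rw [F.map_update_zero]
      exact zero_mem _
    · intro x s a b ha hb
      rw [F.map_update_add]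
      exact add_mem ha hb
    · intro x s c a ha
      rw [F.map_update_smul]
      exact Submodule.smul_mem _ _ ha
  exact hF fun s => ⟨x s, hx s⟩

/-- If a multilinear map takes families with an entry in `U` into `R`, then its values modulo `R`
only depend on the entries modulo `U`. -/
lemma multilinear_sub_mem (f : MultilinearMap ℚ M N) (R : Submodule ℚ N)
    (U : ∀ s, Submodule ℚ (M s)) (h : ∀ x j, ∀ y ∈ U j, f (Function.update x j y) ∈ R)
    (x x' : ∀ s, M s) (hx : ∀ s, x s - x' s ∈ U s) : f x - f x' ∈ R := by
  have := Fintype.ofFinite ι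
  have key : ∀ t : Finset ι, f x - f (t.piecewise x' x) ∈ R := by
    intro t
    induction t using Finset.induction_on with
    | empty => simp
    | insert j t hj ih =>
      rw [← sub_add_sub_cancel (f x) (f (t.piecewise x' x))]
      refine add_mem ih ?_
      have hpw : t.piecewise x' x = Function.update (t.piecewise x' x) j (x j) := by
        rw [eq_comm, Function.update_eq_self_iff, Finset.piecewise_eq_of_notMem _ _ _ hj]
      rw [Finset.piecewise_insert]
      conv => enter [2, 1]; rw [hpw]
      rw [← MultilinearMap.map_update_sub]
      exact h _ _ _ (hx j)
  simpa using key Finset.univ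

end MultilinearMembership

section SplittingSum

open scoped Classical
open LinearMap (BilinForm)
open Module

variable {K V : Type*} [Field K] [AddCommGroup V] [Module K V] {ω : BilinForm K V}

lemma mem_stSep_of_isSeparated {B : Fin (finrank K V) → V} (hB : ∀ i, B i ≠ 0)
    (h : IsSeparated ω B) : apartment rfl B hB ∈ stSep ω :=
  Submodule.subset_span ⟨_, rfl, B, hB, h, rfl⟩

lemma exists_familyOrdering (S : SymplecticSplitting ω) : Nonempty (FamilyOrdering S.parts) :=
  ⟨⟨_, (Fintype.equivFin S.parts).symm.bijective⟩⟩

variable [Finite V]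

/-- The product over the subspaces in `S`, in a given order, of lifts of classes in the
nonseparated quotients. -/
def splitMultilinear (sec : ∀ s : Submodule K V, StNS (ω.restrict s) →ₗ[ℚ] Steinberg K s)
    (S : SymplecticSplitting ω) (e : FamilyOrdering S.parts) :
    MultilinearMap ℚ (fun j => StNS (ω.restrict (e.1 j).1)) (Steinberg K V) :=
  (stProd (S.splitEquiv e)).compLinearMap fun j => sec (e.1 j).1

lemma splitMultilinear_apply
    (sec : ∀ s : Submodule K V, StNS (ω.restrict s) →ₗ[ℚ] Steinberg K s)
    (S : SymplecticSplitting ω) (e : FamilyOrdering S.parts)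
    (f : ∀ j, StNS (ω.restrict (e.1 j).1)) :
    splitMultilinear sec S e f = stProd (S.splitEquiv e) fun j => sec (e.1 j).1 (f j) := rfl

/-- The map `St^ns(S) → St(V)` obtained from sections `St^ns(s) → St(s)` and the product of the
Steinberg modules of the subspaces in `S`. As these subspaces have even dimension, the product does
not depend on their order. -/
def splitProd (hω : ω.IsAlt) (hn : ∀ x, (∀ y, ω x y = 0) → x = 0)
    (sec : ∀ s : Submodule K V, StNS (ω.restrict s) →ₗ[ℚ] Steinberg K s)
    (S : SymplecticSplitting ω) : StNSSplit S →ₗ[ℚ] Steinberg K V :=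
  UnorderedTensor.lift (M := fun s : S.parts => StNS (ω.restrict s.1))
    (splitMultilinear sec S) (by
      intro σ e f
      rw [splitMultilinear_apply, splitMultilinear_apply]
      refine (Steinberg.map_refl _).symm.trans
        (map_stProd (S.splitEquiv (e.permute σ)) (S.splitEquiv e) σ.symm (LinearEquiv.refl K V)
          (fun s => LinearEquiv.refl K _) (fun s w => ?_) (fun s => ?_) _ _ (fun s => ?_))
      · exact (S.blockInc_splitEquiv (e.permute σ) s w).trans
          (S.blockInc_splitEquiv e (σ.symm s) w).symm
      · exact S.even_finrank hω hn (e.1 (σ.symm s)).2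
      · exact (Steinberg.map_refl _).symm)

variable (hω : ω.IsAlt) (hn : ∀ x, (∀ y, ω x y = 0) → x = 0)
    (sec : ∀ s : Submodule K V, StNS (ω.restrict s) →ₗ[ℚ] Steinberg K s)

lemma splitProd_mk (S : SymplecticSplitting ω) (e : FamilyOrdering S.parts)
    (f : ∀ j, StNS (ω.restrict (e.1 j).1)) :
    splitProd hω hn sec S (Representation.Coinvariants.mk
      (permuteTensorRep fun s : S.parts => StNS (ω.restrict s.1))
      (orderedTensor (M := fun s : S.parts => StNS (ω.restrict s.1)) e f)) =
      stProd (S.splitEquiv e) fun j => sec (e.1 j).1 (f j) := by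
  rw [splitProd, UnorderedTensor.lift_mk]
  rfl

/-- The sum over all splittings of the maps `splitProd`. -/
def splitSum : (⨁ S : SymplecticSplitting ω, StNSSplit S) →ₗ[ℚ] Steinberg K V :=
  DirectSum.toModule ℚ _ _ fun S => splitProd hω hn sec S

lemma splitSum_lof (S : SymplecticSplitting ω) (x : StNSSplit S) :
    splitSum hω hn sec (DirectSum.lof ℚ _ (fun S : SymplecticSplitting ω => StNSSplit S) S x) =
      splitProd hω hn sec S x :=
  DirectSum.toModule_lof ℚ S x

lemma apartment_concat_mem {S : SymplecticSplitting ω} (e : FamilyOrdering S.parts)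
    (j : Fin (Fintype.card S.parts)) {R : Submodule ℚ (Steinberg K V)}
    (hR : ∀ S' : SymplecticSplitting ω, S.parts.card < S'.parts.card →
      ∀ (B : Fin (finrank K V) → V) (hB : ∀ i, B i ≠ 0), (∀ i, ∃ s ∈ S'.parts, B i ∈ s) →
        apartment rfl B hB ∈ R)
    (hω : ω.IsAlt) (hn : ∀ x, (∀ y, ω x y = 0) → x = 0)
    (B : ∀ j, Fin (finrank K (e.1 j).1) → (e.1 j).1) (hB : ∀ j i, B j i ≠ 0)
    (hj : IsSeparated (ω.restrict (e.1 j).1) (B j)) :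
    apartment rfl (concat (S.splitEquiv e) B) (concat_ne_zero _ hB) ∈ R := by
  obtain ⟨P, Q, hP, hQ, hPQ, ho, hBj⟩ := hj
  obtain ⟨S', hcard, hS', hPS, hQS⟩ := S.exists_refinement hω hn (e.1 j).2 hP hQ hPQ ho
  refine hR S' hcard _ _ fun i => ?_
  obtain ⟨⟨r, k⟩, rfl⟩ := (blockEquiv (S.splitEquiv e)).surjective i
  rw [concat_blockEquiv, S.blockInc_splitEquiv e r (B r k)]
  by_cases hr : r = j
  · subst hr
    rcases hBj k with h | h
    · exact ⟨_, hPS, _, h, rfl⟩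
    · exact ⟨_, hQS, _, h, rfl⟩
  · refine ⟨_, hS' (e.1 r).1 (e.1 r).2 fun h => hr (e.2.injective (Subtype.ext h)), (B r k).2⟩

/-- Modulo the products over finer splittings, a product over a splitting only depends on the
classes of the factors modulo separated apartments. -/
lemma stProd_update_mem {S : SymplecticSplitting ω} (e : FamilyOrdering S.parts)
    {R : Submodule ℚ (Steinberg K V)}
    (hR : ∀ S' : SymplecticSplitting ω, S.parts.card < S'.parts.card →
      ∀ (B : Fin (finrank K V) → V) (hB : ∀ i, B i ≠ 0), (∀ i, ∃ s ∈ S'.parts, B i ∈ s) →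
        apartment rfl B hB ∈ R)
    (hω : ω.IsAlt) (hn : ∀ x, (∀ y, ω x y = 0) → x = 0)
    (x : ∀ j, Steinberg K (e.1 j).1) (j : Fin (Fintype.card S.parts))
    (y : Steinberg K (e.1 j).1) (hy : y ∈ stSep (ω.restrict (e.1 j).1)) :
    stProd (S.splitEquiv e) (Function.update x j y) ∈ R := by
  refine multilinear_mem_of_span _ R (fun r => {z : Steinberg K (e.1 r).1 | ∃ B hB,
    z = apartment rfl B hB ∧ (r = j → IsSeparated (ω.restrict (e.1 r).1) B)}) ?_ _ ?_
  · intro x hx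
    choose B hB hx hsep using hx
    obtain rfl : x = _ := funext hx
    have h := stProd_apartment (S.splitEquiv e) B hB
    rw [h]
    exact apartment_concat_mem e j hR hω hn B hB (hsep j rfl)
  · intro r
    by_cases hr : r = j
    · subst hr
      rw [Function.update_self]
      refine Submodule.span_mono ?_ hy
      rintro _ ⟨n, rfl, B, hB, hs, rfl⟩
      exact ⟨B, hB, rfl, fun _ => hs⟩
    · rw [Function.update_of_ne hr]
      have h := span_apartment_eq_top (K := K) (V := (e.1 r).1)
      refine Submodule.span_mono ?_ (h ▸ Submodule.mem_top : x r ∈ _)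
      rintro _ ⟨B, hB, rfl⟩
      exact ⟨B, hB, rfl, fun h => absurd h hr⟩

/-- Apartments of vectors which lie in the subspaces of a splitting are in the image of
`splitSum`. -/
lemma apartment_mem_range_splitSum
    (hsec : ∀ s x, (stSep (ω.restrict s)).mkQ (sec s x) = x) (S : SymplecticSplitting ω)
    (B : Fin (finrank K V) → V) (hB : ∀ i, B i ≠ 0) (h : ∀ i, ∃ s ∈ S.parts, B i ∈ s) :
    apartment rfl B hB ∈ LinearMap.range (splitSum hω hn sec) := by
  let _ := Fintype.ofFinite (Submodule K V)
  induction hk : Fintype.card (Submodule K V) - S.parts.card using Nat.strong_induction_on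
    generalizing S B with
  | _ k ih =>
    subst hk
    have hR : ∀ S' : SymplecticSplitting ω, S.parts.card < S'.parts.card →
        ∀ (B : Fin (finrank K V) → V) (hB : ∀ i, B i ≠ 0), (∀ i, ∃ s ∈ S'.parts, B i ∈ s) →
          apartment rfl B hB ∈ LinearMap.range (splitSum hω hn sec) := by
      intro S' hS' B hB h
      have := S'.parts.card_le_univ
      exact ih _ (by omega) S' B hB h rfl
    obtain ⟨e⟩ := exists_familyOrdering S
    obtain ⟨c, x, hx⟩ := exists_apartment_eq_smul_stProd (S.splitEquiv e) hB fun i => by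
      obtain ⟨s, hs, hi⟩ := h i
      exact S.mem_range_blockInc e hs hi
    rw [hx]
    refine Submodule.smul_mem _ _ ?_
    have h1 := multilinear_sub_mem (stProd (S.splitEquiv e)) (LinearMap.range (splitSum hω hn sec))
      (fun j => stSep (ω.restrict (e.1 j).1)) (stProd_update_mem e hR hω hn) x
      (fun j => sec (e.1 j).1 ((stSep (ω.restrict (e.1 j).1)).mkQ (x j))) (fun j => by
        refine (Submodule.Quotient.eq _).1 ?_
        exact (hsec (e.1 j).1 _).symm)
    refine (Submodule.sub_mem_iff_left _ ?_).1 h1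
    exact ⟨_, (splitSum_lof hω hn sec S _).trans (splitProd_mk hω hn sec S e _)⟩

lemma splitSum_surjective [Nontrivial V]
    (hsec : ∀ s x, (stSep (ω.restrict s)).mkQ (sec s x) = x) :
    Function.Surjective (splitSum hω hn sec) := by
  rw [← LinearMap.range_eq_top, eq_top_iff, ← span_apartment_eq_top, Submodule.span_le]
  rintro _ ⟨B, hB, rfl⟩
  exact apartment_mem_range_splitSum hω hn sec hsec (trivialSplitting ω) B hB fun i =>
    ⟨⊤, Finset.mem_singleton_self _, Submodule.mem_top⟩

end SplittingSum

/-! ### The sum of products over splittings is injective -/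

section SplittingSumInjective

open scoped Classical
open LinearMap (BilinForm)
open Module

variable {K V : Type*} [Field K] [AddCommGroup V] [Module K V] {ω : BilinForm K V}

/-- Let the vectors of `c` lie in the subspaces of `V` belonging to a splitting `T`, and let `s` be
a symplectic subspace contained in no such subspace. If the vectors of `c` lie in `s`, their
apartment is separated, or zero. -/
lemma apartment_mem_stSep_of_not_le (hω : ω.IsAlt) (T : SymplecticSplitting ω)
    {s : Submodule K V} [Finite s] (hs : ∀ x : s, (∀ y, ω.restrict s x y = 0) → x = 0)
    (hs0 : s ≠ ⊥)
    (hsT : ∀ t ∈ T.parts, ¬ s ≤ t) {c : Fin (finrank K s) → s} (hc : ∀ i, c i ≠ 0)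
    (h : ∀ i, ∃ t ∈ T.parts, (c i : V) ∈ t) : apartment rfl c hc ∈ stSep (ω.restrict s) := by
  by_cases hspan : Submodule.span K (Set.range c) = ⊤
  swap
  · rw [apartment_eq_zero hc hspan fun i => Submodule.subset_span ⟨i, rfl⟩]
    exact zero_mem _
  refine mem_stSep_of_isSeparated hc ?_
  choose t ht hct using h
  have hpos : 0 < finrank K s := by
    rw [finrank_pos_iff]
    exact Submodule.nontrivial_iff_ne_bot.2 hs0
  -- `P` is cut out by the member of `T` that contains the first vector, and `Q` is spanned by the
  -- vectors outside `P`, which lie in other members of `T`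
  let P : Submodule K s := (t ⟨0, hpos⟩).comap s.subtype
  let Q : Submodule K s := Submodule.span K {x | x ∈ Set.range c ∧ x ∉ P}
  have ho : ∀ x ∈ P, ∀ y ∈ Q, ω.restrict s x y = 0 := by
    intro x hx
    have hle : Q ≤ LinearMap.ker (ω.restrict s x) := by
      refine Submodule.span_le.2 ?_
      rintro _ ⟨⟨i, rfl⟩, hi⟩
      refine T.orthogonal _ (ht ⟨0, hpos⟩) _ (ht i) (fun h => hi ?_) _ hx _ (hct i)
      change (c i : V) ∈ t ⟨0, hpos⟩
      rw [h]
      exact hct i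
    exact fun y hy => hle hy
  have hsup : P ⊔ Q = ⊤ := by
    rw [eq_top_iff, ← hspan, Submodule.span_le]
    rintro _ ⟨i, rfl⟩
    by_cases hi : c i ∈ P
    · exact Submodule.mem_sup_left hi
    · exact Submodule.mem_sup_right (Submodule.subset_span ⟨⟨i, rfl⟩, hi⟩)
  have hdisj : Disjoint P Q := by
    rw [Submodule.disjoint_def]
    intro x hxP hxQ
    refine hs x fun y => ?_
    obtain ⟨a, ha, b, hb, rfl⟩ := Submodule.mem_sup.1 (hsup ▸ Submodule.mem_top : y ∈ P ⊔ Q)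
    have h1 : ω.restrict s x a = 0 := hω.isRefl _ _ (ho a ha x hxQ)
    rw [map_add, h1, ho x hxP b hb, add_zero]
  refine ⟨P, Q, ?_, ?_, ⟨hdisj, codisjoint_iff.2 hsup⟩, ho, fun i => ?_⟩
  · intro hP
    have : c ⟨0, hpos⟩ ∈ P := hct _
    rw [hP, Submodule.mem_bot] at this
    exact hc _ this
  · intro hQ
    rw [hQ, sup_bot_eq] at hsup
    refine hsT _ (ht ⟨0, hpos⟩) fun x hx => ?_
    have : (⟨x, hx⟩ : s) ∈ P := hsup ▸ Submodule.mem_top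
    exact this
  · by_cases hi : c i ∈ P
    · exact Or.inl hi
    · exact Or.inr (Submodule.subset_span ⟨⟨i, rfl⟩, hi⟩)

/-- If a subspace in `S` is contained in a subspace in `T`, the projection onto it preserves every
subspace in `T`. -/
lemma splitEquiv_mem_of_le (hω : ω.IsAlt) (hn : ∀ x, (∀ y, ω x y = 0) → x = 0)
    {S T : SymplecticSplitting ω} (e : FamilyOrdering S.parts) (r : Fin (Fintype.card S.parts))
    {t' : Submodule K V} (ht' : t' ∈ T.parts) (hr : (e.1 r).1 ≤ t') {t : Submodule K V}
    (ht : t ∈ T.parts) {x : V} (hx : x ∈ t) : (S.splitEquiv e x r : V) ∈ t := by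
  by_cases htt : t' = t
  · exact htt ▸ hr (S.splitEquiv e x r).2
  · have h0 : S.splitEquiv e x r = 0 := by
      refine S.eq_zero_of_restrict hn (e.1 r).2 _ fun y => ?_
      have h1 : ω x y = 0 := hω.isRefl _ _ (T.orthogonal _ ht' _ ht htt _ (hr y.2) _ hx)
      rw [← S.sum_splitEquiv e x, map_sum, LinearMap.sum_apply,
        Finset.sum_eq_single r (fun q _ hq => ?_) (by simp)] at h1
      · exact h1
      · exact S.orthogonal _ (e.1 q).2 _ (e.1 r).2
          (fun h => hq (e.2.injective (Subtype.ext h))) _ (S.splitEquiv e x q).2 _ y.2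
    rw [h0]
    exact zero_mem t

variable [Finite V]

/-- The coproduct along a splitting `S`, read modulo separated apartments, annihilates the
products over a splitting `T` unless `S` refines `T`. -/
lemma joinFunctional_stProd_eq_zero (hω : ω.IsAlt) (hn : ∀ x, (∀ y, ω x y = 0) → x = 0)
    {S T : SymplecticSplitting ω} (e : FamilyOrdering S.parts) (e' : FamilyOrdering T.parts)
    (h : ¬ ∀ s ∈ S.parts, ∃ t ∈ T.parts, s ≤ t)
    (l : ∀ j, StNS (ω.restrict (e.1 j).1) →ₗ[ℚ] ℚ) (x : ∀ j, Steinberg K (e'.1 j).1) :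
    joinFunctional (S.splitEquiv e) (fun j => l j ∘ₗ (stSep (ω.restrict (e.1 j).1)).mkQ)
      (stProd (T.splitEquiv e') x) = 0 := by
  have hex : ∃ r, ∀ t ∈ T.parts, ¬ (e.1 r).1 ≤ t := by
    push Not at h
    obtain ⟨s, hs, hst⟩ := h
    obtain ⟨r, hr⟩ := e.2.surjective ⟨s, hs⟩
    exact ⟨r, by rw [hr]; exact hst⟩
  -- the first subspace in the given order of `S` which is contained in no subspace in `T`
  obtain ⟨s₀, hs₀, hmin⟩ := WellFounded.has_min (wellFounded_lt (α := Fin (Fintype.card S.parts)))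
    {r | ∀ t ∈ T.parts, ¬ (e.1 r).1 ≤ t} hex
  have hlt : ∀ r < s₀, ∃ t ∈ T.parts, (e.1 r).1 ≤ t := by
    intro r hr
    by_contra hne
    push Not at hne
    exact hmin r hne hr
  have hmem := multilinear_mem_of_span (stProd (T.splitEquiv e'))
    (LinearMap.ker (joinFunctional (S.splitEquiv e)
      fun j => l j ∘ₗ (stSep (ω.restrict (e.1 j).1)).mkQ))
    (fun j => {z : Steinberg K (e'.1 j).1 | ∃ B hB, z = apartment rfl B hB}) ?_ x
    (fun j => by rw [span_apartment_eq_top]; exact Submodule.mem_top)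
  · exact hmem
  intro z hz
  choose B hB hz using hz
  obtain rfl : z = _ := funext hz
  have hprod := stProd_apartment (T.splitEquiv e') B hB
  rw [hprod, LinearMap.mem_ker]
  refine joinFunctional_apartment_eq_zero _ _ s₀ _ fun b hb hb0 hne => ?_
  rw [LinearMap.comp_apply]
  have hsep : apartment rfl (fun j => S.splitEquiv e (b j) s₀) hne ∈
      stSep (ω.restrict (e.1 s₀).1) := by
    refine apartment_mem_stSep_of_not_le hω T (S.eq_zero_of_restrict hn (e.1 s₀).2)
      (fun h0 => S.bot_notMem (h0 ▸ (e.1 s₀).2)) hs₀ hne fun i => ?_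
    obtain ⟨k, hk⟩ := hb i
    obtain ⟨⟨q, k⟩, rfl⟩ := (blockEquiv (T.splitEquiv e')).surjective k
    rw [concat_blockEquiv, T.blockInc_splitEquiv e' q (B q k)] at hk
    have hbt : b i ∈ (e'.1 q).1 := hk ▸ (B q k).2
    refine ⟨_, (e'.1 q).2, ?_⟩
    have hsum := S.sum_splitEquiv e (b i)
    rw [← Finset.add_sum_erase _ _ (Finset.mem_univ s₀)] at hsum
    rw [eq_sub_of_add_eq hsum]
    refine Submodule.sub_mem _ hbt (Submodule.sum_mem _ fun r hr => ?_)
    rcases lt_or_gt_of_ne (Finset.ne_of_mem_erase hr) with hr | hr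
    · obtain ⟨t', ht', hrt⟩ := hlt r hr
      exact splitEquiv_mem_of_le hω hn e r ht' hrt (e'.1 q).2 hbt
    · rw [hb0 i r hr]
      exact zero_mem _
  rw [Submodule.mkQ_apply, (Submodule.Quotient.mk_eq_zero _).2 hsep, map_zero]

variable (hω : ω.IsAlt) (hn : ∀ x, (∀ y, ω x y = 0) → x = 0)
    (sec : ∀ s : Submodule K V, StNS (ω.restrict s) →ₗ[ℚ] Steinberg K s)

lemma splitSum_injective (hsec : ∀ s x, (stSep (ω.restrict s)).mkQ (sec s x) = x) :
    Function.Injective (splitSum hω hn sec) := by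
  let _ := Fintype.ofFinite (SymplecticSplitting ω)
  rw [injective_iff_map_eq_zero]
  intro y hy
  by_contra hy0
  obtain ⟨S₁, hS₁⟩ : ∃ S, y S ≠ 0 := by
    by_contra hne
    push Not at hne
    exact hy0 (DFinsupp.ext hne)
  obtain ⟨S, hS, hmin⟩ := Finset.exists_min_image (Finset.univ.filter fun S => y S ≠ 0)
    (fun S => S.parts.card) ⟨S₁, by simpa using hS₁⟩
  replace hS : y S ≠ 0 := (Finset.mem_filter.1 hS).2
  obtain ⟨e⟩ := exists_familyOrdering S
  refine hS (UnorderedTensor.eq_zero e (y S) fun l => ⟨joinFunctional (S.splitEquiv e)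
    (fun j => l j ∘ₗ (stSep (ω.restrict (e.1 j).1)).mkQ) ∘ₗ splitProd hω hn sec S, ?_, ?_⟩)
  · set L := joinFunctional (S.splitEquiv e) (fun j => l j ∘ₗ (stSep (ω.restrict (e.1 j).1)).mkQ)
    have hsum : splitSum hω hn sec y = ∑ T, splitProd hω hn sec T (y T) := by
      conv_lhs => rw [← DirectSum.sum_univ_of y]
      rw [map_sum]
      exact Finset.sum_congr rfl fun T _ => splitSum_lof hω hn sec T (y T)
    rw [hy] at hsum
    have hL := congrArg L hsum
    rw [map_zero, map_sum, Finset.sum_eq_single S (fun T _ hTS => ?_) (by simp)] at hL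
    · exact hL.symm
    · by_cases hT : y T = 0
      · rw [hT, map_zero, map_zero]
      · have hcard := hmin T (by simpa using hT)
        have hLT : L ∘ₗ splitProd hω hn sec T = 0 := by
          refine UnorderedTensor.hom_ext fun e' f => ?_
          rw [LinearMap.comp_apply, LinearMap.zero_apply, splitProd_mk]
          exact joinFunctional_stProd_eq_zero hω hn e e'
            (fun h => hTS (SymplecticSplitting.eq_of_refines h hcard).symm) l _
        exact DFunLike.congr_fun hLT (y T)
  · intro f
    rw [LinearMap.comp_apply, splitProd_mk, joinFunctional_stProd]
    refine Finset.prod_congr rfl fun j _ => ?_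
    rw [LinearMap.comp_apply, hsec]

end SplittingSumInjective

/-! ### Equivariance -/

section EquivariantSections

open scoped Classical
open LinearMap (BilinForm)
open Module

variable {K V : Type*} [Field K] [AddCommGroup V] [Module K V] {ω : BilinForm K V}

lemma mkQ_map_restrict (φ : ω.IsometryEquiv ω) (s t : Submodule K V)
    (h : s.map (φ.toLinearEquiv : V →ₗ[K] V) = t) (x : Steinberg K s) :
    (stSep (ω.restrict t)).mkQ (Steinberg.map (φ.toLinearEquiv.ofSubmodules s t h) x) =
      partMap φ s t h ((stSep (ω.restrict s)).mkQ x) := rfl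

variable {G : Type*} (ρ : G → ω.IsometryEquiv ω)
  (sec : ∀ s : Submodule K V, StNS (ω.restrict s) →ₗ[ℚ] Steinberg K s)

/-- The conjugate by `A` of a section of the projection onto the nonseparated quotient. -/
def conjSection (A : G) (s : Submodule K V) : StNS (ω.restrict s) →ₗ[ℚ] Steinberg K s :=
  Steinberg.map ((ρ A).toLinearEquiv.ofSubmodules s _ rfl).symm ∘ₗ
    sec (s.map ((ρ A).toLinearEquiv : V →ₗ[K] V)) ∘ₗ partMap (ρ A) s _ rfl

lemma conjSection_apply (A : G) (s u : Submodule K V)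
    (h : s.map ((ρ A).toLinearEquiv : V →ₗ[K] V) = u) (x : StNS (ω.restrict s)) :
    conjSection ρ sec A s x =
      Steinberg.map ((ρ A).toLinearEquiv.ofSubmodules s u h).symm
        (sec u (partMap (ρ A) s u h x)) := by
  subst h
  rfl

lemma map_conjSection [Mul G] (hρ : ∀ A B x, ρ A (ρ B x) = ρ (A * B) x) (A B : G)
    (s t : Submodule K V) (h : s.map ((ρ B).toLinearEquiv : V →ₗ[K] V) = t)
    (x : StNS (ω.restrict s)) :
    Steinberg.map ((ρ B).toLinearEquiv.ofSubmodules s t h) (conjSection ρ sec (A * B) s x) =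
      conjSection ρ sec A t (partMap (ρ B) s t h x) := by
  have hu : s.map ((ρ (A * B)).toLinearEquiv : V →ₗ[K] V) =
      t.map ((ρ A).toLinearEquiv : V →ₗ[K] V) := by
    rw [← h]
    exact (map_map_of_comp (ρ B) (ρ A) (ρ (A * B)) (hρ A B) s).symm
  rw [conjSection_apply ρ sec (A * B) s _ hu, conjSection_apply ρ sec A t _ rfl,
    partMap_partMap (ρ B) (ρ A) (ρ (A * B)) (hρ A B) s t _ h rfl hu, ← Steinberg.map_trans]
  congr 1
  refine congrArg Steinberg.map (LinearEquiv.ext fun y => ?_)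
  obtain ⟨y, rfl⟩ := ((ρ (A * B)).toLinearEquiv.ofSubmodules s _ hu).surjective y
  rw [LinearEquiv.trans_apply, LinearEquiv.symm_apply_apply, LinearEquiv.eq_symm_apply]
  exact Subtype.ext (hρ A B y)

lemma mkQ_conjSection (hsec : ∀ s x, (stSep (ω.restrict s)).mkQ (sec s x) = x) (A : G)
    (s : Submodule K V) (x : StNS (ω.restrict s)) :
    (stSep (ω.restrict s)).mkQ (conjSection ρ sec A s x) = x := by
  obtain ⟨y, rfl⟩ := Submodule.mkQ_surjective _ x
  set t := s.map ((ρ A).toLinearEquiv : V →ₗ[K] V) with ht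
  have h := hsec t (partMap (ρ A) s t rfl ((stSep (ω.restrict s)).mkQ y))
  rw [← mkQ_map_restrict] at h
  have h' := stSep_le_comap (restrictIsometry (ρ A) s t rfl).symm ((Submodule.Quotient.eq _).1 h)
  rw [Submodule.mem_comap, map_sub] at h'
  refine (Submodule.Quotient.eq _).2 ?_
  have hy : Steinberg.map (restrictIsometry (ρ A) s t rfl).symm.toLinearEquiv
      (Steinberg.map ((ρ A).toLinearEquiv.ofSubmodules s t rfl) y) = y := by
    rw [← Steinberg.map_trans]
    refine Eq.trans (congrArg (Steinberg.map · y) (LinearEquiv.ext fun z => ?_))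
      (Steinberg.map_refl y)
    exact ((ρ A).toLinearEquiv.ofSubmodules s t rfl).symm_apply_apply z
  rw [hy] at h'
  exact h'

/-- The average over a group of isometries of the conjugates of a section. -/
def averageSection [Fintype G] (s : Submodule K V) :
    StNS (ω.restrict s) →ₗ[ℚ] Steinberg K s :=
  (Fintype.card G : ℚ)⁻¹ • ∑ A, conjSection ρ sec A s

lemma averageSection_apply [Fintype G] (s : Submodule K V) (x : StNS (ω.restrict s)) :
    averageSection ρ sec s x = (Fintype.card G : ℚ)⁻¹ • ∑ A, conjSection ρ sec A s x := by
  simp [averageSection]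

lemma map_averageSection [Group G] [Fintype G] (hρ : ∀ A B x, ρ A (ρ B x) = ρ (A * B) x) (B : G)
    (s t : Submodule K V)
    (h : s.map ((ρ B).toLinearEquiv : V →ₗ[K] V) = t) (x : StNS (ω.restrict s)) :
    Steinberg.map ((ρ B).toLinearEquiv.ofSubmodules s t h) (averageSection ρ sec s x) =
      averageSection ρ sec t (partMap (ρ B) s t h x) := by
  rw [averageSection_apply, averageSection_apply, map_smul, map_sum,
    ← Equiv.sum_comp (Equiv.mulRight B)]
  congr 1
  exact Finset.sum_congr rfl fun A _ => map_conjSection ρ sec hρ A B s t h x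

lemma mkQ_averageSection [Fintype G] [Nonempty G]
    (hsec : ∀ s x, (stSep (ω.restrict s)).mkQ (sec s x) = x)
    (s : Submodule K V) (x : StNS (ω.restrict s)) :
    (stSep (ω.restrict s)).mkQ (averageSection ρ sec s x) = x := by
  rw [averageSection_apply, map_smul, map_sum]
  simp only [mkQ_conjSection ρ sec hsec, Finset.sum_const, Finset.card_univ]
  rw [← Nat.cast_smul_eq_nsmul ℚ, smul_smul, inv_mul_cancel₀, one_smul]
  exact Nat.cast_ne_zero.2 Fintype.card_ne_zero

lemma exists_section (s : Submodule K V) :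
    ∃ f : StNS (ω.restrict s) →ₗ[ℚ] Steinberg K s, ∀ x, (stSep (ω.restrict s)).mkQ (f x) = x := by
  obtain ⟨f, hf⟩ := LinearMap.exists_rightInverse_of_surjective (stSep (ω.restrict s)).mkQ
    (Submodule.range_mkQ _)
  exact ⟨f, DFunLike.congr_fun hf⟩

variable [Finite V] (hω : ω.IsAlt) (hn : ∀ x, (∀ y, ω x y = 0) → x = 0)

/-- The map `splitProd` is compatible with isometries which preserve the sections. -/
lemma map_splitProd (φ : ω.IsometryEquiv ω)
    (hφ : ∀ (s t : Submodule K V) (h : s.map (φ.toLinearEquiv : V →ₗ[K] V) = t)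
      (x : StNS (ω.restrict s)), Steinberg.map (φ.toLinearEquiv.ofSubmodules s t h) (sec s x) =
        sec t (partMap φ s t h x))
    {S S' : SymplecticSplitting ω} (h : S.map φ = S') (y : StNSSplit S) :
    Steinberg.map φ.toLinearEquiv (splitProd hω hn sec S y) =
      splitProd hω hn sec S' (StNSSplit.map φ h y) := by
  have key : Steinberg.map φ.toLinearEquiv ∘ₗ splitProd hω hn sec S =
      splitProd hω hn sec S' ∘ₗ StNSSplit.map φ h := by
    refine UnorderedTensor.hom_ext fun e f => ?_
    rw [LinearMap.comp_apply, LinearMap.comp_apply, splitProd_mk, StNSSplit.map,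
      UnorderedTensor.map_mk, orderedTensorMap_apply, splitProd_mk]
    refine map_stProd (S.splitEquiv e) (S'.splitEquiv (e.transport (partsEquiv φ h)))
      (finCongr (Fintype.card_congr (partsEquiv φ h))) φ.toLinearEquiv
      (fun j => φ.toLinearEquiv.ofSubmodules (e.1 j).1 (partsEquiv φ h (e.1 j)).1
        (map_eq_partsEquiv φ h (e.1 j))) (fun j w => ?_) (fun j => ?_) _ _ (fun j => ?_)
    · rw [S.blockInc_splitEquiv e j w]
      exact (S'.blockInc_splitEquiv (e.transport (partsEquiv φ h))
        (finCongr (Fintype.card_congr (partsEquiv φ h)) j)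
        (φ.toLinearEquiv.ofSubmodules (e.1 j).1 (partsEquiv φ h (e.1 j)).1
          (map_eq_partsEquiv φ h (e.1 j)) w)).symm
    · exact S.even_finrank hω hn (e.1 j).2
    · exact (hφ _ _ _ (f j)).symm
  exact DFunLike.congr_fun key y

end EquivariantSections

/-! ### Induced representations -/

section Induced

open Representation
open scoped MonoidAlgebra

variable {k H : Type*} [CommRing k] [Group H]

section

variable {G : Type*} [Group G] (φ : G →* H) {A B : Type*} [AddCommGroup A] [Module k A]
  (ρ : Representation k G A) [AddCommGroup B] [Module k B] (σ : Representation k H B)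

/-- The map from an induced representation given by a `G`-equivariant map `f`. It takes the class
of `h ⊗ a` to `h⁻¹ f(a)`. -/
def indLift (f : A →ₗ[k] B) (hf : ∀ g a, f (ρ g a) = σ (φ g) (f a)) : IndV φ ρ →ₗ[k] B :=
  Coinvariants.lift _ (TensorProduct.lift ((Finsupp.lift _ _ _ fun h => σ h⁻¹ ∘ₗ f) ∘ₗ
      (MonoidAlgebra.coeffLinearEquiv k).toLinearMap))
    fun g => by
      ext h x
      simp only [LinearMap.coe_comp, Function.comp_apply, MonoidAlgebra.lsingle_apply]
      simp [ofMulAction_single, mul_inv_rev, hf]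

lemma indLift_mk (f : A →ₗ[k] B) (hf : ∀ g a, f (ρ g a) = σ (φ g) (f a)) (h : H) (a : A) :
    indLift φ ρ σ f hf (IndV.mk φ ρ h a) = σ h⁻¹ (f a) := by
  simp [indLift]

lemma IndV.mk_mul (g : G) (h : H) (a : A) :
    IndV.mk φ ρ (φ g * h) (ρ g a) = IndV.mk φ ρ h a := by
  have key := Coinvariants.mk_self_apply (Representation.tprod ((leftRegular k H).comp φ) ρ) g
    (TensorProduct.mk k _ _ (.single h 1) a)
  refine Eq.trans ?_ key
  simp [ofMulAction_single]

end

open scoped Classical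

variable {X : Type*} [MulAction H X] {M : X → Type*} [∀ x, AddCommGroup (M x)]
  [∀ x, Module k (M x)] (σ : Representation k H (⨁ x, M x))

/-- If a group permutes the summands of a direct sum in the way it permutes the indices, the sum is
the direct sum of the representations induced from the stabilizers of representatives of the
orbits. -/
theorem nonempty_equiv_directSum_ind
    (hσ : ∀ h x m, ∃ m', σ h (DirectSum.lof k X M x m) = DirectSum.lof k X M (h • x) m')
    (ρ : ∀ x, Representation k (MulAction.stabilizer H x) (M x))
    (hρ : ∀ x g m, σ g.1 (DirectSum.lof k X M x m) = DirectSum.lof k X M x (ρ x g m))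
    (U : Set X) (hU : ∀ x, ∃! y, y ∈ U ∧ y ∈ MulAction.orbit H x) :
    Nonempty (Representation.Equiv σ (Representation.directSum fun x : U =>
      Representation.ind (MulAction.stabilizer H x.1).subtype (ρ x.1))) := by
  have hg : ∀ x, ∃ (y : U) (g : H), g • y.1 = x := by
    intro x
    obtain ⟨y, ⟨hyU, h, hy⟩, -⟩ := hU x
    exact ⟨⟨y, hyU⟩, h⁻¹, inv_smul_eq_iff.2 hy.symm⟩
  choose y g hg using hg
  have huniq : ∀ (x : U) (h : H), y (h • x.1) = x := by
    intro x h
    refine Subtype.ext ((hU x.1).unique ⟨(y _).2, ?_⟩ ⟨x.2, MulAction.mem_orbit_self _⟩)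
    refine ⟨(g (h • x.1))⁻¹ * h, ?_⟩
    change ((g (h • x.1))⁻¹ * h) • x.1 = _
    rw [mul_smul, inv_smul_eq_iff, hg]
  let N : U → Type _ := fun x => IndV (MulAction.stabilizer H x.1).subtype (ρ x.1)
  let F : (⨁ x : U, N x) →ₗ[k] ⨁ x, M x := DirectSum.toModule k _ _ fun x =>
    indLift (MulAction.stabilizer H x.1).subtype (ρ x.1) σ (DirectSum.lof k X M x.1)
      fun g m => (hρ x.1 g m).symm
  have hF : ∀ x h a, F (DirectSum.lof k U N x (IndV.mk _ _ h a)) =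
      σ h⁻¹ (DirectSum.lof k X M x.1 a) := by
    intro x h a
    rw [DirectSum.toModule_lof]
    exact indLift_mk _ _ _ _ _ h a
  let I : (⨁ x, M x) →ₗ[k] ⨁ x : U, N x := DirectSum.toModule k _ _ fun x =>
    DirectSum.lof k U N (y x) ∘ₗ IndV.mk _ _ (g x)⁻¹ ∘ₗ DirectSum.component k X M (y x).1 ∘ₗ
      σ (g x)⁻¹ ∘ₗ DirectSum.lof k X M x
  have hI : ∀ x m, I (DirectSum.lof k X M x m) = DirectSum.lof k U N (y x)
      (IndV.mk _ _ (g x)⁻¹ (DirectSum.component k X M (y x).1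
        (σ (g x)⁻¹ (DirectSum.lof k X M x m)))) := by
    intro x m
    rw [DirectSum.toModule_lof]
    rfl
  have hFI : F ∘ₗ I = LinearMap.id := by
    refine DirectSum.linearMap_ext k fun x => LinearMap.ext fun m => ?_
    change F (I (DirectSum.lof k X M x m)) = DirectSum.lof k X M x m
    have key : ∀ (h : H) (x' : X), h • x = x' → DirectSum.lof k X M x'
        (DirectSum.component k X M x' (σ h (DirectSum.lof k X M x m))) =
          σ h (DirectSum.lof k X M x m) := by
      rintro h _ rfl
      obtain ⟨m', hm'⟩ := hσ h x m
      rw [hm', DirectSum.component.lof_self]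
    rw [hI, hF, inv_inv, key _ _ (by rw [inv_smul_eq_iff, hg]), ← Module.End.mul_apply, ← map_mul,
      mul_inv_cancel, map_one, Module.End.one_apply]
  have hIF : I ∘ₗ F = LinearMap.id := by
    refine DirectSum.linearMap_ext k fun x => IndV.hom_ext _ _ fun h => LinearMap.ext fun a => ?_
    change I (F (DirectSum.lof k U N x (IndV.mk _ _ h a))) = DirectSum.lof k U N x (IndV.mk _ _ h a)
    rw [hF]
    obtain ⟨m', hm'⟩ := hσ h⁻¹ x.1 a
    have key : ∀ (x' : U) (g' : H), x' = x → g' • x'.1 = h⁻¹ • x.1 → DirectSum.lof k U N x'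
      (IndV.mk _ _ g'⁻¹ (DirectSum.component k X M x'.1
        (σ g'⁻¹ (σ h⁻¹ (DirectSum.lof k X M x.1 a))))) =
        DirectSum.lof k U N x (IndV.mk _ _ h a) := by
      rintro x' g' rfl hg'
      have hmem : g'⁻¹ * h⁻¹ ∈ MulAction.stabilizer H x'.1 := by
        rw [MulAction.mem_stabilizer_iff, mul_smul, ← hg', inv_smul_smul]
      rw [← Module.End.mul_apply, ← map_mul, hρ x'.1 ⟨_, hmem⟩, DirectSum.component.lof_self]
      congr 1
      rw [← IndV.mk_mul _ _ ⟨_, hmem⟩ h a]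
      simp
    rw [hm', hI, ← hm']
    exact key _ _ (huniq x h⁻¹) (hg _)
  refine ⟨(Representation.Equiv.mk (LinearEquiv.ofLinearMap F I hFI hIF) fun h => ?_).symm⟩
  refine DirectSum.linearMap_ext k fun x => IndV.hom_ext _ _ fun h' => LinearMap.ext fun a => ?_
  change F (DirectSum.lmap _ (DirectSum.lof k U N x (IndV.mk _ _ h' a))) =
    σ h (F (DirectSum.lof k U N x (IndV.mk _ _ h' a)))
  rw [DirectSum.lmap_lof, ind_mk, hF, hF, ← Module.End.mul_apply, ← map_mul, mul_inv_rev, inv_inv]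

end Induced

/-! ### The standard symplectic space -/

section StandardForm

open scoped Classical
open Matrix

variable (g p : ℕ)

lemma stdForm_apply (x y : SympSpace g p) :
    stdForm g p x y = x ⬝ᵥ Matrix.J (Fin g) (ZMod p) *ᵥ y :=
  Matrix.toBilin'_apply' _ x y

lemma stdForm_isAlt : (stdForm g p).IsAlt := by
  intro x
  rw [stdForm_apply, ← Sum.elim_comp_inl_inr x, Matrix.J, Matrix.fromBlocks_mulVec,
    sumElim_dotProduct_sumElim]
  simp [dotProduct_comm, Matrix.neg_mulVec]

lemma stdForm_nondegenerate [Fact p.Prime] (x : SympSpace g p)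
    (h : ∀ y, stdForm g p x y = 0) : x = 0 :=
  (LinearMap.BilinForm.nondegenerate_toBilin'_of_det_ne_zero' _
    (Matrix.isUnit_det_J (Fin g) (ZMod p)).ne_zero).1 x h

variable [Fact p.Prime]

theorem nonempty_equiv_stNSSumRep (hg : 1 ≤ g) :
    Nonempty (Representation.Equiv ((steinbergSL g p).comp (spToSL g p)) (stNSSumRep g p)) := by
  let _ := Fintype.ofFinite (Matrix.symplecticGroup (Fin g) (ZMod p))
  have : Nontrivial (SympSpace g p) :=
    have : Nonempty (Fin g) := ⟨⟨0, hg⟩⟩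
    inferInstance
  choose sec₀ hsec₀ using exists_section (ω := stdForm g p)
  let sec := averageSection (spIsometry (g := g) (p := p)) sec₀
  have hsec : ∀ s x, (stSep ((stdForm g p).restrict s)).mkQ (sec s x) = x :=
    mkQ_averageSection _ _ hsec₀
  let F := splitSum (stdForm_isAlt g p) (stdForm_nondegenerate g p) sec
  let E := LinearEquiv.ofBijective F
    ⟨splitSum_injective _ _ sec hsec, splitSum_surjective _ _ sec hsec⟩
  have hF : ∀ A, F ∘ₗ stNSSumRep g p A = (steinbergSL g p).comp (spToSL g p) A ∘ₗ F := by
    intro A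
    refine DirectSum.linearMap_ext ℚ fun S => LinearMap.ext fun y => ?_
    have h := map_splitProd sec (stdForm_isAlt g p) (stdForm_nondegenerate g p) (spIsometry A)
      (map_averageSection _ sec₀ spIsometry_mul A) rfl y
    rw [← splitSum_lof, ← splitSum_lof] at h
    have h2 := congrArg F (summandMap_lof A S (S.map (spIsometry A)) rfl y)
    exact h2.trans h.symm
  exact ⟨(Representation.Equiv.mk E hF).symm⟩

lemma stNSSumRep_lof (A : Matrix.symplecticGroup (Fin g) (ZMod p))
    (S S' : SymplecticSplitting (stdForm g p)) (h : S.map (spIsometry A) = S') (y : StNSSplit S) :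
    stNSSumRep g p A
        (DirectSum.lof ℚ _ (fun S : SymplecticSplitting (stdForm g p) => StNSSplit S) S y) =
      DirectSum.lof ℚ _ (fun S : SymplecticSplitting (stdForm g p) => StNSSplit S) S'
        (StNSSplit.map (spIsometry A) h y) :=
  summandMap_lof A S S' h y

end StandardForm

end

theorem theorem4p3 (g p : ℕ) [Fact p.Prime] (hg : 1 ≤ g) :
    Nonempty (Representation.Equiv ((steinbergSL g p).comp (spToSL g p)) (stNSSumRep g p)) ∧
    ∀ U : Set (SymplecticSplitting (stdForm g p)),
      (∀ S : SymplecticSplitting (stdForm g p),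
        ∃! T, T ∈ U ∧ T ∈ MulAction.orbit (Matrix.symplecticGroup (Fin g) (ZMod p)) S) →
      Nonempty (Representation.Equiv ((steinbergSL g p).comp (spToSL g p))
        (Representation.directSum fun S : U =>
          Representation.ind
            (MulAction.stabilizer (Matrix.symplecticGroup (Fin g) (ZMod p)) S.1).subtype
            (stNSStabilizerRep S.1))) := by
  have h := nonempty_equiv_stNSSumRep g p hg
  refine And.intro h fun U hU => ?_
  have h' := nonempty_equiv_directSum_ind (M := fun S => StNSSplit S) (stNSSumRep g p)
    (fun A S y => ⟨StNSSplit.map (spIsometry A) rfl y, stNSSumRep_lof g p A S _ rfl y⟩)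
    stNSStabilizerRep (fun S A y => stNSSumRep_lof g p A.1 S S A.2 y) U hU
  refine h.elim fun E => h'.elim fun E' => ?_
  exact Nonempty.intro (E.trans E')
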